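/- **Setting.** There are $n$ agents $A=\{1,\dots,n\}$; agent $i$ has a private cost $c_i\in\mathbb{Q}_{\ge 0}$. An auctioneer has a budget $B\in\mathbb{Q}_{>0}$, a normalized ($v(\emptyset)=0$) submodular valuation $v:2^A\to\mathbb{Q}_{\ge 0}$, and an independence system $\mathcal{I}\subseteq 2^A$ (that is, $\emptyset\in\mathcal{I}$ and $\mathcal{I}$ is closed under taking subsets). A *basis* of $S\subseteq A$ is a maximal independent set contained in $S$; $\mathrm{ur}(S)$ and $\mathrm{lr}(S)$ are the largest and the smallest cardinality of a basis of $S$. For real $p$, $(A,\mathcal{I})$ is a *$p$-system* if $\mathrm{ur}(S)\le p\cdot\mathrm{lr}(S)$ for all $S\subseteq A$. Let $\mathrm{OPT}(\mathbf{c})=\max\{v(S): S\in\mathcal{I},\ \sum_{i\in S}c_i\le B\}$. A deterministic mechanism maps every vector $\mathbf{b}\in\mathbb{Q}_{\ge0}^n$ of declared costs to a set $f(\mathbf{b})\subseteq A$ of winners and payments $\pi_1(\mathbf{b}),\dots,\pi_n(\mathbf{b})\in\mathbb{Q}$. Agent $i$ has utility $\pi_i(\mathbf{b})-c_i$ if $i\in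 f(\mathbf{b})$, and $\pi_i(\mathbf{b})$ otherwise. The mechanism is *truthful* if declaring $b_i=c_i$ is a dominant strategy for every agent $i$; *individually rational* if $\pi_i(\mathbf{b})\ge 0$ for all $i$ and $\pi_i(\mathbf{b})\ge b_i$ for all $i\in f(\mathbf{b})$; *budget-feasible* if $\sum_i\pi_i(\mathbf{b})\le B$ for all $\mathbf{b}$. A randomized mechanism is given by one program for all instances. Its input consists of $n$, $B$, $\mathbf{b}$ and a number of independent fair coin tosses that is polynomial in $n$; the parameter $p$ is not part of the input. It has access to a value oracle for $v$ and a membership oracle for $\mathcal{I}$. It runs in *polynomial time* if, for every outcome of the coin tosses, the number of bit-cost-weighted steps that it takes to compute the winners and the payments is at most a fixed polynomial in $n$ plus the numbers of bits of $B$, of the $b_i$, and of the longest value of $v$. (The steps are rational arithmetic, comparisons, memory accesses and oracle queries; each is charged the number of bits of its operands and of its result, and a query also the $n$ bits of the queried set.) **Theorem.** 1. There is a polynomial-time randomized mechanism such that for every instance $(n,v,\mathcal{I},B)$ as above with $v$ monotone ($v(S)\le v(T)$ for $S\subseteq T$), for every outcome of the coin tosses, the resulting deterministic mechanism is truthful (so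 the randomized mechanism is universally truthful), individually rational and budget-feasible, pays nothing to agents who are not selected, and always selects a set in $\mathcal{I}$; and, whenever $\mathcal{I}$ is a $p$-system, the random set $S$ selected at the costs $\mathbf{c}$ satisfies $$138\,(p+10)\cdot\mathbb{E}[v(S)]\ \ge\ \mathrm{OPT}(\mathbf{c})\qquad\text{for all }\mathbf{c}\in\mathbb{Q}_{\ge0}^n .$$ 2. There is a polynomial-time randomized mechanism with the same properties for all (not necessarily monotone) normalized submodular $v:2^A\to\mathbb{Q}_{\ge0}$, with $$410\,(p+10)\cdot\mathbb{E}[v(S)]\ \ge\ \mathrm{OPT}(\mathbf{c})\qquad\text{for all }\mathbf{c}\in\mathbb{Q}_{\ge0}^n .$$ In particular both are $O(p)$-approximation mechanisms. -/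

import Mathlib

open scoped NNRat

namespace Procurement

/-! ### Valuations and independence systems on the set of agents `Fin n` -/

/-- Submodularity: the marginal value of an agent does not increase when the set grows.
The inequality `v(i | T) ≤ v(i | S)` is written between differences of rational numbers. -/
def IsSubmodular {n : ℕ} (v : Finset (Fin n) → ℚ≥0) : Prop :=
  ∀ S T : Finset (Fin n), S ⊆ T → ∀ i, i ∉ T →
    (v (insert i T) : ℚ) - (v T : ℚ) ≤ (v (insert i S) : ℚ) - (v S : ℚ)

/-- Independence system: contains the empty set and is closed under taking subsets. -/
def IsIndependenceSystem {n : ℕ} (I : Finset (Finset (Fin n))) : Prop :=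
  ∅ ∈ I ∧ ∀ S T : Finset (Fin n), S ⊆ T → T ∈ I → S ∈ I

/-- The bases of `S`: the maximal independent sets contained in `S`. -/
def bases {n : ℕ} (I : Finset (Finset (Fin n))) (S : Finset (Fin n)) : Set (Finset (Fin n)) :=
  {T | Maximal (fun X => X ∈ I ∧ X ⊆ S) T}

/-- The cardinality of a largest basis of `S`. -/
noncomputable def upperRank {n : ℕ} (I : Finset (Finset (Fin n))) (S : Finset (Fin n)) : ℕ :=
  sSup (Finset.card '' bases I S)

/-- The cardinality of a smallest basis of `S`. -/
noncomputable def lowerRank {n : ℕ} (I : Finset (Finset (Fin n))) (S : Finset (Fin n)) : ℕ :=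
  sInf (Finset.card '' bases I S)

/-- `p`-system: an independence system with `ur(S) / lr(S) ≤ p` for all `S`.  The quotient is
multiplied out; if `lr(S) = 0`, then the empty set is the only basis of `S` and `ur(S) = 0`. -/
def IsPSystem {n : ℕ} (I : Finset (Finset (Fin n))) (p : ℝ) : Prop :=
  IsIndependenceSystem I ∧ ∀ S : Finset (Fin n), (upperRank I S : ℝ) ≤ p * (lowerRank I S : ℝ)

/-- The public data of a procurement auction with `n` agents: the valuation of the auctioneer,
the family of independent sets, and the budget. -/
structure Auction (n : ℕ) where
  value : Finset (Fin n) → ℚ≥0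
  indep : Finset (Finset (Fin n))
  budget : ℚ≥0

/-- The value of an optimal solution: the largest value of an independent set whose total cost is
at most the budget. -/
def Auction.opt {n : ℕ} (A : Auction n) (c : Fin n → ℚ≥0) : ℚ≥0 :=
  (A.indep.filter fun S => ∑ i ∈ S, c i ≤ A.budget).sup A.value

/-! ### Mechanisms -/

/-- A deterministic mechanism: for every vector of declared costs, the set of winners and the
payment to every agent. -/
structure Mechanism (n : ℕ) where
  winners : (Fin n → ℚ≥0) → Finset (Fin n)
  payment : (Fin n → ℚ≥0) → Fin n → ℚ

namespace Mechanism

variable {n : ℕ}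

/-- The utility of agent `i` with true cost `ci` when `b` is declared; the cost is incurred only by
winners. -/
def utility (M : Mechanism n) (i : Fin n) (ci : ℚ≥0) (b : Fin n → ℚ≥0) : ℚ :=
  M.payment b i - (if i ∈ M.winners b then (ci : ℚ) else 0)

/-- Truthfulness: declaring the true cost is a dominant strategy of every agent. -/
def Truthful (M : Mechanism n) : Prop :=
  ∀ (i : Fin n) (ci : ℚ≥0) (b : Fin n → ℚ≥0),
    M.utility i ci b ≤ M.utility i ci (Function.update b i ci)

def IndividuallyRational (M : Mechanism n) : Prop :=
  ∀ (b : Fin n → ℚ≥0) (i : Fin n),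
    0 ≤ M.payment b i ∧ (i ∈ M.winners b → (b i : ℚ) ≤ M.payment b i)

def BudgetFeasible (M : Mechanism n) (B : ℚ≥0) : Prop :=
  ∀ b : Fin n → ℚ≥0, ∑ i, M.payment b i ≤ (B : ℚ)

/-- Agents that are not selected are not paid. -/
def PaysOnlyWinners (M : Mechanism n) : Prop :=
  ∀ (b : Fin n → ℚ≥0) (i : Fin n), i ∉ M.winners b → M.payment b i = 0

end Mechanism

/-! ### Programs with a value oracle and an independence oracle, and their running time

The memory consists of arrays of rational numbers, `s a i` being cell `i` of array `a`.  Every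
operation is charged the number of bits of the numbers that it handles. -/

/-- The number of bits of a rational number in binary. -/
def bitSize (q : ℚ) : ℕ := Nat.size q.num.natAbs + Nat.size q.den

abbrev Memory : Type := ℕ → ℕ → ℚ

/-- The set of agents that is stored in array `a` as an indicator vector. -/
def storedSet {n : ℕ} (s : Memory) (a : ℕ) : Finset (Fin n) :=
  Finset.univ.filter fun i => s a i ≠ 0

/-- Expressions.  `read a e` is the cell of array `a` with the index given by `e`, `le` is `1` or
`0`, and `value a`, `indep a` query the value oracle and the independence oracle at the set that is
stored in array `a`. -/
inductive Expr : Type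
  | const (q : ℚ)
  | read (a : ℕ) (e : Expr)
  | add (e f : Expr)
  | sub (e f : Expr)
  | mul (e f : Expr)
  | div (e f : Expr)
  | le (e f : Expr)
  | value (a : ℕ)
  | indep (a : ℕ)

def Expr.eval {n : ℕ} (A : Auction n) (s : Memory) : Expr → ℚ
  | const q => q
  | read a e => s a ⌊e.eval A s⌋₊
  | add e f => e.eval A s + f.eval A s
  | sub e f => e.eval A s - f.eval A s
  | mul e f => e.eval A s * f.eval A s
  | div e f => e.eval A s / f.eval A s
  | le e f => if e.eval A s ≤ f.eval A s then 1 else 0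
  | value a => (A.value (storedSet s a) : ℚ)
  | indep a => if storedSet s a ∈ A.indep then 1 else 0

/-- The time to evaluate an expression: one unit for every operation plus the number of bits of
every intermediate result; an oracle query also pays for the `n` bits of the queried set. -/
def Expr.time {n : ℕ} (A : Auction n) (s : Memory) : Expr → ℕ
  | const q => 1 + bitSize q
  | read a e => 1 + e.time A s + bitSize ((read a e).eval A s)
  | add e f => 1 + e.time A s + f.time A s + bitSize ((add e f).eval A s)
  | sub e f => 1 + e.time A s + f.time A s + bitSize ((sub e f).eval A s)
  | mul e f => 1 + e.time A s + f.time A s + bitSize ((mul e f).eval A s)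
  | div e f => 1 + e.time A s + f.time A s + bitSize ((div e f).eval A s)
  | le e f => 1 + e.time A s + f.time A s + bitSize ((le e f).eval A s)
  | value a => 1 + n + bitSize ((value a).eval A s)
  | indep a => 1 + n + bitSize ((indep a).eval A s)

/-- Commands.  `assign a e f` stores the value of `f` in cell `e` of array `a`; `cond e c d` runs
`c` if the value of `e` is not `0`, and `d` otherwise; `loop e c` evaluates `e` once and repeats `c`
that many times. -/
inductive Cmd : Type
  | skip
  | assign (a : ℕ) (e f : Expr)
  | seq (c d : Cmd)
  | cond (e : Expr) (c d : Cmd)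
  | loop (e : Expr) (c : Cmd)

/-- Execution of a command on a memory, together with a clock. -/
def Cmd.exec {n : ℕ} (A : Auction n) : Cmd → Memory × ℕ → Memory × ℕ
  | skip, (s, t) => (s, t + 1)
  | assign a e f, (s, t) =>
      (Function.update s a (Function.update (s a) ⌊e.eval A s⌋₊ (f.eval A s)),
        t + 1 + e.time A s + f.time A s)
  | seq c d, (s, t) => d.exec A (c.exec A (s, t + 1))
  | cond e c d, (s, t) =>
      if e.eval A s ≠ 0 then c.exec A (s, t + 1 + e.time A s)
      else d.exec A (s, t + 1 + e.time A s)
  | loop e c, (s, t) => (c.exec A)^[⌊e.eval A s⌋₊] (s, t + 1 + e.time A s)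

/-- A randomized program: a single program for all instances, which receives a number of
independent fair coin tosses that is polynomial in the number of agents. -/
structure RandomizedProgram where
  body : Cmd
  coins : Polynomial ℕ

namespace RandomizedProgram

variable {n : ℕ}

/-- The random bits received by the program on instances with `n` agents. -/
abbrev Coins (P : RandomizedProgram) (n : ℕ) : Type := Fin (P.coins.eval n) → Bool

/-- The initial memory: the number of agents in array `0`, the budget in array `1`, the declared
costs in array `2`, the coin tosses in array `3`; everything else is `0`. -/
def input (P : RandomizedProgram) (A : Auction n) (ω : P.Coins n) (b : Fin n → ℚ≥0) : Memory
  | 0, 0 => n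
  | 1, 0 => (A.budget : ℚ)
  | 2, i => if h : i < n then (b ⟨i, h⟩ : ℚ) else 0
  | 3, i => if h : i < P.coins.eval n then (if ω ⟨i, h⟩ then 1 else 0) else 0
  | _, _ => 0

/-- The final memory and the running time. -/
def run (P : RandomizedProgram) (A : Auction n) (ω : P.Coins n) (b : Fin n → ℚ≥0) : Memory × ℕ :=
  P.body.exec A (P.input A ω b, 0)

/-- The running time, with the auction, the coin tosses and the declared costs as input. -/
def time (P : RandomizedProgram) (A : Auction n) (ω : P.Coins n) (b : Fin n → ℚ≥0) : ℕ :=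
  (P.run A ω b).2

/-- The deterministic mechanism given by an outcome of the coin tosses: the program leaves the
winners in array `4`, as an indicator vector, and the payments in array `5`. -/
def mechanism (P : RandomizedProgram) (A : Auction n) (ω : P.Coins n) : Mechanism n where
  winners b := storedSet (P.run A ω b).1 4
  payment b i := (P.run A ω b).1 5 i

/-- The expected value of the set of winners over the uniform distribution of the coin tosses. -/
def expectedValue (P : RandomizedProgram) (A : Auction n) (b : Fin n → ℚ≥0) : ℚ≥0 :=
  (∑ ω : P.Coins n, A.value ((P.mechanism A ω).winners b)) / Fintype.card (P.Coins n)

end RandomizedProgram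

/-- The size of the input: the number of agents and the numbers of bits of the budget, of the
declared costs, and of the longest answer of the value oracle. -/
def inputSize {n : ℕ} (A : Auction n) (b : Fin n → ℚ≥0) : ℕ :=
  n + bitSize A.budget + ∑ i, bitSize (b i) + Finset.univ.sup fun S => bitSize (A.value S)

/-- `P` runs in polynomial time on the auctions in the class `K`. -/
def RandomizedProgram.PolynomialTime (P : RandomizedProgram) (K : ∀ n : ℕ, Auction n → Prop) :
    Prop :=
  ∃ f : Polynomial ℕ, ∀ (n : ℕ) (A : Auction n), K n A →
    ∀ (ω : P.Coins n) (b : Fin n → ℚ≥0), P.time A ω b ≤ f.eval (inputSize A b)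

/-- The instances of the problem: the budget is positive, the feasible sets form an independence
system, and the valuation is normalized and submodular. -/
def Auction.IsSubmodularAuction {n : ℕ} (A : Auction n) : Prop :=
  0 < A.budget ∧ IsIndependenceSystem A.indep ∧ A.value ∅ = 0 ∧ IsSubmodular A.value

/-- A solution of the problem on the auctions in the class `K` with the approximation ratio `ρ p`
for `p`-systems.  Every outcome of the coin tosses gives a mechanism that is truthful, individually
rational and budget-feasible, and that selects independent sets. -/
structure RandomizedProgram.Solves (P : RandomizedProgram) (K : ∀ n : ℕ, Auction n → Prop)
    (ρ : ℝ → ℝ) : Prop where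
  polynomialTime : P.PolynomialTime K
  universallyTruthful : ∀ (n : ℕ) (A : Auction n), K n A → ∀ ω : P.Coins n,
    (P.mechanism A ω).Truthful
  individuallyRational : ∀ (n : ℕ) (A : Auction n), K n A → ∀ ω : P.Coins n,
    (P.mechanism A ω).IndividuallyRational
  paysOnlyWinners : ∀ (n : ℕ) (A : Auction n), K n A → ∀ ω : P.Coins n,
    (P.mechanism A ω).PaysOnlyWinners
  budgetFeasible : ∀ (n : ℕ) (A : Auction n), K n A → ∀ ω : P.Coins n,
    (P.mechanism A ω).BudgetFeasible A.budget
  independent : ∀ (n : ℕ) (A : Auction n), K n A → ∀ (ω : P.Coins n) (b : Fin n → ℚ≥0),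
    (P.mechanism A ω).winners b ∈ A.indep
  approximation : ∀ (n : ℕ) (A : Auction n), K n A → ∀ p : ℝ, IsPSystem A.indep p →
    ∀ c : Fin n → ℚ≥0, (A.opt c : ℝ) ≤ ρ p * (P.expectedValue A c : ℝ)

end Procurement

namespace Procurement

/-! ### Bit lengths of the results of rational arithmetic -/

/-! One program serves both parts, because its analysis never uses monotonicity. It reaches the
ratio `96 * (q + 3)` for every rational `q ≥ 1` with `q ≥ p`, and a `q` below `p + 1` makes this
smaller than both claimed ratios.

The core is a posted-price greedy with a target `τ`. It keeps two disjoint independent solutions. In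
each round the pair of an agent and a solution with the largest marginal value `m` receives a single
take-it-or-leave-it offer: the price is `B * m / τ` if the value of the solution stays at most `τ`,
and an unacceptable price otherwise. Payments to a solution are therefore exactly `B / τ` times its
value, hence at most `B`. Each agent sees at most one offer, which is independent of its own bid;
this gives truthfulness and individual rationality.

A fair coin per agent splits the agents into a sample `R` and the rest. Greedy runs on the sample
with many targets give an estimate `L` of the optimum; sampled agents cannot win in this mode, so
they have no influence on their own outcome. The rest then play the greedy game with target `L / 6`,
and a coin selects one of the two solutions. With probability one half the mechanism instead offers
the whole budget to single agents by decreasing value, which secures the largest value `M` of an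
element of the optimal set `O`.

Approximation rests on `State.run_greedy_value`: either some solution reaches `τ - M`, or the value
of a feasible set of available agents is at most `p + 2` times the value of the two solutions
together, plus `2 * τ`. The proof charges the marginal values of the agents that are no longer
candidates. An agent blocked by independence is charged to an accepted marginal value, at most `p`
per accepted agent; an agent placed in the other solution is charged to that solution; an agent that
refused its price is charged to its cost. The two solutions are needed because `v` may decrease:
disjointness gives `v(O) ≤ v(O ∪ S) + v(O ∪ T)`.

Random splitting is handled by a second-moment argument. Additive weights `w` below `v` on the
subsets of `O` and with total `v(O)` exist by `IsSubmodular.exists_weights`. For every sample, the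
value achieved on the rest is bounded below by a concave quadratic in the sampled weight
(`quadratic_le_greedyValue`). The variance of this weight is at most `M * v(O) / 4`, so in
expectation the loss is a multiple of `M`, which the single-winner mode pays for
(`value_le_expectedValue`).

Running time is handled statically: the contents of an array are computed from a few others without
accumulation, so fixed multiples of the input size bound all cells, and every loop runs at most `n`
times (`Cmd.exec_le`, `Program.safe_body`). The simulation lemmas up to `Program.mechanism_eq`
identify the program with the abstract mechanism. -/

theorem size_mul_le (x y : ℕ) : Nat.size (x * y) ≤ Nat.size x + Nat.size y := by
  rw [Nat.size_le, pow_add]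
  exact Nat.mul_lt_mul'' (Nat.lt_size_self x) (Nat.lt_size_self y)

theorem size_add_le (x y : ℕ) : Nat.size (x + y) ≤ Nat.size x + Nat.size y + 1 := by
  rw [Nat.size_le]
  have hx := Nat.lt_size_self x
  have hy := Nat.lt_size_self y
  have h1 : 2 ^ Nat.size x ≤ 2 ^ (Nat.size x + Nat.size y) :=
    Nat.pow_le_pow_right (by norm_num) (by omega)
  have h2 : 2 ^ Nat.size y ≤ 2 ^ (Nat.size x + Nat.size y) :=
    Nat.pow_le_pow_right (by norm_num) (by omega)
  rw [pow_succ]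
  omega

theorem bitSize_zero : bitSize 0 = 1 := by simp [bitSize]

theorem bitSize_one : bitSize 1 = 2 := by simp [bitSize]

theorem bitSize_neg (q : ℚ) : bitSize (-q) = bitSize q := by simp [bitSize]

theorem bitSize_natCast_le (k : ℕ) : bitSize k ≤ k + 1 := by
  have : Nat.size k ≤ k := Nat.size_le.2 Nat.lt_two_pow_self
  simpa [bitSize] using this

/-- Reduction to lowest terms replaces numerator and denominator by divisors. All operations below
are bounded by writing the result as an unreduced fraction. -/
theorem bitSize_intCast_div_le (x y : ℤ) (hy : y ≠ 0) :
    bitSize ((x : ℚ) / (y : ℚ)) ≤ Nat.size x.natAbs + Nat.size y.natAbs := by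
  rcases eq_or_ne x 0 with rfl | hx
  · have : 0 < Nat.size y.natAbs := Nat.size_pos.2 (Int.natAbs_pos.2 hy)
    simp [bitSize_zero]
    omega
  · refine add_le_add (Nat.size_le_size ?_) (Nat.size_le_size ?_)
    · rw [← Rat.divInt_eq_div]
      exact Nat.le_of_dvd (Int.natAbs_pos.2 hx) (Int.natAbs_dvd_natAbs.2 (Rat.num_dvd x hy))
    · rw [← Rat.divInt_eq_div]
      exact Nat.le_of_dvd (Int.natAbs_pos.2 hy)
        (Int.natCast_dvd.1 (Rat.den_dvd x y))

theorem bitSize_mul_le (a b : ℚ) : bitSize (a * b) ≤ 2 * (bitSize a + bitSize b) + 2 := by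
  have h : a * b = ((a.num * b.num : ℤ) : ℚ) / ((a.den * b.den : ℤ) : ℚ) := by
    conv_lhs => rw [← Rat.num_div_den a, ← Rat.num_div_den b]
    push_cast
    rw [div_mul_div_comm]
  rw [h]
  refine (bitSize_intCast_div_le _ _ (by simp)).trans ?_
  have h1 := size_mul_le a.num.natAbs b.num.natAbs
  have h2 := size_mul_le a.den b.den
  simp only [Int.natAbs_mul, Int.natAbs_natCast, bitSize] at *
  omega

theorem bitSize_div_le (a b : ℚ) : bitSize (a / b) ≤ 2 * (bitSize a + bitSize b) + 2 := by
  rcases eq_or_ne b 0 with rfl | hb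
  · rw [div_zero, bitSize_zero]
    omega
  have h : a / b = ((a.num * b.den : ℤ) : ℚ) / ((a.den * b.num : ℤ) : ℚ) := by
    conv_lhs => rw [← Rat.num_div_den a, ← Rat.num_div_den b]
    push_cast
    rw [div_div_div_eq]
  rw [h]
  refine (bitSize_intCast_div_le _ _ (by simp [hb])).trans ?_
  have h1 := size_mul_le a.num.natAbs b.den
  have h2 := size_mul_le a.den b.num.natAbs
  simp only [Int.natAbs_mul, Int.natAbs_natCast, bitSize] at *
  omega

theorem bitSize_add_le (a b : ℚ) : bitSize (a + b) ≤ 2 * (bitSize a + bitSize b) + 2 := by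
  have h : a + b = ((a.num * b.den + a.den * b.num : ℤ) : ℚ) / ((a.den * b.den : ℤ) : ℚ) := by
    conv_lhs => rw [← Rat.num_div_den a, ← Rat.num_div_den b]
    push_cast
    rw [div_add_div _ _ (by simp) (by simp)]
  rw [h]
  refine (bitSize_intCast_div_le _ _ (by simp)).trans ?_
  have h0 := Nat.size_le_size (Int.natAbs_add_le (a.num * b.den) (a.den * b.num))
  have h1 := size_mul_le a.num.natAbs b.den
  have h2 := size_mul_le a.den b.num.natAbs
  have h3 := size_mul_le a.den b.den
  have h4 := size_add_le (a.num.natAbs * b.den) (a.den * b.num.natAbs)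
  simp only [Int.natAbs_mul, Int.natAbs_natCast, bitSize] at *
  omega

theorem bitSize_sub_le (a b : ℚ) : bitSize (a - b) ≤ 2 * (bitSize a + bitSize b) + 2 := by
  rw [sub_eq_add_neg, ← bitSize_neg b]
  exact bitSize_add_le a (-b)

/-! ### Static bounds on the running time

`K a` bounds the number of bits of the cells of array `a`, in multiples of a number `N`. -/

variable {n : ℕ}

/-- A bound on the number of bits of the value of an expression. -/
def Expr.bits (K : ℕ → ℕ) : Expr → ℕ
  | const q => bitSize q
  | read a _ => K a
  | add e f => 2 * (e.bits K + f.bits K) + 2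
  | sub e f => 2 * (e.bits K + f.bits K) + 2
  | mul e f => 2 * (e.bits K + f.bits K) + 2
  | div e f => 2 * (e.bits K + f.bits K) + 2
  | le _ _ => 2
  | value _ => 1
  | indep _ => 2

/-- A bound on the time to evaluate an expression. -/
def Expr.cost (K : ℕ → ℕ) : Expr → ℕ
  | const q => 1 + bitSize q
  | read a e => 1 + e.cost K + K a
  | add e f => 1 + e.cost K + f.cost K + (add e f).bits K
  | sub e f => 1 + e.cost K + f.cost K + (sub e f).bits K
  | mul e f => 1 + e.cost K + f.cost K + (mul e f).bits K
  | div e f => 1 + e.cost K + f.cost K + (div e f).bits K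
  | le e f => 1 + e.cost K + f.cost K + (le e f).bits K
  | value _ => 3
  | indep _ => 4

/-- A bound on the running time of a command all of whose loops are repeated at most `X` times. -/
noncomputable def Cmd.cost (K : ℕ → ℕ) : Cmd → Polynomial ℕ
  | skip => 1
  | assign _ e f => 1 + Polynomial.C (e.cost K + f.cost K) * Polynomial.X
  | seq c d => 1 + c.cost K + d.cost K
  | cond e c d => 1 + Polynomial.C (e.cost K) * Polynomial.X + c.cost K + d.cost K
  | loop e c => 1 + Polynomial.C (e.cost K) * Polynomial.X + Polynomial.X * c.cost K

section Bounds

variable {A : Auction n} {K : ℕ → ℕ} {N : ℕ}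

theorem bitSize_ite_le (P : Prop) [Decidable P] (hN : 1 ≤ N) :
    bitSize (if P then 1 else 0) ≤ 2 * N := by
  split_ifs
  · rw [bitSize_one]
    omega
  · rw [bitSize_zero]
    omega

/-- Since `N ≥ 1`, additive constants are absorbed into the multiplier of `N`; hence the bounds for
expressions can be computed from the syntax alone. -/
theorem bits_binary_le {x y z a b : ℕ} (hN : 1 ≤ N) (h : z ≤ 2 * (x + y) + 2)
    (hx : x ≤ a * N) (hy : y ≤ b * N) : z ≤ (2 * (a + b) + 2) * N := by
  nlinarith

theorem Expr.bitSize_eval_le (hN : 1 ≤ N) (hv : ∀ S, bitSize (A.value S) ≤ N) {s : Memory}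
    (hs : ∀ a i, bitSize (s a i) ≤ K a * N) (e : Expr) :
    bitSize (e.eval A s) ≤ e.bits K * N := by
  induction e with
  | const q => exact Nat.le_mul_of_pos_right _ hN
  | read a e => exact hs _ _
  | add e f he hf => exact bits_binary_le hN (bitSize_add_le _ _) he hf
  | sub e f he hf => exact bits_binary_le hN (bitSize_sub_le _ _) he hf
  | mul e f he hf => exact bits_binary_le hN (bitSize_mul_le _ _) he hf
  | div e f he hf => exact bits_binary_le hN (bitSize_div_le _ _) he hf
  | le e f => exact bitSize_ite_le _ hN
  | value a => simpa [Expr.bits, Expr.eval, bitSize] using hv (storedSet s a)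
  | indep a => exact bitSize_ite_le _ hN

theorem Expr.time_le (hN : 1 ≤ N) (hn : n ≤ N) (hv : ∀ S, bitSize (A.value S) ≤ N) {s : Memory}
    (hs : ∀ a i, bitSize (s a i) ≤ K a * N) (e : Expr) : e.time A s ≤ e.cost K * N := by
  have hb := fun e : Expr => Expr.bitSize_eval_le hN hv hs e
  induction e with
  | const q => exact Nat.le_mul_of_pos_right _ hN
  | read a e he =>
    have := hb (.read a e)
    simp only [Expr.time, Expr.cost, Expr.bits] at *
    nlinarith
  | add e f he hf =>
    have := hb (.add e f)
    simp only [Expr.time, Expr.cost]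
    nlinarith
  | sub e f he hf =>
    have := hb (.sub e f)
    simp only [Expr.time, Expr.cost]
    nlinarith
  | mul e f he hf =>
    have := hb (.mul e f)
    simp only [Expr.time, Expr.cost]
    nlinarith
  | div e f he hf =>
    have := hb (.div e f)
    simp only [Expr.time, Expr.cost]
    nlinarith
  | le e f he hf =>
    have := hb (.le e f)
    simp only [Expr.time, Expr.cost]
    nlinarith
  | value a =>
    have := hb (.value a)
    simp only [Expr.time, Expr.cost, Expr.bits] at *
    omega
  | indep a =>
    have := hb (.indep a)
    simp only [Expr.time, Expr.cost, Expr.bits] at *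
    omega

/-- All assignments preserve the invariant `Inv`, and all loops are repeated at most `N` times. -/
def Cmd.Safe (A : Auction n) (Inv : Memory → Prop) (N : ℕ) : Cmd → Prop
  | skip => True
  | assign a e f => ∀ s, Inv s →
      Inv (Function.update s a (Function.update (s a) ⌊e.eval A s⌋₊ (f.eval A s)))
  | seq c d => c.Safe A Inv N ∧ d.Safe A Inv N
  | cond _ c d => c.Safe A Inv N ∧ d.Safe A Inv N
  | loop e c => (∀ s, Inv s → ⌊e.eval A s⌋₊ ≤ N) ∧ c.Safe A Inv N

theorem iterate_time_le {Inv : Memory → Prop} {T : ℕ} {g : Memory × ℕ → Memory × ℕ}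
    (hg : ∀ s t, Inv s → Inv (g (s, t)).1 ∧ (g (s, t)).2 ≤ t + T) (k : ℕ) (s : Memory) (t : ℕ)
    (hs : Inv s) : Inv (g^[k] (s, t)).1 ∧ (g^[k] (s, t)).2 ≤ t + k * T := by
  induction k with
  | zero => simpa using hs
  | succ k ih =>
    rw [Function.iterate_succ_apply']
    obtain ⟨h1, h2⟩ := hg (g^[k] (s, t)).1 (g^[k] (s, t)).2 ih.1
    refine ⟨h1, h2.trans ?_⟩
    have := ih.2
    rw [add_mul]
    omega

/-- The invariant bounds all cells before every operation, so the cost of a loop body is the same in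
every iteration. A loop then only multiplies the bound by `N`, and the total is polynomial of a
degree given by the nesting depth. -/
theorem Cmd.exec_le (hN : 1 ≤ N) (hn : n ≤ N) (hv : ∀ S, bitSize (A.value S) ≤ N)
    {Inv : Memory → Prop} (hI : ∀ s, Inv s → ∀ a i, bitSize (s a i) ≤ K a * N) (c : Cmd)
    (hc : c.Safe A Inv N) (s : Memory) (t : ℕ) (hs : Inv s) :
    Inv (c.exec A (s, t)).1 ∧ (c.exec A (s, t)).2 ≤ t + (c.cost K).eval N := by
  have he := fun (e : Expr) s (hs : Inv s) => Expr.time_le hN hn hv (hI s hs) e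
  induction c generalizing s t with
  | skip => simpa [Cmd.exec, Cmd.cost] using hs
  | assign a e f =>
    refine ⟨hc s hs, ?_⟩
    have h1 := he e s hs
    have h2 := he f s hs
    simp only [Cmd.exec, Cmd.cost, Polynomial.eval_add, Polynomial.eval_mul, Polynomial.eval_one,
      Polynomial.eval_C, Polynomial.eval_X, add_mul]
    omega
  | seq c d hc' hd' =>
    obtain ⟨h1, h2⟩ := hc' hc.1 s (t + 1) hs
    obtain ⟨h3, h4⟩ := hd' hc.2 (c.exec A (s, t + 1)).1 (c.exec A (s, t + 1)).2 h1
    refine ⟨h3, h4.trans ?_⟩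
    simp only [Cmd.cost, Polynomial.eval_add, Polynomial.eval_one]
    omega
  | cond e c d hc' hd' =>
    have h := he e s hs
    obtain ⟨h1, h2⟩ := hc' hc.1 s (t + 1 + e.time A s) hs
    obtain ⟨h3, h4⟩ := hd' hc.2 s (t + 1 + e.time A s) hs
    simp only [Cmd.exec, Cmd.cost, Polynomial.eval_add, Polynomial.eval_mul, Polynomial.eval_one,
      Polynomial.eval_C, Polynomial.eval_X]
    split_ifs
    · exact ⟨h1, by omega⟩
    · exact ⟨h3, by omega⟩
  | loop e c hc' =>
    have h := he e s hs
    obtain ⟨h1, h2⟩ := iterate_time_le (fun s t hs => hc' hc.2 s t hs) ⌊e.eval A s⌋₊ s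
      (t + 1 + e.time A s) hs
    refine ⟨h1, h2.trans ?_⟩
    have h3 := Nat.mul_le_mul_right ((c.cost K).eval N) (hc.1 s hs)
    simp only [Cmd.cost, Polynomial.eval_add, Polynomial.eval_mul, Polynomial.eval_one,
      Polynomial.eval_C, Polynomial.eval_X]
    omega

end Bounds

/-! ### The effect of a command on the memory -/

/-- The memory after the execution of a command. -/
def Cmd.sem (A : Auction n) : Cmd → Memory → Memory
  | skip, s => s
  | assign a e f, s => Function.update s a (Function.update (s a) ⌊e.eval A s⌋₊ (f.eval A s))
  | seq c d, s => d.sem A (c.sem A s)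
  | cond e c d, s => if e.eval A s ≠ 0 then c.sem A s else d.sem A s
  | loop e c, s => (c.sem A)^[⌊e.eval A s⌋₊] s

/-- The clock never influences the memory, so correctness can be proved for `Cmd.sem` without it. -/
theorem Cmd.exec_fst (A : Auction n) (c : Cmd) (x : Memory × ℕ) :
    (c.exec A x).1 = c.sem A x.1 := by
  induction c generalizing x with
  | skip => rfl
  | assign a e f => rfl
  | seq c d hc hd => simp [Cmd.exec, Cmd.sem, hc, hd]
  | cond e c d hc hd =>
    simp only [Cmd.exec, Cmd.sem]
    split_ifs
    · rw [hc]
    · rw [hd]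
  | loop e c hc =>
    simp only [Cmd.exec, Cmd.sem]
    generalize ⌊e.eval A x.1⌋₊ = k
    generalize x.2 + 1 + e.time A x.1 = t
    generalize x.1 = s
    induction k generalizing s t with
    | zero => rfl
    | succ k ih => rw [Function.iterate_succ_apply, Function.iterate_succ_apply, ← hc (s, t), ← ih]

/-- The arrays that a command may change. -/
def Cmd.writes : Cmd → Finset ℕ
  | skip => ∅
  | assign a _ _ => {a}
  | seq c d => c.writes ∪ d.writes
  | cond _ c d => c.writes ∪ d.writes
  | loop _ c => c.writes

theorem Cmd.sem_of_notMem_writes (A : Auction n) {c : Cmd} {a : ℕ} (ha : a ∉ c.writes)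
    (s : Memory) : c.sem A s a = s a := by
  induction c generalizing s with
  | skip => rfl
  | assign b e f =>
    have : a ≠ b := by simpa [Cmd.writes] using ha
    simp [Cmd.sem, this]
  | seq c d hc hd =>
    simp only [Cmd.writes, Finset.mem_union, not_or] at ha
    simp only [Cmd.sem]
    rw [hd ha.2, hc ha.1]
  | cond e c d hc hd =>
    simp only [Cmd.writes, Finset.mem_union, not_or] at ha
    simp only [Cmd.sem]
    split_ifs
    · exact hc ha.1 s
    · exact hd ha.2 s
  | loop e c hc =>
    simp only [Cmd.sem]
    generalize ⌊e.eval A s⌋₊ = k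
    induction k generalizing s with
    | zero => rfl
    | succ k ih => rw [Function.iterate_succ_apply', hc ha, ih]

theorem iterate_induction {α : Type*} {f : α → α} {P : ℕ → α → Prop} {N : ℕ} {s : α} (h0 : P 0 s)
    (h : ∀ k < N, ∀ s, P k s → P (k + 1) (f s)) : P N (f^[N] s) := by
  have : ∀ k ≤ N, P k (f^[k] s) := by
    intro k hk
    induction k with
    | zero => exact h0
    | succ k ih =>
      rw [Function.iterate_succ_apply']
      exact h k hk _ (ih (by omega))
  exact this N le_rfl


/-! ### Sequential posted prices with two candidate solutions -/

/-- The state of the mechanism: two disjoint candidate solutions, the agents that have not yet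
received an offer, and the payments. -/
structure State (n : ℕ) where
  sol : Bool → Finset (Fin n)
  alive : Finset (Fin n)
  pay : Fin n → ℚ

/-- The state in which the agents in `U` may receive offers. -/
def State.start (U : Finset (Fin n)) : State n := ⟨fun _ => ∅, U, fun _ => 0⟩

/-- The marginal value of agent `i` with respect to solution `j`. -/
def State.marginal (A : Auction n) (st : State n) (x : Fin n × Bool) : ℚ :=
  (A.value (insert x.1 (st.sol x.2)) : ℚ) - A.value (st.sol x.2)

/-- Agent `i` may still receive an offer to join solution `j`. -/
def State.Candidate (A : Auction n) (st : State n) (x : Fin n × Bool) : Prop :=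
  x.1 ∈ st.alive ∧ insert x.1 (st.sol x.2) ∈ A.indep

instance (A : Auction n) (st : State n) (x : Fin n × Bool) : Decidable (st.Candidate A x) :=
  inferInstanceAs (Decidable (_ ∧ _))

/-- The better one of the best candidate so far and `x`. -/
def State.improve (A : Auction n) (st : State n) (best : Option (Fin n × Bool))
    (x : Fin n × Bool) : Option (Fin n × Bool) :=
  if st.Candidate A x then
    match best with
    | none => some x
    | some y => if st.marginal A x ≤ st.marginal A y then some y else some x
  else best

/-- The best candidate after the scan of the agents below `k` for solution `j`. -/
def State.scan (A : Auction n) (st : State n) (j : Bool) (best : Option (Fin n × Bool)) :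
    ℕ → Option (Fin n × Bool)
  | 0 => best
  | k + 1 => if h : k < n then st.improve A (st.scan A j best k) (⟨k, h⟩, j)
      else st.scan A j best k

/-- The candidate of largest marginal value. -/
def State.pick (A : Auction n) (st : State n) : Option (Fin n × Bool) :=
  st.scan A true (st.scan A false none n) n

/-- `price st i j` is the price that is offered to agent `i` in state `st` for joining solution
`j`. -/
abbrev PriceRule (n : ℕ) : Type := State n → Fin n → Bool → ℚ

/-- The state after the offer of the price `q` to agent `i` for joining solution `j`. -/
def State.offer (st : State n) (b : Fin n → ℚ≥0) (i : Fin n) (j : Bool) (q : ℚ) : State n :=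
  if (b i : ℚ) ≤ q then
    ⟨Function.update st.sol j (insert i (st.sol j)), st.alive.erase i, Function.update st.pay i q⟩
  else ⟨st.sol, st.alive.erase i, st.pay⟩

/-- One round: the candidate of largest marginal value receives an offer. -/
def State.step (A : Auction n) (price : PriceRule n) (b : Fin n → ℚ≥0) (st : State n) : State n :=
  match st.pick A with
  | none => st
  | some x => st.offer b x.1 x.2 (price st x.1 x.2)

/-- The final state of the mechanism. -/
def State.run (A : Auction n) (price : PriceRule n) (b : Fin n → ℚ≥0) (st : State n) : State n :=
  (State.step A price b)^[n] st

/-- Prices proportional to the marginal values, as long as the value is at most `τ`. -/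
def greedyPrice (A : Auction n) (τ : ℚ) : PriceRule n := fun st i j =>
  if A.value (st.sol j) + st.marginal A (i, j) ≤ τ then A.budget * st.marginal A (i, j) / τ else -1

/-- The whole budget for the first agent that accepts. -/
def singlePrice (A : Auction n) : PriceRule n := fun st _ _ =>
  if st.sol false = ∅ ∧ st.sol true = ∅ then A.budget else -1

namespace State

variable {A : Auction n}

theorem improve_candidate {st : State n} {best : Option (Fin n × Bool)} {x : Fin n × Bool}
    (h : ∀ y ∈ best, st.Candidate A y) : ∀ y ∈ st.improve A best x, st.Candidate A y := by
  intro y hy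
  unfold improve at hy
  split_ifs at hy with hx
  · cases best with
    | none =>
      simp only [Option.mem_def, Option.some.injEq] at hy
      exact hy ▸ hx
    | some z =>
      simp only at hy
      split_ifs at hy with hz
      · exact h y hy
      · simp only [Option.mem_def, Option.some.injEq] at hy
        exact hy ▸ hx
  · exact h y hy

/-- `best` is at least as good as the candidate `x`. -/
def Dominates (A : Auction n) (st : State n) (best : Option (Fin n × Bool)) (x : Fin n × Bool) :
    Prop :=
  st.Candidate A x → ∃ y ∈ best, st.marginal A x ≤ st.marginal A y

theorem improve_dominates_self (st : State n) (best : Option (Fin n × Bool)) (x : Fin n × Bool) :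
    st.Dominates A (st.improve A best x) x := by
  intro hx
  unfold improve
  rw [if_pos hx]
  cases best with
  | none => exact ⟨x, rfl, le_rfl⟩
  | some y =>
    simp only
    split_ifs with hy
    · exact ⟨y, rfl, hy⟩
    · exact ⟨x, rfl, le_rfl⟩

theorem improve_dominates {st : State n} {best : Option (Fin n × Bool)} (x : Fin n × Bool)
    {z : Fin n × Bool} (h : st.Dominates A best z) : st.Dominates A (st.improve A best x) z := by
  intro hz
  obtain ⟨y, hy, hzy⟩ := h hz
  rw [Option.mem_def] at hy
  subst hy
  unfold improve
  split_ifs with hx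
  · simp only
    split_ifs with hxy
    · exact ⟨y, rfl, hzy⟩
    · exact ⟨x, rfl, hzy.trans (le_of_not_ge hxy)⟩
  · exact ⟨y, rfl, hzy⟩

theorem scan_candidate {st : State n} {j : Bool} {best : Option (Fin n × Bool)}
    (h : ∀ y ∈ best, st.Candidate A y) (k : ℕ) : ∀ y ∈ st.scan A j best k, st.Candidate A y := by
  induction k with
  | zero => exact h
  | succ k ih =>
    unfold scan
    split_ifs
    · exact improve_candidate ih
    · exact ih

theorem scan_dominates {st : State n} (j : Bool) {best : Option (Fin n × Bool)}
    {z : Fin n × Bool} (h : st.Dominates A best z) (k : ℕ) :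
    st.Dominates A (st.scan A j best k) z := by
  induction k with
  | zero => exact h
  | succ k ih =>
    unfold scan
    split_ifs
    · exact improve_dominates _ ih
    · exact ih

theorem scan_dominates_of_lt (st : State n) (j : Bool) (best : Option (Fin n × Bool)) (k : ℕ)
    (i : Fin n) (hi : i < k) : st.Dominates A (st.scan A j best k) (i, j) := by
  induction k with
  | zero => omega
  | succ k ih =>
    unfold scan
    split_ifs with hk
    · rcases Nat.lt_succ_iff_lt_or_eq.1 hi with h | h
      · exact improve_dominates _ (ih h)
      · have : i = ⟨k, hk⟩ := Fin.ext h
        rw [this]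
        exact improve_dominates_self _ _ _
    · exact ih (by omega)

theorem pick_candidate {st : State n} {x : Fin n × Bool} (h : st.pick A = some x) :
    st.Candidate A x :=
  scan_candidate (scan_candidate (by simp) n) n x h

/-- A candidate for the first solution is met in the first scan, and its dominance survives the
second scan. -/
theorem pick_dominates (st : State n) (x : Fin n × Bool) : st.Dominates A (st.pick A) x := by
  obtain ⟨i, j⟩ := x
  cases j
  · exact scan_dominates _ (scan_dominates_of_lt st _ _ n i i.2) n
  · exact scan_dominates_of_lt st _ _ n i i.2

theorem marginal_le_of_pick {st : State n} {x y : Fin n × Bool} (h : st.pick A = some x)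
    (hy : st.Candidate A y) : st.marginal A y ≤ st.marginal A x := by
  obtain ⟨z, hz, hyz⟩ := pick_dominates st y hy
  rw [h, Option.mem_def, Option.some.injEq] at hz
  exact hz ▸ hyz

theorem not_candidate_of_pick {st : State n} (h : st.pick A = none) (y : Fin n × Bool) :
    ¬ st.Candidate A y := by
  intro hy
  obtain ⟨z, hz, -⟩ := pick_dominates st y hy
  simp [h] at hz

/-! #### Induction over the rounds -/

theorem run_induction {price : PriceRule n} {b : Fin n → ℚ≥0} {P : State n → Prop} {st : State n}
    (h0 : P st)
    (h : ∀ st x, P st → st.pick A = some x → P (st.offer b x.1 x.2 (price st x.1 x.2))) :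
    P (st.run A price b) := by
  refine iterate_induction (P := fun _ => P) h0 fun k _ st hst => ?_
  unfold step
  cases hp : st.pick A with
  | none => exact hst
  | some x => exact h st x hst hp

@[simp] theorem offer_alive (st : State n) (b : Fin n → ℚ≥0) (i : Fin n) (j : Bool) (q : ℚ) :
    (st.offer b i j q).alive = st.alive.erase i := by
  unfold offer
  split_ifs <;> rfl

/-- As long as there is a candidate, a round removes one agent from `alive`; therefore `n` rounds
exhaust all candidates. -/
theorem pick_run (price : PriceRule n) (b : Fin n → ℚ≥0) (st : State n) :
    (st.run A price b).pick A = none := by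
  have key : (st.run A price b).pick A = none ∨ (st.run A price b).alive.card + n ≤ n := by
    refine iterate_induction (P := fun k (st : State n) => st.pick A = none ∨ st.alive.card + k ≤ n) ?_ ?_
    · right
      simpa using Finset.card_le_univ st.alive
    · intro k _ st hst
      unfold step
      cases hp : st.pick A with
      | none => exact Or.inl hp
      | some x =>
        right
        have hx := (pick_candidate hp).1
        have := Finset.card_erase_add_one hx
        simp only [hp, reduceCtorEq, false_or] at hst
        simp only [offer_alive]
        omega
  refine key.elim id fun h => ?_
  have h0 : (st.run A price b).alive = ∅ := Finset.card_eq_zero.1 (by omega)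
  cases hp : (st.run A price b).pick A with
  | none => rfl
  | some x =>
    have := (pick_candidate hp).1
    simp [h0] at this

/-- Only bids of agents that receive offers are ever read. This keeps the estimate independent of
the bids outside the sample. -/
theorem run_congr {price : PriceRule n} {b b' : Fin n → ℚ≥0} {st : State n}
    (h : ∀ i ∈ st.alive, b i = b' i) : st.run A price b = st.run A price b' := by
  have key : ∀ k, (step A price b)^[k] st = (step A price b')^[k] st ∧
      ((step A price b)^[k] st).alive ⊆ st.alive := by
    intro k
    induction k with
    | zero => simp
    | succ k ih =>
      rw [Function.iterate_succ_apply', Function.iterate_succ_apply', ← ih.1]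
      generalize (step A price b)^[k] st = s at ih
      unfold step
      cases hp : s.pick A with
      | none => exact ⟨rfl, ih.2⟩
      | some x =>
        have hx := h _ (ih.2 (pick_candidate hp).1)
        constructor
        · simp only [offer, hx]
        · simp only [offer_alive]
          exact (Finset.erase_subset _ _).trans ih.2
  exact (key n).1

theorem run_start_sol_subset {U : Finset (Fin n)} (price : PriceRule n) (b : Fin n → ℚ≥0)
    (j : Bool) : ((start U).run A price b).sol j ⊆ U := by
  have : (∀ j, ((start U).run A price b).sol j ⊆ U) ∧ ((start U).run A price b).alive ⊆ U := by
    refine run_induction (P := fun st => (∀ j, st.sol j ⊆ U) ∧ st.alive ⊆ U) (by simp [start]) ?_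
    rintro st ⟨i, j'⟩ ⟨h1, h2⟩ hp
    have hi := h2 (pick_candidate hp).1
    refine ⟨fun j => ?_, ?_⟩
    · unfold offer
      split_ifs
      · rcases eq_or_ne j j' with rfl | hj
        · simpa using Finset.insert_subset hi (h1 j)
        · simpa [hj] using h1 j
      · exact h1 j
    · simpa using (Finset.erase_subset _ _).trans h2
  exact this.1 j

/-- Every agent receives at most one offer, which does not depend on the declared cost of this
agent. -/
theorem exists_offer (price : PriceRule n) (b : Fin n → ℚ≥0) (i : Fin n) (k : ℕ) (st : State n)
    (hi : ∀ j, i ∉ st.sol j) :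
    ∃ o : Option (Bool × ℚ), ∀ x : ℚ≥0,
      (∀ j, i ∈ ((step A price (Function.update b i x))^[k] st).sol j ↔
        ∃ q, o = some (j, q) ∧ (x : ℚ) ≤ q) ∧
      ∀ j q, o = some (j, q) → (x : ℚ) ≤ q →
        ((step A price (Function.update b i x))^[k] st).pay i = q := by
  -- Once an agent is no longer alive, later rounds change neither its membership nor its payment,
  -- whatever the bids are.
  have dead : ∀ (c : Fin n → ℚ≥0) (k : ℕ) (st : State n), i ∉ st.alive →
      (∀ j, i ∈ ((step A price c)^[k] st).sol j ↔ i ∈ st.sol j) ∧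
      ((step A price c)^[k] st).pay i = st.pay i := by
    intro c k
    induction k with
    | zero => simp
    | succ k ih =>
      intro st hst
      rw [Function.iterate_succ_apply]
      have h1 : i ∉ (step A price c st).alive := by
        unfold step
        cases hp : st.pick A with
        | none => exact hst
        | some x => simp [hst]
      have h2 : (∀ j, i ∈ (step A price c st).sol j ↔ i ∈ st.sol j) ∧
          (step A price c st).pay i = st.pay i := by
        unfold step
        cases hp : st.pick A with
        | none => simp
        | some x =>
          have hx : i ≠ x.1 := fun h => hst (h ▸ (pick_candidate hp).1)
          simp only [offer]
          split_ifs
          · refine ⟨fun j => ?_, by simp [hx]⟩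
            rcases eq_or_ne j x.2 with rfl | hj
            · simp [hx]
            · simp [hj]
          · simp
      obtain ⟨h3, h4⟩ := ih _ h1
      exact ⟨fun j => (h3 j).trans (h2.1 j), h4.trans h2.2⟩
  induction k generalizing st with
  | zero => exact ⟨none, by simpa using hi⟩
  | succ k ih =>
    simp only [Function.iterate_succ_apply]
    cases hp : st.pick A with
    | none =>
      obtain ⟨o, ho⟩ := ih st hi
      refine ⟨o, fun x => ?_⟩
      have : step A price (Function.update b i x) st = st := by simp [step, hp]
      rw [this]
      exact ho x
    | some y =>
      obtain ⟨i', j'⟩ := y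
      have hs : ∀ x, step A price (Function.update b i x) st =
          st.offer (Function.update b i x) i' j' (price st i' j') := by
        intro x
        simp [step, hp]
      -- Until agent `i` is picked, its bid has not been read. If it is picked now, this is its only
      -- offer; otherwise the round is the same for all `x` and the induction continues.
      rcases eq_or_ne i' i with rfl | hii
      · refine ⟨some (j', price st i' j'), fun x => ?_⟩
        rw [hs]
        obtain ⟨h3, h4⟩ := dead (Function.update b i' x) k
          (st.offer (Function.update b i' x) i' j' (price st i' j')) (by simp)
        rw [h4]
        simp only [h3]
        unfold offer
        simp only [Function.update_self]
        split_ifs with hx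
        · refine ⟨fun j => ?_, by simp⟩
          rcases eq_or_ne j j' with rfl | hj
          · simp [hx]
          · simp [hj, hj.symm, hi]
        · refine ⟨fun j => ?_, ?_⟩
          · simp only [hi, false_iff]
            rintro ⟨q, hq, hxq⟩
            simp only [Option.some.injEq, Prod.mk.injEq] at hq
            exact hx (hq.2 ▸ hxq)
          · rintro j q hq hxq
            simp only [Option.some.injEq, Prod.mk.injEq] at hq
            exact absurd (hq.2 ▸ hxq) hx
      · have hs' : ∀ x, step A price (Function.update b i x) st =
            st.offer b i' j' (price st i' j') := by
          intro x
          rw [hs]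
          simp [offer, hii]
        obtain ⟨o, ho⟩ := ih (st.offer b i' j' (price st i' j')) (by
          intro j
          unfold offer
          split_ifs
          · rcases eq_or_ne j j' with rfl | hj
            · simp [hii.symm, hi]
            · simp [hj, hi]
          · exact hi j)
        exact ⟨o, fun x => by rw [hs']; exact ho x⟩

end State


/-! ### Invariants: independence, disjointness, and payments -/

namespace State

variable {A : Auction n}

/-- The two solutions are independent, disjoint, and consist of agents that received offers. -/
structure Valid (A : Auction n) (st : State n) : Prop where
  indep : ∀ j, st.sol j ∈ A.indep
  notMem_alive : ∀ j, ∀ i ∈ st.sol j, i ∉ st.alive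
  notMem_other : ∀ j, ∀ i ∈ st.sol j, i ∉ st.sol (!j)

theorem Valid.start (h : ∅ ∈ A.indep) (U : Finset (Fin n)) : (start U).Valid A :=
  ⟨fun _ => h, by simp [State.start], by simp [State.start]⟩

theorem Valid.offer {st : State n} (h : st.Valid A) {x : Fin n × Bool} (hx : st.Candidate A x)
    (b : Fin n → ℚ≥0) (q : ℚ) : (st.offer b x.1 x.2 q).Valid A := by
  obtain ⟨i, j⟩ := x
  obtain ⟨hi, hI⟩ := hx
  unfold State.offer
  split_ifs
  · refine ⟨fun k => ?_, fun k l hl => ?_, fun k l hl => ?_⟩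
    · rcases eq_or_ne k j with rfl | hk
      · simpa using hI
      · simpa [hk] using h.indep k
    · rcases eq_or_ne k j with rfl | hk
      · simp only [Function.update_self, Finset.mem_insert] at hl
        rcases hl with rfl | hl
        · simp
        · simp [h.notMem_alive _ _ hl]
      · simp only [Function.update_of_ne hk] at hl
        simp [h.notMem_alive _ _ hl]
    · rcases eq_or_ne k j with rfl | hk
      · simp only [Function.update_self, Finset.mem_insert] at hl
        simp only [ne_eq, Bool.not_eq_self, not_false_eq_true, Function.update_of_ne]
        rcases hl with rfl | hl
        · exact fun h' => h.notMem_alive _ _ h' hi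
        · exact h.notMem_other _ _ hl
      · simp only [Function.update_of_ne hk] at hl
        have hj : (!k) = j := by cases k <;> cases j <;> simp_all
        simp only [hj, Function.update_self, Finset.mem_insert, not_or]
        refine ⟨?_, hj ▸ h.notMem_other _ _ hl⟩
        rintro rfl
        exact h.notMem_alive _ _ hl hi
  · refine ⟨h.indep, fun k l hl => ?_, h.notMem_other⟩
    simp [h.notMem_alive _ _ hl]

/-- The payments are bounded by the multiple `B / τ` of the values. -/
structure Paid (A : Auction n) (τ : ℚ) (b : Fin n → ℚ≥0) (st : State n) : Prop where
  sum_pay : ∀ j, ∑ i ∈ st.sol j, st.pay i = A.budget * A.value (st.sol j) / τ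
  value_le : ∀ j, (A.value (st.sol j) : ℚ) ≤ τ
  le_pay : ∀ j, ∀ i ∈ st.sol j, (b i : ℚ) ≤ st.pay i

theorem Paid.start (h : A.value ∅ = 0) {τ : ℚ} (hτ : 0 ≤ τ) (b : Fin n → ℚ≥0)
    (U : Finset (Fin n)) : (start U).Paid A τ b :=
  ⟨by simp [State.start, h], by simpa [State.start, h] using hτ, by simp [State.start]⟩

theorem greedyPrice_of_le {τ : ℚ} {st : State n} {b : Fin n → ℚ≥0} {x : Fin n × Bool}
    (h : (b x.1 : ℚ) ≤ greedyPrice A τ st x.1 x.2) :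
    (A.value (st.sol x.2) : ℚ) + st.marginal A x ≤ τ ∧
      greedyPrice A τ st x.1 x.2 = A.budget * st.marginal A x / τ := by
  unfold greedyPrice at h ⊢
  split_ifs at h ⊢ with h1
  · exact ⟨h1, rfl⟩
  -- The price `-1` for exceeding the target is never accepted, because costs are nonnegative.
  · have : (0 : ℚ) ≤ b x.1 := by positivity
    linarith

/-- Prices are proportional to marginal values, and these telescope to the value of the solution;
the test against `τ` in the price keeps that value below the target. -/
theorem Paid.offer {τ : ℚ} {b : Fin n → ℚ≥0} {st : State n} (hv : st.Valid A)
    (h : st.Paid A τ b) {x : Fin n × Bool} (hx : st.Candidate A x) :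
    (st.offer b x.1 x.2 (greedyPrice A τ st x.1 x.2)).Paid A τ b := by
  unfold State.offer
  split_ifs with hb
  · obtain ⟨h1, h2⟩ := greedyPrice_of_le hb
    obtain ⟨i, j⟩ := x
    have hm := hx.1
    have hi : ∀ k, i ∉ st.sol k := fun k hk => hv.notMem_alive _ _ hk hm
    have hs : ∀ k, ∑ l ∈ st.sol k, Function.update st.pay i (greedyPrice A τ st i j) l =
        ∑ l ∈ st.sol k, st.pay l := by
      intro k
      refine Finset.sum_congr rfl fun l hl => Function.update_of_ne ?_ _ _
      rintro rfl
      exact hi k hl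
    refine ⟨fun k => ?_, fun k => ?_, fun k l hl => ?_⟩
    · rcases eq_or_ne k j with rfl | hk
      · simp only [Function.update_self]
        rw [Finset.sum_insert (hi k), hs, h.sum_pay, Function.update_self, h2]
        simp only [marginal]
        ring
      · simp only [Function.update_of_ne hk]
        rw [hs, h.sum_pay]
    · rcases eq_or_ne k j with rfl | hk
      · simpa [marginal] using h1
      · simpa [hk] using h.value_le k
    · rcases eq_or_ne l i with rfl | hl'
      · simpa using hb
      · simp only [Function.update_of_ne hl']
        refine h.le_pay k l ?_
        rcases eq_or_ne k j with rfl | hk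
        · simpa [hl'] using hl
        · simpa [hk] using hl
  · exact ⟨h.sum_pay, h.value_le, h.le_pay⟩

theorem run_valid (h : ∅ ∈ A.indep) (price : PriceRule n) (b : Fin n → ℚ≥0)
    (U : Finset (Fin n)) : ((start U).run A price b).Valid A :=
  run_induction (Valid.start h U) fun _ _ hst hx => hst.offer (pick_candidate hx) _ _

theorem run_paid (h : ∅ ∈ A.indep) (h0 : A.value ∅ = 0) {τ : ℚ} (hτ : 0 ≤ τ) (b : Fin n → ℚ≥0)
    (U : Finset (Fin n)) : ((start U).run A (greedyPrice A τ) b).Paid A τ b :=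
  (run_induction (P := fun st => st.Valid A ∧ st.Paid A τ b)
    ⟨Valid.start h U, Paid.start h0 hτ b U⟩ fun _ _ hst hx =>
      ⟨hst.1.offer (pick_candidate hx) _ _, hst.2.offer hst.1 (pick_candidate hx)⟩).2

theorem Paid.sum_pay_le {τ : ℚ} {b : Fin n → ℚ≥0} {st : State n} (h : st.Paid A τ b)
    (hτ : 0 ≤ τ) (j : Bool) : ∑ i ∈ st.sol j, st.pay i ≤ A.budget := by
  rw [h.sum_pay]
  refine div_le_of_le_mul₀ hτ (by positivity) ?_
  exact mul_le_mul_of_nonneg_left (h.value_le j) (by positivity)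

/-- Winners are paid at least their bids and the payments fit into the budget, so the solution
itself is feasible for the optimum at the bids `b`. -/
theorem value_sol_le_opt {st : State n} (hv : st.Valid A) {b : Fin n → ℚ≥0} (j : Bool)
    (h1 : ∀ i ∈ st.sol j, (b i : ℚ) ≤ st.pay i) (h2 : ∑ i ∈ st.sol j, st.pay i ≤ A.budget) :
    A.value (st.sol j) ≤ A.opt b := by
  refine Finset.le_sup (f := A.value) (Finset.mem_filter.2 ⟨hv.indep j, ?_⟩)
  have : ((∑ i ∈ st.sol j, b i : ℚ≥0) : ℚ) ≤ A.budget := by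
    push_cast
    exact (Finset.sum_le_sum h1).trans h2
  exact_mod_cast this

/-- At most one agent has accepted the offer of the whole budget; this agent has the largest value
among those that would accept it. -/
def SinglePaid (A : Auction n) (b : Fin n → ℚ≥0) (st : State n) : Prop :=
  (st.sol false = ∅ ∧ st.sol true = ∅ ∧ ∀ k ∉ st.alive, {k} ∈ A.indep → A.budget < b k) ∨
    ∃ j i, st.sol j = {i} ∧ st.sol (!j) = ∅ ∧ st.pay i = A.budget ∧
      ∀ k, {k} ∈ A.indep → b k ≤ A.budget → A.value {k} ≤ A.value {i}

/-- While both solutions are empty, the marginal values are the singleton values, and all earlier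
offers were refused by agents that cost more than the budget. The first acceptance is thus by the
most valuable affordable agent; afterwards all prices are `-1`. -/
theorem SinglePaid.offer {b : Fin n → ℚ≥0} {st : State n} (h : st.SinglePaid A b)
    {x : Fin n × Bool} (hx : st.pick A = some x) :
    (st.offer b x.1 x.2 (singlePrice A st x.1 x.2)).SinglePaid A b := by
  obtain ⟨i, j⟩ := x
  rcases h with ⟨h1, h2, h3⟩ | ⟨j', i', h1, h2, h3, h4⟩
  · have h0 : ∀ k, st.sol k = ∅ := by
      intro k
      cases k <;> assumption
    have hp : singlePrice A st i j = A.budget := if_pos ⟨h1, h2⟩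
    simp only [hp]
    unfold State.offer
    split_ifs with hb
    · right
      refine ⟨j, i, by simp [h0], by simp [h0], by simp, fun k hk hkb => ?_⟩
      have hka : k ∈ st.alive := by
        by_contra hka
        exact absurd (h3 k hka hk) (not_lt.2 hkb)
      have := marginal_le_of_pick hx (y := (k, j)) ⟨hka, by simpa [h0] using hk⟩
      simpa [marginal, h0] using this
    · left
      refine ⟨h1, h2, fun k hk hkI => ?_⟩
      rcases eq_or_ne k i with rfl | hki
      · exact_mod_cast not_le.1 hb
      · exact h3 k (by simpa [hki] using hk) hkI
  · right
    have hp : singlePrice A st i j = -1 := by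
      refine if_neg fun h => ?_
      have h0 : st.sol j' = ∅ := by
        cases j'
        · exact h.1
        · exact h.2
      simp [h1] at h0
    have hn : ¬ ((b i : ℚ) ≤ -1) := by
      have : (0 : ℚ) ≤ b i := by positivity
      linarith
    simp only [hp, State.offer, hn, if_false]
    exact ⟨j', i', h1, h2, h3, h4⟩

theorem run_singlePaid (b : Fin n → ℚ≥0) :
    ((start Finset.univ).run A (singlePrice A) b).SinglePaid A b :=
  run_induction (Or.inl ⟨rfl, rfl, by simp [start]⟩) fun _ _ hst hx => hst.offer hx

/-- With no candidate left, an affordable independent singleton rules out that everybody refused. -/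
theorem SinglePaid.value_le {b : Fin n → ℚ≥0} {st : State n} (h : st.SinglePaid A b)
    (hp : st.pick A = none) {k : Fin n} (hk : {k} ∈ A.indep)
    (hb : b k ≤ A.budget) : A.value {k} ≤ A.value (st.sol false ∪ st.sol true) := by
  rcases h with ⟨h1, h2, h3⟩ | ⟨j', i', h1, h2, h3, h4⟩
  · exfalso
    refine not_candidate_of_pick hp (k, false) ⟨?_, by simpa [h1] using hk⟩
    by_contra hka
    exact absurd (h3 k hka hk) (not_lt.2 hb)
  · have : st.sol false ∪ st.sol true = {i'} := by
      cases j' <;> simp_all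
    rw [this]
    exact h4 k hk hb

end State


/-! ### The mechanism for fixed coin tosses -/

/-- The singleton of agent `i`. -/
def agent (i : ℕ) : Finset (Fin n) := Finset.univ.filter fun l => (l : ℕ) = i

theorem agent_val (i : Fin n) : agent (i : ℕ) = ({i} : Finset (Fin n)) := by
  ext l
  simp [agent, Fin.ext_iff]

/-- The larger value of the two solutions that are found with the multiple `k + 1` of the value of
agent `i` as target. -/
def trialValue (A : Auction n) (R : Finset (Fin n)) (b : Fin n → ℚ≥0) (i k : ℕ) : ℚ≥0 :=
  let st := (State.start R).run A (greedyPrice A ((k + 1) * A.value (agent i))) b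
  max (A.value (st.sol false)) (A.value (st.sol true))

/-- The estimate of the optimal value from the agents in the sample `R`. -/
def estimate (A : Auction n) (R : Finset (Fin n)) (b : Fin n → ℚ≥0) : ℚ≥0 :=
  (Finset.range n).sup fun i => (Finset.range n).sup fun k => trialValue A R b i k

/-- The final state: either prices from the estimate for the agents outside of the sample, or
the whole budget for a single agent. -/
def finalState (A : Auction n) (R : Finset (Fin n)) (g : Bool) (b : Fin n → ℚ≥0) : State n :=
  if g then (State.start Rᶜ).run A (greedyPrice A (estimate A R b / 6)) b
  else (State.start Finset.univ).run A (singlePrice A) b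

/-- The mechanism with sample `R`.  If `g` holds, then prices from the estimate are used and solution
`c` is selected. -/
def sampleMechanism (A : Auction n) (R : Finset (Fin n)) (g c : Bool) : Mechanism n where
  winners b := Finset.univ.filter fun i =>
    ∃ j, (g = true → j = c) ∧ i ∈ (finalState A R g b).sol j
  payment b i := if ∃ j, (g = true → j = c) ∧ i ∈ (finalState A R g b).sol j then
    (finalState A R g b).pay i else 0

variable {A : Auction n} {R : Finset (Fin n)} {g c : Bool}

/-- Every agent receives at most one take-it-or-leave-it offer. -/
theorem sampleMechanism_offer (A : Auction n) (R : Finset (Fin n)) (g c : Bool)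
    (b : Fin n → ℚ≥0) (i : Fin n) :
    ∃ o : Option ℚ, ∀ x : ℚ≥0,
      (i ∈ (sampleMechanism A R g c).winners (Function.update b i x) ↔ ∃ q ∈ o, (x : ℚ) ≤ q) ∧
      ∀ q ∈ o, (x : ℚ) ≤ q →
        (sampleMechanism A R g c).payment (Function.update b i x) i = q := by
  -- A sampled agent in the greedy mode can never win. In all other cases the bid of `i` does not
  -- enter the estimate, so the price rule is fixed as the bid varies.
  by_cases hR : g = true ∧ i ∈ R
  · refine ⟨none, fun x => ?_⟩
    have hs : ∀ j, i ∉ (finalState A R g (Function.update b i x)).sol j := by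
      intro j hj
      simp only [finalState, hR.1, if_true] at hj
      have := State.run_start_sol_subset _ _ _ hj
      simp [hR.2] at this
    simp [sampleMechanism, hs]
  · have key : ∃ (price : PriceRule n) (U : Finset (Fin n)), ∀ x : ℚ≥0,
        finalState A R g (Function.update b i x) =
          (State.start U).run A price (Function.update b i x) := by
      cases g
      · exact ⟨singlePrice A, Finset.univ, fun x => rfl⟩
      · refine ⟨greedyPrice A (estimate A R b / 6), Rᶜ, fun x => ?_⟩
        have : estimate A R (Function.update b i x) = estimate A R b := by
          unfold estimate trialValue
          refine Finset.sup_congr rfl fun l _ => Finset.sup_congr rfl fun k _ => ?_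
          rw [State.run_congr (b := Function.update b i x) (b' := b)]
          rintro l' hl'
          refine Function.update_of_ne ?_ _ _
          rintro rfl
          exact hR ⟨rfl, hl'⟩
        simp [finalState, this]
    obtain ⟨price, U, hU⟩ := key
    obtain ⟨o, ho⟩ := State.exists_offer (A := A) price b i n (State.start U)
      (by simp [State.start])
    -- An offer for the solution that is discarded by the coin counts as no offer.
    refine ⟨o.bind fun y => if g = true → y.1 = c then some y.2 else none, fun x => ?_⟩
    obtain ⟨h1, h2⟩ := ho x
    have h1' : ∀ j, i ∈ (finalState A R g (Function.update b i x)).sol j ↔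
        ∃ q, o = some (j, q) ∧ (x : ℚ) ≤ q := by
      rw [hU]
      exact h1
    have h3 : (∃ j, (g = true → j = c) ∧
        i ∈ (finalState A R g (Function.update b i x)).sol j) ↔
        ∃ q ∈ o.bind fun y => if g = true → y.1 = c then some y.2 else none, (x : ℚ) ≤ q := by
      simp only [h1']
      constructor
      · rintro ⟨j, hj, q, rfl, hq⟩
        exact ⟨q, by simpa using hj, hq⟩
      · rintro ⟨q, hq, hxq⟩
        cases o with
        | none => simp at hq
        | some y =>
          simp only [Option.bind_some, Option.mem_def] at hq
          split_ifs at hq with hy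
          simp only [Option.some.injEq] at hq
          exact ⟨y.1, hy, q, by rw [← hq], hxq⟩
    refine ⟨by simpa [sampleMechanism] using h3, fun q hq hxq => ?_⟩
    simp only [sampleMechanism]
    rw [if_pos (h3.2 ⟨q, hq, hxq⟩), hU]
    cases o with
    | none => simp at hq
    | some y =>
      simp only [Option.bind_some, Option.mem_def] at hq
      split_ifs at hq with hy
      simp only [Option.some.injEq] at hq
      exact h2 y.1 q (by rw [← hq]) hxq

theorem sampleMechanism_paysOnlyWinners : (sampleMechanism A R g c).PaysOnlyWinners := by
  intro b i hi
  simp only [sampleMechanism, Finset.mem_filter, Finset.mem_univ, true_and] at hi ⊢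
  exact if_neg hi

/-- The bid only decides whether a fixed price `q` is accepted; the utility is `q - ci` or `0`, and
the true cost selects the better of the two. -/
theorem sampleMechanism_truthful : (sampleMechanism A R g c).Truthful := by
  intro i ci b
  obtain ⟨o, ho⟩ := sampleMechanism_offer A R g c b i
  have hu : ∀ x : ℚ≥0, (sampleMechanism A R g c).utility i ci (Function.update b i x) =
      o.elim 0 fun q => if (x : ℚ) ≤ q then q - ci else 0 := by
    intro x
    obtain ⟨h1, h2⟩ := ho x
    unfold Mechanism.utility
    by_cases hx : ∃ q ∈ o, (x : ℚ) ≤ q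
    · rw [if_pos (h1.2 hx)]
      obtain ⟨q, hq, hxq⟩ := hx
      rw [h2 q hq hxq]
      rw [Option.mem_def] at hq
      subst hq
      simp [hxq]
    · rw [if_neg (fun h => hx (h1.1 h)), sampleMechanism_paysOnlyWinners _ _ (fun h => hx (h1.1 h))]
      cases o with
      | none => simp
      | some q =>
        have : ¬ ((x : ℚ) ≤ q) := fun h => hx ⟨q, rfl, h⟩
        simp [this]
  have hb := hu (b i)
  rw [Function.update_eq_self] at hb
  rw [hb, hu]
  cases o with
  | none => simp
  | some q =>
    simp only [Option.elim_some]
    split_ifs <;> linarith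

theorem sampleMechanism_individuallyRational :
    (sampleMechanism A R g c).IndividuallyRational := by
  intro b i
  obtain ⟨o, ho⟩ := sampleMechanism_offer A R g c b i
  obtain ⟨h1, h2⟩ := ho (b i)
  rw [Function.update_eq_self] at h1 h2
  have h0 : (0 : ℚ) ≤ b i := by positivity
  by_cases hi : i ∈ (sampleMechanism A R g c).winners b
  · obtain ⟨q, hq, hbq⟩ := h1.1 hi
    rw [h2 q hq hbq]
    exact ⟨h0.trans hbq, fun _ => hbq⟩
  · rw [sampleMechanism_paysOnlyWinners _ _ hi]
    exact ⟨le_rfl, fun h => absurd h hi⟩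

theorem finalState_valid (h : ∅ ∈ A.indep) (R : Finset (Fin n)) (g : Bool) (b : Fin n → ℚ≥0) :
    (finalState A R g b).Valid A := by
  unfold finalState
  split_ifs <;> exact State.run_valid h _ _ _

theorem sampleMechanism_winners_true (b : Fin n → ℚ≥0) :
    (sampleMechanism A R true c).winners b = (finalState A R true b).sol c := by
  ext i
  simp [sampleMechanism]

theorem sampleMechanism_winners_false (b : Fin n → ℚ≥0) :
    (sampleMechanism A R false c).winners b =
      (finalState A R false b).sol false ∪ (finalState A R false b).sol true := by
  ext i
  simp [sampleMechanism]

theorem sampleMechanism_sum_payment (b : Fin n → ℚ≥0) :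
    ∑ i, (sampleMechanism A R g c).payment b i =
      ∑ i ∈ (sampleMechanism A R g c).winners b, (finalState A R g b).pay i := by
  simp only [sampleMechanism]
  rw [Finset.sum_filter]

/-- In the second mode, there is at most one winner, who is paid the budget. -/
theorem State.SinglePaid.winners_eq {st : State n} {b : Fin n → ℚ≥0} (h : st.SinglePaid A b) :
    st.sol false ∪ st.sol true = ∅ ∨
      ∃ j i, st.sol j = {i} ∧ st.sol false ∪ st.sol true = {i} ∧ st.pay i = A.budget := by
  rcases h with ⟨h1, h2, -⟩ | ⟨j, i, h1, h2, h3, -⟩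
  · exact Or.inl (by simp [h1, h2])
  · exact Or.inr ⟨j, i, h1, by cases j <;> simp_all, h3⟩

/-- In the greedy mode only one solution is paid, and each solution alone respects the budget; in
the other mode there is at most one winner, who receives exactly the budget. -/
theorem sampleMechanism_budgetFeasible (hI : ∅ ∈ A.indep) (h0 : A.value ∅ = 0) :
    (sampleMechanism A R g c).BudgetFeasible A.budget := by
  intro b
  rw [sampleMechanism_sum_payment]
  cases g
  · rw [sampleMechanism_winners_false]
    have := (State.run_singlePaid (A := A) b).winners_eq
    rcases this with h | ⟨j, i, -, h, h3⟩
    · simp only [finalState, Bool.false_eq_true, if_false]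
      rw [h]
      simp
    · simp only [finalState, Bool.false_eq_true, if_false]
      rw [h, Finset.sum_singleton, h3]
  · rw [sampleMechanism_winners_true]
    exact (State.run_paid hI h0 (by positivity) b Rᶜ).sum_pay_le (by positivity) c

theorem sampleMechanism_winners_mem (hI : ∅ ∈ A.indep) (b : Fin n → ℚ≥0) :
    (sampleMechanism A R g c).winners b ∈ A.indep := by
  cases g
  · rw [sampleMechanism_winners_false]
    have hv := finalState_valid hI R false b
    have := (State.run_singlePaid (A := A) b).winners_eq
    simp only [finalState, Bool.false_eq_true, if_false] at hv ⊢
    rcases this with h | ⟨j, i, h1, h, -⟩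
    · rwa [h]
    · rw [h, ← h1]
      exact hv.indep j
  · rw [sampleMechanism_winners_true]
    exact (finalState_valid hI R true b).indep c


/-! ### The program

Besides the arrays for input and output, the program uses the following arrays: the solutions (`6`
and `7`), flags for the agents that cannot receive an offer (`8`), the payments (`9`), counters
(`10`, `21`, `22`), the best candidate of a scan (`11`: whether there is one, `12`: the agent,
`13`: the solution, `14`: the marginal value), auxiliary values (`15`, `16`, `24`), the price of
the current offer (`17`), the target value (`18`), the estimate of the optimal value (`19`), whether
some offer has been accepted (`20`), and a singleton (`23`). -/

namespace Program

infixr:60 " ⨾ " => Cmd.seq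

/-- The content of cell `0` of array `a`. -/
def scalar (a : ℕ) : Expr := .read a (.const 0)

/-- Store a number in cell `0` of array `a`. -/
def store (a : ℕ) (e : Expr) : Cmd := .assign a (.const 0) e

/-- Increment a counter that is less than the number of agents. -/
def increment (a : ℕ) : Cmd :=
  store a (.mul (.add (scalar a) (.const 1)) (.le (.add (scalar a) (.const 1)) (scalar 0)))

/-- Repeat a command for all values of the counter `a` that are less than the number of agents. -/
def forAgents (a : ℕ) (c : Cmd) : Cmd :=
  store a (.const 0) ⨾ .loop (scalar 0) (c ⨾ increment a)

/-- The array of solution `j`. -/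
def solArray (j : Bool) : ℕ := if j then 7 else 6

/-- Find out whether the current agent can join solution `j`, and its marginal value. -/
def probe (j : Bool) : Cmd :=
  .assign (solArray j) (scalar 10) (.const 1) ⨾
  store 16 (.indep (solArray j)) ⨾
  store 15 (.value (solArray j)) ⨾
  .assign (solArray j) (scalar 10) (.const 0) ⨾
  store 24 (.sub (scalar 15) (.value (solArray j)))

/-- Record the current agent as the best candidate. -/
def record (j : Bool) : Cmd :=
  store 11 (.const 1) ⨾ store 12 (scalar 10) ⨾ store 13 (.const (if j then 1 else 0)) ⨾
  store 14 (scalar 24)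

/-- Compare the current agent with the best candidate. -/
def compare (j : Bool) : Cmd :=
  .cond (.read 8 (scalar 10)) .skip
    (probe j ⨾
      .cond (scalar 16) (.cond (.mul (scalar 11) (.le (scalar 24) (scalar 14))) .skip (record j))
        .skip)

/-- Offer a price to the best candidate. -/
def offer (price : Bool → Expr) (j : Bool) : Cmd :=
  store 17 (price j) ⨾
  .assign 8 (scalar 12) (.const 1) ⨾
  .cond (.le (.read 2 (scalar 12)) (scalar 17))
    (.assign (solArray j) (scalar 12) (.const 1) ⨾ .assign 9 (scalar 12) (scalar 17) ⨾
      store 20 (.const 1))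
    .skip

/-- One round of the mechanism. -/
def round (price : Bool → Expr) : Cmd :=
  store 11 (.const 0) ⨾ forAgents 10 (compare false) ⨾ forAgents 10 (compare true) ⨾
  .cond (scalar 11) (.cond (scalar 13) (offer price true) (offer price false)) .skip

/-- Sequential posted prices for the agents at which `dead` vanishes. -/
def posted (dead : Expr) (price : Bool → Expr) : Cmd :=
  store 20 (.const 0) ⨾
  forAgents 10 (.assign 8 (scalar 10) dead ⨾ .assign 6 (scalar 10) (.const 0) ⨾
    .assign 7 (scalar 10) (.const 0) ⨾ .assign 9 (scalar 10) (.const 0)) ⨾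
  .loop (scalar 0) (round price)

/-- The form `t * (x + 1) - 1` with a test `t` of value `0` or `1` evaluates to `x` or to `-1`
without branching. -/
def greedyPriceExpr (j : Bool) : Expr :=
  .sub (.mul (.le (.add (.value (solArray j)) (scalar 14)) (scalar 18))
    (.add (.div (.mul (scalar 1) (scalar 14)) (scalar 18)) (.const 1))) (.const 1)

def singlePriceExpr (_ : Bool) : Expr :=
  .sub (.mul (.le (scalar 20) (.const 0)) (.add (scalar 1) (.const 1))) (.const 1)

/-- The coin toss of the current agent. -/
def coinExpr : Expr := .read 3 (scalar 10)

/-- The coin toss that selects the mode. -/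
def modeExpr : Expr := .read 3 (scalar 0)

/-- The coin toss that selects the solution. -/
def solutionExpr : Expr := .read 3 (.add (scalar 0) (.const 1))

/-- Replace the estimate by the value of solution `j` if the latter is larger. -/
def raise (j : Bool) : Cmd :=
  .cond (.le (.value (solArray j)) (scalar 19)) .skip (store 19 (.value (solArray j)))

/-- Raise the estimate to the values of the solutions for one target value. -/
def trial : Cmd :=
  store 18 (.mul (.add (scalar 21) (.const 1)) (.value 23)) ⨾
  posted (.sub (.const 1) coinExpr) greedyPriceExpr ⨾ raise false ⨾ raise true

/-- The computation of the estimate from the sampled agents. -/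
def estimation : Cmd :=
  forAgents 22
    (.assign 23 (scalar 22) (.const 1) ⨾ forAgents 21 trial ⨾
      .assign 23 (scalar 22) (.const 0))

def output : Cmd :=
  forAgents 10
    (.cond modeExpr
      (.cond solutionExpr
        (.assign 4 (scalar 10) (.read 7 (scalar 10)))
        (.assign 4 (scalar 10) (.read 6 (scalar 10))))
      (.assign 4 (scalar 10) (.add (.read 6 (scalar 10)) (.read 7 (scalar 10)))) ⨾
    .assign 5 (scalar 10) (.mul (.read 4 (scalar 10)) (.read 9 (scalar 10))))

def body : Cmd :=
  estimation ⨾ store 18 (.div (scalar 19) (.const 6)) ⨾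
  .cond modeExpr (posted coinExpr greedyPriceExpr) (posted (.const 0) singlePriceExpr) ⨾
  output

/-! ### Simulation -/

section Simulation

variable {A : Auction n}

@[simp] theorem eval_scalar (s : Memory) (a : ℕ) : (scalar a).eval A s = s a 0 := by
  simp [scalar, Expr.eval]

/-- A change of cell `i` of array `a`. -/
def putAt (s : Memory) (a i : ℕ) (q : ℚ) : Memory :=
  Function.update s a (Function.update (s a) i q)

theorem putAt_same (s : Memory) (a i : ℕ) (q : ℚ) :
    putAt s a i q a = Function.update (s a) i q := by simp [putAt]

theorem putAt_ne (s : Memory) {a a' : ℕ} (h : a' ≠ a) (i : ℕ) (q : ℚ) :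
    putAt s a i q a' = s a' := by simp [putAt, h]

theorem sem_store (s : Memory) (a : ℕ) (e : Expr) :
    (store a e).sem A s = putAt s a 0 (e.eval A s) := by
  simp [store, Cmd.sem, Expr.eval, putAt]

theorem sem_assign (s : Memory) (a : ℕ) (e f : Expr) :
    (Cmd.assign a e f).sem A s = putAt s a ⌊e.eval A s⌋₊ (f.eval A s) := rfl

theorem sem_seq (s : Memory) (c d : Cmd) : (c ⨾ d).sem A s = d.sem A (c.sem A s) := rfl

theorem sem_skip (s : Memory) : Cmd.skip.sem A s = s := rfl

theorem sem_cond (s : Memory) (e : Expr) (c d : Cmd) :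
    (Cmd.cond e c d).sem A s = if e.eval A s ≠ 0 then c.sem A s else d.sem A s := rfl

theorem sem_cond_pos {s : Memory} {e : Expr} (h : e.eval A s ≠ 0) (c d : Cmd) :
    (Cmd.cond e c d).sem A s = c.sem A s := if_pos h

theorem sem_cond_neg {s : Memory} {e : Expr} (h : e.eval A s = 0) (c d : Cmd) :
    (Cmd.cond e c d).sem A s = d.sem A s := if_neg (not_not.2 h)

/-- A loop over all agents. -/
theorem forAgents_induction {a : ℕ} {c : Cmd} {s : Memory} (ha : a ≠ 0) (hc0 : 0 ∉ c.writes)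
    (hca : a ∉ c.writes) (h0 : s 0 0 = n) {P : ℕ → Memory → Prop}
    (hP0 : P 0 (putAt s a 0 0))
    (hP : ∀ k < n, ∀ s' : Memory, s' 0 0 = (n : ℚ) → s' a 0 = (k : ℚ) → P k s' →
      P (k + 1) (putAt (c.sem A s') a 0 (k + 1 : ℕ))) :
    P n ((forAgents a c).sem A s) := by
  have hl : (forAgents a c).sem A s = ((c ⨾ increment a).sem A)^[n] (putAt s a 0 0) := by
    unfold forAgents
    rw [sem_seq, sem_store]
    simp only [Cmd.sem, eval_scalar, Expr.eval, putAt_ne s ha.symm, h0, Nat.floor_natCast]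
  rw [hl]
  have key : ∀ k ≤ n, (fun (k : ℕ) (s' : Memory) => s' 0 0 = (n : ℚ) ∧ s' a 0 = (k : ℚ) ∧ P k s') k
      (((c ⨾ increment a).sem A)^[k] (putAt s a 0 0)) := by
    intro k hk
    induction k with
    | zero => exact ⟨by rw [Function.iterate_zero, id, putAt_ne _ ha.symm, h0],
        by simp [putAt_same], hP0⟩
    | succ k ih =>
      rw [Function.iterate_succ_apply']
      obtain ⟨h1, h2, h3⟩ := ih (by omega)
      generalize ((c ⨾ increment a).sem A)^[k] (putAt s a 0 0) = s' at h1 h2 h3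
      have hk' : ((k : ℚ) + 1) ≤ n := by exact_mod_cast hk
      have hs : (c ⨾ increment a).sem A s' = putAt (c.sem A s') a 0 (k + 1 : ℕ) := by
        rw [sem_seq, increment, sem_store]
        simp only [Expr.eval, eval_scalar, Cmd.sem_of_notMem_writes A hca,
          Cmd.sem_of_notMem_writes A hc0, h1, h2, hk', if_true, mul_one]
        push_cast
        rfl
      rw [hs]
      refine ⟨?_, by simp [putAt_same], hP k hk s' h1 h2 h3⟩
      rw [putAt_ne _ ha.symm, Cmd.sem_of_notMem_writes A hc0, h1]
  exact (key n le_rfl).2.2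

/-- The array `a` contains the indicator vector of `S`. -/
def Indicates (s : Memory) (a : ℕ) (S : Finset (Fin n)) : Prop :=
  ∀ i : Fin n, s a i = if i ∈ S then 1 else 0

theorem Indicates.storedSet_eq {s : Memory} {a : ℕ} {S : Finset (Fin n)} (h : Indicates s a S) :
    storedSet s a = S := by
  ext i
  simp [storedSet, h i]

theorem Indicates.congr {s s' : Memory} {a : ℕ} {S : Finset (Fin n)} (h : Indicates s a S)
    (hs : s' a = s a) : Indicates s' a S := by
  intro i
  rw [hs]
  exact h i

theorem Indicates.insert {s s' : Memory} {a : ℕ} {S : Finset (Fin n)} (h : Indicates s a S)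
    (i : Fin n) (hs : s' a = Function.update (s a) i 1) : Indicates s' a (insert i S) := by
  intro l
  rw [hs]
  rcases eq_or_ne l i with rfl | hl
  · simp
  · rw [Function.update_of_ne (by simpa [Fin.ext_iff] using hl), h l]
    simp [hl]

/-- The memory represents the state `st`. -/
structure Represents (s : Memory) (st : State n) : Prop where
  sol : ∀ j, Indicates s (solArray j) (st.sol j)
  alive : ∀ i : Fin n, s 8 i = 0 ↔ i ∈ st.alive
  pay : ∀ i : Fin n, s 9 i = st.pay i
  accepted : s 20 0 = if st.sol false = ∅ ∧ st.sol true = ∅ then 0 else 1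

theorem Represents.congr {s s' : Memory} {st : State n} (h : Represents s st) (h6 : s' 6 = s 6)
    (h7 : s' 7 = s 7) (h8 : s' 8 = s 8) (h9 : s' 9 = s 9) (h20 : s' 20 = s 20) :
    Represents s' st := by
  refine ⟨fun j => (h.sol j).congr ?_, ?_, ?_, ?_⟩
  · cases j
    · exact h6
    · exact h7
  · rw [h8]
    exact h.alive
  · rw [h9]
    exact h.pay
  · rw [h20]
    exact h.accepted

/-- The memory contains the best candidate. -/
def HasBest (A : Auction n) (st : State n) (s : Memory) : Option (Fin n × Bool) → Prop
  | none => s 11 0 = 0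
  | some x => s 11 0 = 1 ∧ s 12 0 = (x.1 : ℕ) ∧ s 13 0 = (if x.2 then 1 else 0) ∧
      s 14 0 = st.marginal A x

theorem HasBest.congr {st : State n} {s s' : Memory} {best : Option (Fin n × Bool)}
    (h : HasBest A st s best) (h11 : s' 11 = s 11) (h12 : s' 12 = s 12) (h13 : s' 13 = s 13)
    (h14 : s' 14 = s 14) : HasBest A st s' best := by
  cases best with
  | none => simpa [HasBest, h11] using h
  | some x => simpa [HasBest, h11, h12, h13, h14] using h

theorem storedSet_putAt_ne (s : Memory) {a a' : ℕ} (h : a' ≠ a) (i : ℕ) (q : ℚ) :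
    (storedSet (putAt s a i q) a' : Finset (Fin n)) = storedSet s a' := by
  unfold storedSet
  rw [putAt_ne s h]

theorem storedSet_putAt_one (s : Memory) (a : ℕ) (i : Fin n) :
    (storedSet (putAt s a i 1) a : Finset (Fin n)) = insert i (storedSet s a) := by
  ext l
  simp only [storedSet, putAt_same, Finset.mem_filter, Finset.mem_univ, true_and,
    Finset.mem_insert]
  rcases eq_or_ne l i with rfl | hl
  · simp
  · rw [Function.update_of_ne (by simpa [Fin.ext_iff] using hl)]
    simp [hl]

theorem putAt_one_zero {s : Memory} {a i : ℕ} (h : s a i = 0) :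
    Function.update (Function.update (s a) i 1) i 0 = s a := by
  rw [Function.update_idem, ← h, Function.update_eq_self]

/-- The oracles read a stored set, so the agent is entered into the solution array, the queries are
made, and the agent is removed again. Removal restores the array only because the agent was not in
`S`. -/
theorem probe_spec {s : Memory} {j : Bool} {S : Finset (Fin n)} (hS : Indicates s (solArray j) S)
    {i : Fin n} (hi : s 10 0 = ((i : ℕ) : ℚ)) (hiS : i ∉ S) :
    (probe j).sem A s (solArray j) = s (solArray j) ∧
      (probe j).sem A s 16 0 = (if insert i S ∈ A.indep then 1 else 0) ∧
      (probe j).sem A s 24 0 = (A.value (insert i S) : ℚ) - A.value S := by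
  have h0 : s (solArray j) i = 0 := by rw [hS i, if_neg hiS]
  have hS' := hS.storedSet_eq
  generalize ht : (probe j).sem A s = t
  generalize hp : Cmd.sem A (.assign (solArray j) (scalar 10) (.const 1) ⨾
    store 16 (.indep (solArray j)) ⨾ store 15 (.value (solArray j)) ⨾
    .assign (solArray j) (scalar 10) (.const 0)) s = r
  have hr : r (solArray j) = s (solArray j) ∧ r 16 0 = (if insert i S ∈ A.indep then 1 else 0) ∧
      r 15 0 = A.value (insert i S) := by
    subst hp
    cases j <;> simp only [solArray, if_true, if_false, Bool.false_eq_true] at hS' h0 ⊢ <;>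
    simp [sem_seq, sem_store, sem_assign, Expr.eval, hi, putAt_same, putAt_ne,
      storedSet_putAt_ne, storedSet_putAt_one, hS', putAt_one_zero h0]
  have hrt : t = putAt r 24 0 (r 15 0 - A.value (storedSet r (solArray j))) := by
    rw [← ht, ← hp]
    simp only [probe, sem_seq, sem_store, Expr.eval, eval_scalar]
  have hrS : storedSet r (solArray j) = S := (hS.congr hr.1).storedSet_eq
  rw [hrt, hrS, hr.2.2]
  refine ⟨?_, ?_, by simp [putAt_same]⟩
  · rw [putAt_ne, hr.1]
    cases j <;> simp [solArray]
  · rw [putAt_ne _ (by norm_num), hr.2.1]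

theorem record_spec {s : Memory} {st : State n} {i : Fin n} (hi : s 10 0 = ((i : ℕ) : ℚ)) (j : Bool)
    (h24 : s 24 0 = st.marginal A (i, j)) : HasBest A st ((record j).sem A s) (some (i, j)) := by
  cases j <;>
  simp [record, HasBest, sem_seq, sem_store, Expr.eval, putAt_same, putAt_ne, hi, h24]

theorem compare_sol (s : Memory) (j : Bool) {S : Finset (Fin n)}
    (hS : Indicates s (solArray j) S) {i : Fin n} (hi : s 10 0 = ((i : ℕ) : ℚ))
    (hiS : s 8 i = 0 → i ∉ S) :
    (compare j).sem A s (solArray j) = s (solArray j) := by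
  have he : (Expr.read 8 (scalar 10)).eval A s = s 8 i := by simp [Expr.eval, hi]
  by_cases h : s 8 i = 0
  · have hp := (probe_spec (A := A) hS hi (hiS h)).1
    rw [compare, sem_cond_neg (he.trans h), sem_seq, Cmd.sem_of_notMem_writes A _, hp]
    cases j <;> decide
  · rw [compare, sem_cond_pos (by rwa [he]), sem_skip]

/-- One step of the scan. -/
theorem compare_spec {s : Memory} {st : State n} (hv : st.Valid A) (hs : Represents s st)
    {best : Option (Fin n × Bool)} (hb : HasBest A st s best) {i : Fin n}
    (hi : s 10 0 = ((i : ℕ) : ℚ)) (j : Bool) :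
    HasBest A st ((compare j).sem A s) (st.improve A best (i, j)) := by
  by_cases ha : i ∈ st.alive
  · have h8 : s 8 i = 0 := (hs.alive i).2 ha
    have hiS : i ∉ st.sol j := fun h => hv.notMem_alive _ _ h ha
    obtain ⟨h1, h2, h3⟩ := probe_spec (A := A) (hs.sol j) hi hiS
    have hb' : HasBest A st ((probe j).sem A s) best := by
      refine hb.congr ?_ ?_ ?_ ?_ <;>
      exact Cmd.sem_of_notMem_writes A (by cases j <;> decide) s
    have hi' : (probe j).sem A s 10 0 = ((i : ℕ) : ℚ) := by
      rw [Cmd.sem_of_notMem_writes A (by cases j <;> decide), hi]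
    unfold compare State.improve
    simp only [sem_cond, sem_seq, sem_skip, Expr.eval, eval_scalar, hi, Nat.floor_natCast, h8,
      ne_eq, not_true_eq_false, if_false]
    generalize (probe j).sem A s = t at *
    by_cases hI : insert i (st.sol j) ∈ A.indep
    · have hc : st.Candidate A (i, j) := ⟨ha, hI⟩
      rw [if_pos hI] at h2
      rw [if_pos hc, h2]
      simp only [one_ne_zero, not_false_eq_true, if_true]
      cases best with
      | none =>
        have h11 : t 11 0 = 0 := hb'
        simp only [h11, zero_mul, not_true_eq_false, if_false]
        exact record_spec hi' j h3
      | some y =>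
        obtain ⟨h11, h12, h13, h14⟩ := hb'
        simp only [h11, h14, one_mul, h3]
        by_cases hm : st.marginal A (i, j) ≤ st.marginal A y
        · have hm' := hm
          simp only [State.marginal] at hm'
          simp only [State.marginal, hm', if_true, one_ne_zero, not_false_eq_true]
          exact ⟨h11, h12, h13, h14⟩
        · have hm' := hm
          simp only [State.marginal] at hm'
          simp only [State.marginal, hm', if_false, not_true_eq_false]
          exact record_spec hi' j h3
    · have hc : ¬ st.Candidate A (i, j) := fun h => hI h.2
      rw [if_neg hI] at h2
      rw [if_neg hc, h2]
      simpa using hb'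
  · have h8 : s 8 i ≠ 0 := fun h => ha ((hs.alive i).1 h)
    have hc : ¬ st.Candidate A (i, j) := fun h => ha h.1
    unfold compare State.improve
    simp only [sem_cond, sem_skip, Expr.eval, eval_scalar, hi, Nat.floor_natCast, h8, if_neg hc,
      ne_eq, not_false_eq_true, if_true]
    exact hb

theorem compare_represents {s : Memory} {st : State n} (hv : st.Valid A) (hs : Represents s st)
    {i : Fin n} (hi : s 10 0 = ((i : ℕ) : ℚ)) (j : Bool) :
    Represents ((compare j).sem A s) st := by
  have h := compare_sol (A := A) s j (hs.sol j) hi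
    fun h h' => hv.notMem_alive _ _ h' ((hs.alive i).1 h)
  have hw := fun a (ha : a ∉ (compare j).writes) => Cmd.sem_of_notMem_writes A ha s
  cases j
  · exact hs.congr h (hw _ (by decide)) (hw _ (by decide)) (hw _ (by decide)) (hw _ (by decide))
  · exact hs.congr (hw _ (by decide)) h (hw _ (by decide)) (hw _ (by decide)) (hw _ (by decide))

theorem scan_spec {s : Memory} {st : State n} (hv : st.Valid A) (hs : Represents s st)
    {best : Option (Fin n × Bool)} (hb : HasBest A st s best) (h0 : s 0 0 = n) (j : Bool) :
    Represents ((forAgents 10 (compare j)).sem A s) st ∧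
      HasBest A st ((forAgents 10 (compare j)).sem A s) (st.scan A j best n) := by
  refine forAgents_induction (P := fun k s' => Represents s' st ∧
    HasBest A st s' (st.scan A j best k)) (by norm_num) (by cases j <;> decide)
    (by cases j <;> decide) h0 ?_ ?_
  · exact ⟨hs.congr (by simp [putAt_ne]) (by simp [putAt_ne]) (by simp [putAt_ne])
      (by simp [putAt_ne]) (by simp [putAt_ne]), hb.congr (by simp [putAt_ne]) (by simp [putAt_ne])
      (by simp [putAt_ne]) (by simp [putAt_ne])⟩
  · rintro k hk s' - hk' ⟨h1, h2⟩
    have h3 := compare_represents hv h1 (i := ⟨k, hk⟩) hk' j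
    have h4 := compare_spec hv h1 h2 (i := ⟨k, hk⟩) hk' j
    rw [State.scan, dif_pos hk]
    exact ⟨h3.congr (by simp [putAt_ne]) (by simp [putAt_ne]) (by simp [putAt_ne])
      (by simp [putAt_ne]) (by simp [putAt_ne]), h4.congr (by simp [putAt_ne])
      (by simp [putAt_ne]) (by simp [putAt_ne]) (by simp [putAt_ne])⟩

/-- In memories that agree with `s` on the arrays `0`, `1` and `18`, the expression `e` computes
the price of `price` for the best candidate. -/
def Computes (A : Auction n) (s : Memory) (e : Bool → Expr) (price : PriceRule n) : Prop :=
  ∀ (s' : Memory) (st : State n) (x : Fin n × Bool), (∀ a ∈ ({0, 1, 18} : Finset ℕ), s' a = s a) →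
    Represents s' st → s' 14 0 = st.marginal A x → (e x.2).eval A s' = price st x.1 x.2

theorem greedyPrice_computes {s : Memory} (h1 : s 1 0 = A.budget) :
    Computes A s greedyPriceExpr (greedyPrice A (s 18 0)) := by
  intro s' st x hs hr hm
  have e1 : s' 1 0 = A.budget := by rw [hs 1 (by decide), h1]
  have e18 : s' 18 = s 18 := hs 18 (by decide)
  have e6 := (hr.sol x.2).storedSet_eq
  simp only [greedyPriceExpr, Expr.eval, eval_scalar, e1, e18, e6, hm, greedyPrice]
  split_ifs <;> ring

theorem singlePrice_computes {s : Memory} (h1 : s 1 0 = A.budget) :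
    Computes A s singlePriceExpr (singlePrice A) := by
  intro s' st x hs hr _
  have e1 : s' 1 0 = A.budget := by rw [hs 1 (by decide), h1]
  simp only [singlePriceExpr, Expr.eval, eval_scalar, e1, hr.accepted, singlePrice]
  by_cases h : st.sol false = ∅ ∧ st.sol true = ∅
  · simp [h]
  · have : ¬ ((1 : ℚ) ≤ 0) := by norm_num
    simp only [h, if_false, this]
    ring

theorem offer_spec {s : Memory} {st : State n} (hs : Represents s st) {b : Fin n → ℚ≥0}
    (hb : ∀ i : Fin n, s 2 i = b i) (e : Bool → Expr) (i : Fin n) (j : Bool)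
    (hi : s 12 0 = ((i : ℕ) : ℚ)) :
    Represents ((offer e j).sem A s) (st.offer b i j ((e j).eval A s)) := by
  set q := (e j).eval A s with hq
  have hbi := hb i
  have halive : ∀ l : Fin n, Function.update (s 8) i 1 l = 0 ↔ l ∈ st.alive.erase i := by
    intro l
    rcases eq_or_ne l i with rfl | hl
    · simp
    · rw [Function.update_of_ne (by simpa [Fin.ext_iff] using hl), hs.alive l]
      simp [hl]
  by_cases hbq : (b i : ℚ) ≤ q
  · have key : (offer e j).sem A s = putAt (putAt (putAt (putAt (putAt s 17 0 q) 8 i 1)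
        (solArray j) i 1) 9 i q) 20 0 1 := by
      rw [offer, sem_seq, sem_seq, sem_cond_pos]
      · cases j <;> simp [sem_seq, sem_store, sem_assign, Expr.eval, putAt_same, putAt_ne, hi, hq,
          solArray]
      · simp [sem_store, sem_assign, Expr.eval, putAt_same, putAt_ne, hi, hbi, ← hq, hbq]
    rw [key]
    unfold State.offer
    rw [if_pos hbq]
    refine ⟨fun k => ?_, ?_, ?_, ?_⟩
    · rcases eq_or_ne k j with rfl | hk
      · simp only [Function.update_self]
        refine (hs.sol k).insert i ?_
        cases k <;> simp [solArray, putAt_same, putAt_ne]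
      · simp only [Function.update_of_ne hk]
        refine (hs.sol k).congr ?_
        cases k <;> cases j <;> simp_all [solArray, putAt_ne]
    · intro l
      have : putAt (putAt (putAt (putAt (putAt s 17 0 q) 8 i 1) (solArray j) i 1) 9 i q) 20 0 1 8 =
          Function.update (s 8) i 1 := by
        cases j <;> simp [solArray, putAt_same, putAt_ne]
      rw [this]
      exact halive l
    · intro l
      have : putAt (putAt (putAt (putAt (putAt s 17 0 q) 8 i 1) (solArray j) i 1) 9 i q) 20 0 1 9 =
          Function.update (s 9) i q := by
        cases j <;> simp [solArray, putAt_same, putAt_ne]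
      rw [this]
      rcases eq_or_ne l i with rfl | hl
      · simp
      · rw [Function.update_of_ne (by simpa [Fin.ext_iff] using hl), hs.pay l]
        exact (Function.update_of_ne hl _ _).symm
    · rw [putAt_same, Function.update_self, if_neg]
      rintro ⟨h1, h2⟩
      cases j <;> simp at h1 h2
  · have key : (offer e j).sem A s = putAt (putAt s 17 0 q) 8 i 1 := by
      rw [offer, sem_seq, sem_seq, sem_cond_neg]
      · simp [sem_skip, sem_store, sem_assign, Expr.eval, putAt_ne, hi, hq]
      · simp [sem_store, sem_assign, Expr.eval, putAt_same, putAt_ne, hi, hbi, ← hq, hbq]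
    rw [key]
    unfold State.offer
    rw [if_neg hbq]
    refine ⟨fun k => (hs.sol k).congr ?_, ?_, ?_, ?_⟩
    · cases k <;> simp [solArray, putAt_ne]
    · intro l
      rw [putAt_same, putAt_ne _ (by norm_num)]
      exact halive l
    · simpa [putAt_ne] using hs.pay
    · simpa [putAt_ne] using hs.accepted

/-- The two scans leave the represented state alone and end with `State.pick` in the cells for the
best candidate; the offer is then the only change of state. -/
theorem round_spec {s : Memory} {st : State n} (hv : st.Valid A) (hs : Represents s st)
    {b : Fin n → ℚ≥0} (hb : ∀ i : Fin n, s 2 i = b i) (h0 : s 0 0 = n) {e : Bool → Expr}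
    {price : PriceRule n} (he : Computes A s e price) :
    Represents ((round e).sem A s) (st.step A price b) := by
  set s1 := putAt s 11 0 0 with hs1
  have r1 : Represents s1 st := hs.congr (by simp [s1, putAt_ne]) (by simp [s1, putAt_ne])
    (by simp [s1, putAt_ne]) (by simp [s1, putAt_ne]) (by simp [s1, putAt_ne])
  have b1 : HasBest A st s1 none := by simp [HasBest, s1, putAt_same]
  obtain ⟨r2, b2⟩ := scan_spec hv r1 b1 (by simp [s1, putAt_ne, h0]) false
  obtain ⟨r3, b3⟩ := scan_spec hv r2 b2 (by
    rw [Cmd.sem_of_notMem_writes A (by decide)]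
    simp [s1, putAt_ne, h0]) true
  set s3 := (forAgents 10 (compare true)).sem A ((forAgents 10 (compare false)).sem A s1) with hs3
  have hf : ∀ a ∈ ({0, 1, 2, 18} : Finset ℕ), s3 a = s a := by
    intro a ha
    rw [hs3, Cmd.sem_of_notMem_writes A, Cmd.sem_of_notMem_writes A, hs1, putAt_ne]
    all_goals
      revert a
      decide
  have key : (round e).sem A s = (Cmd.cond (scalar 11) (.cond (scalar 13) (offer e true)
      (offer e false)) .skip).sem A s3 := by
    simp only [round, sem_seq, sem_store, Expr.eval, hs3, hs1]
  rw [key]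
  have hpick : st.scan A true (st.scan A false none n) n = st.pick A := rfl
  rw [hpick] at b3
  unfold State.step
  cases hp : st.pick A with
  | none =>
    rw [hp] at b3
    rw [sem_cond_neg (by rw [eval_scalar]; exact b3)]
    exact r3
  | some x =>
    obtain ⟨i, j⟩ := x
    rw [hp] at b3
    obtain ⟨h11, h12, h13, h14⟩ := b3
    rw [sem_cond_pos (by simp [h11])]
    have hq := he s3 st (i, j) (fun a ha => hf a (by revert a; decide)) r3 h14
    have ho := offer_spec (A := A) r3 (b := b) (by rw [hf 2 (by decide)]; exact hb) e i j h12
    rw [hq] at ho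
    cases j
    · rw [sem_cond_neg (by simp [h13])]
      exact ho
    · rw [sem_cond_pos (by simp [h13])]
      exact ho

end Simulation

end Program


/-! ### Simulation of the complete greedy game and of the estimate -/

namespace Program

section Simulation

variable {A : Auction n}

theorem notMem_writes_posted (d : Expr) (e : Bool → Expr) {a : ℕ}
    (ha : a ∈ ({0, 1, 2, 3, 4, 5, 18, 19, 21, 22, 23} : Finset ℕ)) : a ∉ (posted d e).writes := by
  have : ∀ a ∈ ({0, 1, 2, 3, 4, 5, 18, 19, 21, 22, 23} : Finset ℕ), a ∉ (posted d e).writes := by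
    simp [posted, round, offer, forAgents, compare, probe, record, store, increment, Cmd.writes,
      solArray]
  exact this a ha

theorem notMem_writes_round (e : Bool → Expr) {a : ℕ}
    (ha : a ∈ ({0, 1, 2, 3, 4, 5, 18, 19, 21, 22, 23} : Finset ℕ)) : a ∉ (round e).writes := by
  have := notMem_writes_posted (.const 0) e ha
  simp only [posted, Cmd.writes, Finset.mem_union, not_or] at this
  exact this.2.2

theorem indicates_empty {s : Memory} {a : ℕ} (h : ∀ i : Fin n, s a i = 0) :
    Indicates s a (∅ : Finset (Fin n)) := by
  intro i
  simp [h i]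

theorem update_eq_of_lt_succ {f : ℕ → ℚ} {k : ℕ} {P : ℕ → ℚ → Prop} (h : ∀ i < k, P i (f i))
    {q : ℚ} (hq : P k q) : ∀ i < k + 1, P i (Function.update f k q i) := by
  intro i hi
  rcases Nat.lt_succ_iff_lt_or_eq.1 hi with h' | rfl
  · rw [Function.update_of_ne h'.ne]
    exact h i h'
  · rwa [Function.update_self]

theorem posted_spec {s : Memory} {b : Fin n → ℚ≥0} (hb : ∀ i : Fin n, s 2 i = b i)
    (h0 : s 0 0 = n) (hI : ∅ ∈ A.indep) {d : Expr} {U : Finset (Fin n)}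
    (hd : ∀ (s' : Memory) (i : Fin n), s' 0 = s 0 → s' 3 = s 3 → s' 10 0 = (i : ℕ) →
      (d.eval A s' = 0 ↔ i ∈ U))
    {e : Bool → Expr} {price : PriceRule n} (he : Computes A s e price) :
    Represents ((posted d e).sem A s) ((State.start U).run A price b) := by
  set s1 := putAt s 20 0 0 with hs1
  set c : Cmd := .assign 8 (scalar 10) d ⨾ .assign 6 (scalar 10) (.const 0) ⨾
    .assign 7 (scalar 10) (.const 0) ⨾ .assign 9 (scalar 10) (.const 0) with hc
  have hcw : ∀ a ∈ ({0, 1, 2, 3, 18, 20} : Finset ℕ), a ∉ (forAgents 10 c).writes := by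
    simp [hc, forAgents, store, increment, Cmd.writes]
  have h2 : ∀ a ∈ ({0, 1, 2, 3, 18} : Finset ℕ), (forAgents 10 c).sem A s1 a = s a := by
    intro a ha
    rw [Cmd.sem_of_notMem_writes A (hcw a (by revert a; decide)), hs1, putAt_ne]
    revert a
    decide
  -- The arrays `0` and `3` are tracked because the expression `d` reads the number of agents and
  -- the coins while the flags are being initialized.
  have h3 : (∀ i < n, (forAgents 10 c).sem A s1 8 i = 0 ↔ ∃ h : i < n, (⟨i, h⟩ : Fin n) ∈ U) ∧
      (∀ i < n, (forAgents 10 c).sem A s1 6 i = 0) ∧ (∀ i < n, (forAgents 10 c).sem A s1 7 i = 0) ∧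
      (∀ i < n, (forAgents 10 c).sem A s1 9 i = 0) ∧ (forAgents 10 c).sem A s1 3 = s 3 ∧
      (forAgents 10 c).sem A s1 0 = s 0 := by
    refine forAgents_induction (P := fun k s' =>
      (∀ i < k, s' 8 i = 0 ↔ ∃ h : i < n, (⟨i, h⟩ : Fin n) ∈ U) ∧ (∀ i < k, s' 6 i = 0) ∧
      (∀ i < k, s' 7 i = 0) ∧ (∀ i < k, s' 9 i = 0) ∧ s' 3 = s 3 ∧ s' 0 = s 0)
      (by norm_num) (by simp [hc, Cmd.writes]) (by simp [hc, Cmd.writes])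
      (by simp [hs1, putAt_ne, h0]) ?_ ?_
    · simp [hs1, putAt_ne]
    · rintro k hk s' - h10 ⟨p8, p6, p7, p9, p3, p0⟩
      have key : c.sem A s' = putAt (putAt (putAt (putAt s' 8 k (d.eval A s')) 6 k 0) 7 k 0) 9 k 0 := by
        simp [hc, sem_seq, sem_assign, Expr.eval, putAt_ne, h10]
      rw [key]
      have hdk := hd s' ⟨k, hk⟩ p0 p3 h10
      refine ⟨?_, ?_, ?_, ?_, by simpa [putAt_ne] using p3, by simpa [putAt_ne] using p0⟩
      all_goals simp only [putAt_same, putAt_ne, ne_eq, Nat.reduceEqDiff, not_false_eq_true]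
      · exact update_eq_of_lt_succ (P := fun i q => q = 0 ↔ ∃ h : i < n, (⟨i, h⟩ : Fin n) ∈ U) p8
          (hdk.trans ⟨fun h => ⟨hk, h⟩, fun ⟨_, h⟩ => h⟩)
      · exact update_eq_of_lt_succ (P := fun _ q => q = 0) p6 rfl
      · exact update_eq_of_lt_succ (P := fun _ q => q = 0) p7 rfl
      · exact update_eq_of_lt_succ (P := fun _ q => q = 0) p9 rfl
  have h20 : (forAgents 10 c).sem A s1 20 = s1 20 := Cmd.sem_of_notMem_writes A (hcw 20 (by decide)) _
  have key : (posted d e).sem A s =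
      ((round e).sem A)^[n] ((forAgents 10 c).sem A s1) := by
    simp only [posted, sem_seq, sem_store, Expr.eval, ← hs1, ← hc]
    simp only [Cmd.sem, eval_scalar, h2 0 (by decide), h0, Nat.floor_natCast]
  rw [key]
  generalize (forAgents 10 c).sem A s1 = s2 at *
  have r2 : Represents s2 (State.start U) := by
    refine ⟨fun j => indicates_empty ?_, fun i => ?_, fun i => h3.2.2.2.1 i i.2, ?_⟩
    · cases j
      · exact fun i => h3.2.1 i i.2
      · exact fun i => h3.2.2.1 i i.2
    · rw [h3.1 i i.2]
      exact ⟨fun ⟨_, h⟩ => h, fun h => ⟨i.2, h⟩⟩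
    · rw [h20]
      simp [hs1, putAt_same, State.start]
  -- Validity accompanies the simulation since probing is correct only for alive agents that lie in
  -- no solution.
  have hk : ∀ k, State.Valid A ((State.step A price b)^[k] (State.start U)) ∧
      Represents (((round e).sem A)^[k] s2) ((State.step A price b)^[k] (State.start U)) ∧
      ∀ a ∈ ({0, 1, 2, 18} : Finset ℕ), ((round e).sem A)^[k] s2 a = s2 a := by
    intro k
    induction k with
    | zero => exact ⟨State.Valid.start hI U, r2, fun _ _ => rfl⟩
    | succ k ih =>
      obtain ⟨i1, i2, i3⟩ := ih
      simp only [Function.iterate_succ_apply']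
      generalize ((round e).sem A)^[k] s2 = s3 at *
      generalize (State.step A price b)^[k] (State.start U) = st at *
      have i4 : ∀ a ∈ ({0, 1, 2, 18} : Finset ℕ), s3 a = s a := by
        intro a ha
        rw [i3 a ha, h2 a]
        revert a
        decide
      refine ⟨?_, ?_, ?_⟩
      · unfold State.step
        cases hp : st.pick A with
        | none => exact i1
        | some x => exact i1.offer (State.pick_candidate hp) _ _
      · refine round_spec i1 i2 (by rw [i4 2 (by decide)]; exact hb)
          (by rw [i4 0 (by decide), h0]) ?_
        intro s' st' x hs'
        refine he s' st' x fun a ha => ?_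
        rw [hs' a ha, i4 a]
        revert a
        decide
      · intro a ha
        rw [Cmd.sem_of_notMem_writes A (notMem_writes_round e _), i3 a ha]
        revert a
        decide
  exact (hk n).2.1

theorem raise_spec {s : Memory} {j : Bool} {S : Finset (Fin n)} (hS : Indicates s (solArray j) S)
    {q : ℚ≥0} (hq : s 19 0 = q) : (raise j).sem A s 19 0 = (max q (A.value S) : ℚ≥0) := by
  have hS' := hS.storedSet_eq
  by_cases h : (A.value S : ℚ) ≤ q
  · rw [raise, sem_cond_pos (by simp [Expr.eval, hS', hq, h]), sem_skip, hq, max_eq_left]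
    exact_mod_cast h
  · rw [raise, sem_cond_neg (by simp [Expr.eval, hS', hq, h]), sem_store, putAt_same,
      max_eq_right (le_of_lt (by exact_mod_cast not_le.1 h))]
    simp [Expr.eval, hS']

/-- The memory contains the input. -/
structure HasInput (A : Auction n) (ω : ℕ → Bool) (b : Fin n → ℚ≥0) (s : Memory) : Prop where
  agents : s 0 0 = n
  budget : s 1 0 = A.budget
  cost : ∀ i : Fin n, s 2 i = b i
  coin : ∀ i < n + 2, s 3 i = if ω i then 1 else 0

theorem HasInput.congr {ω : ℕ → Bool} {b : Fin n → ℚ≥0} {s s' : Memory} (h : HasInput A ω b s)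
    (hs : ∀ a ∈ ({0, 1, 2, 3} : Finset ℕ), s' a = s a) : HasInput A ω b s' := by
  refine ⟨?_, ?_, ?_, ?_⟩
  · rw [hs 0 (by decide), h.agents]
  · rw [hs 1 (by decide), h.budget]
  · rw [hs 2 (by decide)]
    exact h.cost
  · rw [hs 3 (by decide)]
    exact h.coin

/-- The sample that is given by the coin tosses. -/
def sample (ω : ℕ → Bool) : Finset (Fin n) := Finset.univ.filter fun i => ω i = true

theorem notMem_writes_forAgents {a a' : ℕ} {c : Cmd} (h : a' ≠ a) (hc : a' ∉ c.writes) :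
    a' ∉ (forAgents a c).writes := by
  simp [forAgents, store, increment, Cmd.writes, h, hc]

theorem notMem_writes_trial {a : ℕ}
    (ha : a ∈ ({0, 1, 2, 3, 4, 5, 21, 22, 23} : Finset ℕ)) : a ∉ trial.writes := by
  have h1 : a ∈ ({0, 1, 2, 3, 4, 5, 18, 19, 21, 22, 23} : Finset ℕ) := by
    revert a
    decide
  have h2 : a ≠ 18 ∧ a ≠ 19 := by
    revert a
    decide
  simp [trial, store, raise, Cmd.writes, h2.1, h2.2, notMem_writes_posted _ _ h1]

theorem notMem_writes_estimation {a : ℕ}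
    (ha : a ∈ ({0, 1, 2, 3, 4, 5} : Finset ℕ)) : a ∉ estimation.writes := by
  have h1 : a ∈ ({0, 1, 2, 3, 4, 5, 21, 22, 23} : Finset ℕ) := by
    revert a
    decide
  have h2 : a ≠ 21 ∧ a ≠ 22 ∧ a ≠ 23 := by
    revert a
    decide
  refine notMem_writes_forAgents h2.2.1 ?_
  simp [Cmd.writes, h2.2.2, notMem_writes_forAgents h2.1 (notMem_writes_trial h1)]

theorem trial_spec {ω : ℕ → Bool} {b : Fin n → ℚ≥0} {s : Memory} (hs : HasInput A ω b s)
    (hI : ∅ ∈ A.indep) {i k : ℕ} (h23 : storedSet s 23 = agent (n := n) i) (h21 : s 21 0 = k)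
    {q : ℚ≥0} (hq : s 19 0 = q) :
    trial.sem A s 19 0 = (max q (trialValue A (sample ω) b i k) : ℚ≥0) := by
  set s1 := putAt s 18 0 ((k + 1) * A.value (agent i)) with hs1
  have h1 : (store 18 (.mul (.add (scalar 21) (.const 1)) (.value 23))).sem A s = s1 := by
    simp [sem_store, Expr.eval, h21, h23, hs1]
  have i1 : HasInput A ω b s1 := hs.congr (by
    intro a ha
    rw [hs1, putAt_ne]
    revert a
    decide)
  have e18 : s1 18 0 = ((k + 1) * A.value (agent i)) := by simp [hs1, putAt_same]
  have hp := posted_spec (A := A) i1.cost i1.agents hI (d := .sub (.const 1) coinExpr)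
    -- Here the flag is `1` minus the coin, so exactly the sampled agents are alive; the final game
    -- uses the coin itself and hence the complement.
    (U := sample ω) (e := greedyPriceExpr) (price := greedyPrice A (s1 18 0)) (by
      intro s' l _ h3 h10
      simp only [Expr.eval, coinExpr, eval_scalar, h10, Nat.floor_natCast, h3,
        i1.coin l (by omega), sample, Finset.mem_filter, Finset.mem_univ, true_and]
      cases ω l <;> simp) (greedyPrice_computes i1.budget)
  have h19 : (posted (.sub (.const 1) coinExpr) greedyPriceExpr).sem A s1 19 0 = q := by
    rw [Cmd.sem_of_notMem_writes A (notMem_writes_posted _ _ (by decide)), hs1,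
      putAt_ne _ (by norm_num), hq]
  rw [trial, sem_seq, sem_seq, sem_seq, h1]
  have h3 := raise_spec (A := A) (hp.sol false) h19
  have h4 := raise_spec (A := A) (j := true) ((hp.sol true).congr
    (Cmd.sem_of_notMem_writes A (by decide) _)) h3
  rw [h4, e18, trialValue, max_assoc]

/-- The running maximum in array `19` mirrors the double supremum, with the partial suprema as loop
invariants. Array `23` is a singleton only inside the outer loop and is zero between its iterations.
-/
theorem estimation_spec {ω : ℕ → Bool} {b : Fin n → ℚ≥0} {s : Memory} (hs : HasInput A ω b s)
    (hI : ∅ ∈ A.indep) (h23 : ∀ i, s 23 i = 0) (h19 : s 19 0 = 0) :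
    HasInput A ω b (estimation.sem A s) ∧
      estimation.sem A s 19 0 = estimate A (sample ω) b := by
  refine ⟨hs.congr fun a ha => Cmd.sem_of_notMem_writes A (notMem_writes_estimation (by
    revert a
    decide)) s, ?_⟩
  refine (forAgents_induction (P := fun i s' => (HasInput A ω b s' ∧ ∀ l, s' 23 l = 0) ∧
    s' 19 0 = ((Finset.range i).sup fun i => (Finset.range n).sup fun k =>
      trialValue A (sample ω) b i k : ℚ≥0)) (by norm_num) ?_ ?_ hs.agents ?_ ?_).2
  · simp [Cmd.writes, notMem_writes_forAgents (show 0 ≠ 21 by decide)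
      (notMem_writes_trial (show 0 ∈ _ by decide))]
  · simp [Cmd.writes, notMem_writes_forAgents (show 22 ≠ 21 by decide)
      (notMem_writes_trial (show 22 ∈ _ by decide))]
  · refine ⟨⟨hs.congr ?_, ?_⟩, ?_⟩
    · intro a ha
      rw [putAt_ne]
      revert a
      decide
    · simpa [putAt_ne] using h23
    · simpa [putAt_ne] using h19
  · rintro i hi s1 - h22 ⟨⟨hs1, e23⟩, e19⟩
    set q := (Finset.range i).sup fun i => (Finset.range n).sup fun k =>
      trialValue A (sample ω) b i k with hq
    set s2 := putAt s1 23 i 1 with hs2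
    have i2 : HasInput A ω b s2 := hs1.congr (by
      intro a ha
      rw [hs2, putAt_ne]
      revert a
      decide)
    have hloop : (HasInput A ω b ((forAgents 21 trial).sem A s2) ∧
        (forAgents 21 trial).sem A s2 23 = Function.update (s1 23) i 1) ∧
        (forAgents 21 trial).sem A s2 19 0 = (max q ((Finset.range n).sup fun k =>
          trialValue A (sample ω) b i k) : ℚ≥0) := by
      refine forAgents_induction (P := fun k s' => (HasInput A ω b s' ∧
        s' 23 = Function.update (s1 23) i 1) ∧ s' 19 0 = (max q ((Finset.range k).sup fun k =>
          trialValue A (sample ω) b i k) : ℚ≥0)) (by norm_num) (notMem_writes_trial (by decide))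
        (notMem_writes_trial (by decide)) i2.agents ?_ ?_
      · refine ⟨⟨i2.congr ?_, ?_⟩, ?_⟩
        · intro a ha
          rw [putAt_ne]
          revert a
          decide
        · simp [hs2, putAt_ne, putAt_same]
        · simp [hs2, putAt_ne, e19]
      · rintro k hk s3 - h21 ⟨⟨hs3, f23⟩, f19⟩
        refine ⟨⟨hs3.congr ?_, ?_⟩, ?_⟩
        · intro a ha
          rw [putAt_ne, Cmd.sem_of_notMem_writes A (notMem_writes_trial _)]
          all_goals
            revert a
            decide
        · rw [putAt_ne _ (by norm_num), Cmd.sem_of_notMem_writes A (notMem_writes_trial (by decide)), f23]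
        · have hst : storedSet s3 23 = agent (n := n) i := by
            ext l
            simp only [storedSet, agent, Finset.mem_filter, Finset.mem_univ, true_and, f23]
            by_cases hl : (l : ℕ) = i
            · simp [hl]
            · simp [hl, e23]
          rw [putAt_ne _ (by norm_num), trial_spec hs3 hI hst h21 f19, Finset.range_add_one,
            Finset.sup_insert, max_assoc, max_comm (trialValue _ _ _ _ _)]
    have key : (Cmd.assign 23 (scalar 22) (.const 1) ⨾ forAgents 21 trial ⨾
        .assign 23 (scalar 22) (.const 0)).sem A s1 =
        putAt ((forAgents 21 trial).sem A s2) 23 i 0 := by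
      have e22 : (forAgents 21 trial).sem A s2 22 0 = i := by
        rw [Cmd.sem_of_notMem_writes A (notMem_writes_forAgents (by decide)
          (notMem_writes_trial (by decide))), hs2, putAt_ne _ (by norm_num), h22]
      simp only [sem_seq, sem_assign, eval_scalar, h22, Nat.floor_natCast, Expr.eval, ← hs2, e22]
    rw [key]
    obtain ⟨⟨g1, g2⟩, g3⟩ := hloop
    refine ⟨⟨g1.congr ?_, ?_⟩, ?_⟩
    · intro a ha
      rw [putAt_ne, putAt_ne]
      all_goals
        revert a
        decide
    · intro l
      rw [putAt_ne _ (by norm_num), putAt_same, g2, Function.update_idem]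
      by_cases hl : l = i
      · simp [hl]
      · simp [hl, e23]
    · rw [putAt_ne _ (by norm_num), putAt_ne _ (by norm_num), g3, Finset.range_add_one,
        Finset.sup_insert, max_comm]

end Simulation

end Program


/-! ### Simulation of the output and identification with the mechanism -/

namespace Program

section Simulation

variable {A : Auction n}

theorem output_spec {ω : ℕ → Bool} {b : Fin n → ℚ≥0} {s : Memory} (hs : HasInput A ω b s) :
    ∀ i < n, output.sem A s 4 i =
        (if ω n then (if ω (n + 1) then s 7 i else s 6 i) else s 6 i + s 7 i) ∧
      output.sem A s 5 i =
        (if ω n then (if ω (n + 1) then s 7 i else s 6 i) else s 6 i + s 7 i) * s 9 i := by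
  set w : ℕ → ℚ := fun i =>
    if ω n then (if ω (n + 1) then s 7 i else s 6 i) else s 6 i + s 7 i with hw
  have hn := hs.coin n (by omega)
  have hn1 := hs.coin (n + 1) (by omega)
  refine (forAgents_induction (P := fun k s' =>
    (∀ a ∈ ({0, 3, 6, 7, 9} : Finset ℕ), s' a = s a) ∧
      ∀ i < k, s' 4 i = w i ∧ s' 5 i = w i * s 9 i) (by norm_num) (by decide) (by decide) hs.agents
      ?_ ?_).2
  · refine ⟨fun a ha => putAt_ne _ ?_ _ _, by simp⟩
    revert a
    decide
  · rintro k hk s' h0 h10 ⟨h1, h2⟩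
    have e3 : s' 3 = s 3 := h1 3 (by decide)
    have e6 : s' 6 = s 6 := h1 6 (by decide)
    have e7 : s' 7 = s 7 := h1 7 (by decide)
    have e9 : s' 9 = s 9 := h1 9 (by decide)
    have hmode : modeExpr.eval A s' = if ω n then 1 else 0 := by
      simp only [modeExpr, Expr.eval, eval_scalar, h0, Nat.floor_natCast, e3, hn]
    have hsol : solutionExpr.eval A s' = if ω (n + 1) then 1 else 0 := by
      have : ⌊(n : ℚ) + 1⌋₊ = n + 1 := by exact_mod_cast Nat.floor_natCast (R := ℚ) (n + 1)
      simp only [solutionExpr, Expr.eval, eval_scalar, h0, this, e3, hn1]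
    have key1 : (Cmd.cond modeExpr (.cond solutionExpr
        (.assign 4 (scalar 10) (.read 7 (scalar 10))) (.assign 4 (scalar 10) (.read 6 (scalar 10))))
        (.assign 4 (scalar 10) (.add (.read 6 (scalar 10)) (.read 7 (scalar 10))))).sem A s' =
        putAt s' 4 k (w k) := by
      by_cases hm : ω n = true
      · rw [sem_cond_pos (by simp [hmode, hm])]
        by_cases hc : ω (n + 1) = true
        · rw [sem_cond_pos (by simp [hsol, hc])]
          simp [sem_assign, Expr.eval, h10, hw, hm, hc, e7]
        · rw [sem_cond_neg (by simp [hsol, hc])]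
          simp [sem_assign, Expr.eval, h10, hw, hm, hc, e6]
      · rw [sem_cond_neg (by simp [hmode, hm])]
        simp [sem_assign, Expr.eval, h10, hw, hm, e6, e7]
    rw [sem_seq, key1]
    have key2 : (Cmd.assign 5 (scalar 10) (.mul (.read 4 (scalar 10)) (.read 9 (scalar 10)))).sem A
        (putAt s' 4 k (w k)) = putAt (putAt s' 4 k (w k)) 5 k (w k * s 9 k) := by
      simp [sem_assign, Expr.eval, putAt_same, putAt_ne, h10, e9]
    rw [key2]
    constructor
    · intro a ha
      rw [putAt_ne, putAt_ne, putAt_ne, h1 a ha]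
      all_goals
        revert a
        decide
    · have e4 : putAt (putAt (putAt s' 4 k (w k)) 5 k (w k * s 9 k)) 10 0 (k + 1 : ℕ) 4 =
          Function.update (s' 4) k (w k) := by simp [putAt_same, putAt_ne]
      have e5 : putAt (putAt (putAt s' 4 k (w k)) 5 k (w k * s 9 k)) 10 0 (k + 1 : ℕ) 5 =
          Function.update (s' 5) k (w k * s 9 k) := by simp [putAt_same, putAt_ne]
      rw [e4, e5]
      have h4 := update_eq_of_lt_succ (f := s' 4) (P := fun i q => q = w i)
        (fun i hi => (h2 i hi).1) (q := w k) rfl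
      have h5 := update_eq_of_lt_succ (f := s' 5) (P := fun i q => q = w i * s 9 i)
        (fun i hi => (h2 i hi).2) (q := w k * s 9 k) rfl
      exact fun i hi => ⟨h4 i hi, h5 i hi⟩

theorem body_spec {ω : ℕ → Bool} {b : Fin n → ℚ≥0} {s : Memory} (hs : HasInput A ω b s)
    (hI : ∅ ∈ A.indep) (h23 : ∀ i, s 23 i = 0) (h19 : s 19 0 = 0) (i : Fin n) :
    (body.sem A s 4 i ≠ 0 ↔
      i ∈ (sampleMechanism A (sample ω) (ω n) (ω (n + 1))).winners b) ∧
    body.sem A s 5 i = (sampleMechanism A (sample ω) (ω n) (ω (n + 1))).payment b i := by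
  obtain ⟨i1, e1⟩ := estimation_spec hs hI h23 h19
  have hb : body.sem A s = output.sem A ((Cmd.cond modeExpr (posted coinExpr greedyPriceExpr)
      (posted (.const 0) singlePriceExpr)).sem A
        ((store 18 (.div (scalar 19) (.const 6))).sem A (estimation.sem A s))) := rfl
  rw [hb]
  generalize estimation.sem A s = s1 at *
  have h2 : (store 18 (.div (scalar 19) (.const 6))).sem A s1 =
      putAt s1 18 0 ((estimate A (sample ω) b : ℚ) / 6) := by
    simp [sem_store, Expr.eval, e1]
  rw [h2]
  have i2 : HasInput A ω b (putAt s1 18 0 ((estimate A (sample ω) b : ℚ) / 6)) := i1.congr (by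
    intro a ha
    rw [putAt_ne]
    revert a
    decide)
  have e18 : putAt s1 18 0 ((estimate A (sample ω) b : ℚ) / 6) 18 0 =
    (estimate A (sample ω) b : ℚ) / 6 := by simp [putAt_same]
  generalize putAt s1 18 0 ((estimate A (sample ω) b : ℚ) / 6) = s2 at *
  have hmode : modeExpr.eval A s2 = if ω n then 1 else 0 := by
    simp only [modeExpr, Expr.eval, eval_scalar, i2.agents, Nat.floor_natCast, i2.coin n (by omega)]
  have h3 : Represents ((Cmd.cond modeExpr (posted coinExpr greedyPriceExpr)
      (posted (.const 0) singlePriceExpr)).sem A s2) (finalState A (sample ω) (ω n) b) ∧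
      HasInput A ω b ((Cmd.cond modeExpr (posted coinExpr greedyPriceExpr)
      (posted (.const 0) singlePriceExpr)).sem A s2) := by
    by_cases hm : ω n = true
    · rw [sem_cond_pos (by simp [hmode, hm])]
      constructor
      · have := posted_spec (A := A) i2.cost i2.agents hI (d := coinExpr) (U := (sample ω)ᶜ)
          (e := greedyPriceExpr) (price := greedyPrice A (s2 18 0)) (by
            intro s' l _ h3 h10
            simp only [Expr.eval, coinExpr, eval_scalar, h10, Nat.floor_natCast, h3,
              i2.coin l (by omega), sample, Finset.mem_compl, Finset.mem_filter, Finset.mem_univ,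
              true_and]
            cases ω l <;> simp) (greedyPrice_computes i2.budget)
        rw [e18] at this
        rw [finalState, if_pos hm]
        exact this
      · refine i2.congr fun a ha => Cmd.sem_of_notMem_writes A (notMem_writes_posted _ _ ?_) _
        revert a
        decide
    · rw [sem_cond_neg (by simp [hmode, hm])]
      constructor
      · rw [finalState, if_neg hm]
        exact posted_spec (A := A) i2.cost i2.agents hI (d := .const 0) (U := Finset.univ)
          (e := singlePriceExpr) (price := singlePrice A) (by simp [Expr.eval])
          (singlePrice_computes i2.budget)
      · refine i2.congr fun a ha => Cmd.sem_of_notMem_writes A (notMem_writes_posted _ _ ?_) _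
        revert a
        decide
  generalize (Cmd.cond modeExpr (posted coinExpr greedyPriceExpr)
      (posted (.const 0) singlePriceExpr)).sem A s2 = s3 at *
  obtain ⟨r3, i3⟩ := h3
  obtain ⟨o4, o5⟩ := output_spec i3 i i.2
  have hv := finalState_valid hI (sample ω) (ω n) b
  have e6 : s3 6 i = if i ∈ (finalState A (sample ω) (ω n) b).sol false then 1 else 0 :=
    r3.sol false i
  have e7 : s3 7 i = if i ∈ (finalState A (sample ω) (ω n) b).sol true then 1 else 0 :=
    r3.sol true i
  rw [o4, o5, r3.pay i, e6, e7]
  -- In the single-winner mode the output adds the indicators of the two solutions. Disjointness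
  -- keeps the sum at most `1`; a `2` would double the payment.
  have hd := hv.notMem_other false i
  simp only [sampleMechanism, Finset.mem_filter, Finset.mem_univ, true_and, Bool.exists_bool]
  generalize finalState A (sample ω) (ω n) b = st at *
  generalize ω n = g
  generalize ω (n + 1) = c
  by_cases m1 : i ∈ st.sol false <;> by_cases m2 : i ∈ st.sol true <;> cases g <;> cases c <;>
    simp_all

end Simulation

/-- The program with one coin toss for every agent and two further ones. -/
noncomputable def program : RandomizedProgram := ⟨body, Polynomial.X + 2⟩

theorem coins_eval (n : ℕ) : program.coins.eval n = n + 2 := by simp [program]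

/-- The coin tosses as a sequence. -/
noncomputable def toss (ω : program.Coins n) (k : ℕ) : Bool :=
  if h : k < program.coins.eval n then ω ⟨k, h⟩ else false

theorem mechanism_eq {A : Auction n} (hI : ∅ ∈ A.indep) (ω : program.Coins n) :
    program.mechanism A ω =
      sampleMechanism A (sample (toss ω)) (toss ω n) (toss ω (n + 1)) := by
  -- The arrays `19` and `23` are not initialized by the program; the required zeros come from the
  -- default contents of the input memory.
  have key := fun b i => body_spec (A := A) (ω := toss ω) (b := b) (s := program.input A ω b)
    ⟨rfl, rfl, fun i => by simp [RandomizedProgram.input], fun i hi => by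
      have hi' : i < program.coins.eval n := by rwa [coins_eval]
      simp [RandomizedProgram.input, toss, hi']⟩ hI (fun _ => rfl) rfl i
  have hr : ∀ b, (program.run A ω b).1 = body.sem A (program.input A ω b) := fun b =>
    Cmd.exec_fst A body _
  unfold RandomizedProgram.mechanism
  refine congr_arg₂ Mechanism.mk (funext fun b => Finset.ext fun i => ?_)
    (funext fun b => funext fun i => ?_)
  · rw [hr]
    refine Iff.trans ?_ (key b i).1
    simp [storedSet]
  · rw [hr]
    exact (key b i).2

end Program


namespace Program

/-! ### The running time -/

/-- Bounds on the numbers of bits of the cells of the arrays, relative to the size of the input. -/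
def width : ℕ → ℕ
  | 3 | 6 | 7 | 11 | 13 | 16 | 20 | 23 => 2
  | 14 | 24 => 6
  | 4 | 8 => 10
  | 18 => 20
  | 9 | 17 => 634
  | 5 => 1290
  | _ => 1

/-- The arrays that contain counters. -/
def counters : Finset ℕ := {10, 21, 22}

/-- The invariant of the memory in the analysis of the running time. -/
structure Bounded (n N : ℕ) (s : Memory) : Prop where
  agents : s 0 0 = n
  bits : ∀ a i, bitSize (s a i) ≤ width a * N
  counter : ∀ a ∈ counters, ∀ i, ∃ k : ℕ, k ≤ n ∧ s a i = k

section Safe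

variable {A : Auction n} {N : ℕ}

theorem Bounded.update {s : Memory} (hs : Bounded n N s) {a : ℕ} (ha : a ≠ 0) (k : ℕ) {q : ℚ}
    (hq : bitSize q ≤ width a * N) (hc : a ∈ counters → ∃ k : ℕ, k ≤ n ∧ q = k) :
    Bounded n N (Function.update s a (Function.update (s a) k q)) := by
  refine ⟨by rw [Function.update_of_ne ha.symm, hs.agents], fun a' i => ?_, fun a' ha' i => ?_⟩
  · rcases eq_or_ne a' a with rfl | h
    · rw [Function.update_self]
      rcases eq_or_ne i k with rfl | hi
      · rwa [Function.update_self]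
      · rw [Function.update_of_ne hi]
        exact hs.bits _ _
    · rw [Function.update_of_ne h]
      exact hs.bits _ _
  · rcases eq_or_ne a' a with rfl | h
    · rw [Function.update_self]
      rcases eq_or_ne i k with rfl | hi
      · rw [Function.update_self]
        exact hc ha'
      · rw [Function.update_of_ne hi]
        exact hs.counter _ ha' _
    · rw [Function.update_of_ne h]
      exact hs.counter _ ha' _

theorem safe_assign (hN : 1 ≤ N) (hv : ∀ S, bitSize (A.value S) ≤ N) {a : ℕ} {e f : Expr}
    (ha : a ∉ insert 0 counters) (hf : f.bits width ≤ width a) :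
    (Cmd.assign a e f).Safe A (Bounded n N) N := by
  intro s hs
  simp only [Finset.mem_insert, not_or] at ha
  exact hs.update ha.1 _ ((Expr.bitSize_eval_le hN hv hs.bits f).trans
    (Nat.mul_le_mul_right N hf)) fun h => absurd h ha.2

/-- A natural number up to `n` has at most `n + 1` bits, which is why `N` must exceed `n` strictly.
-/
theorem safe_store_counter (hn : n < N) {a : ℕ} (ha : a ∈ counters) {f : Expr}
    (hf : ∀ s, Bounded n N s → ∃ k : ℕ, k ≤ n ∧ f.eval A s = k) :
    (store a f).Safe A (Bounded n N) N := by
  intro s hs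
  obtain ⟨k, hk, hq⟩ := hf s hs
  refine hs.update (by revert a; decide) _ ?_ fun _ => ⟨k, hk, hq⟩
  have hw : width a = 1 := by
    revert a
    decide
  have := bitSize_natCast_le k
  rw [hq, hw]
  omega

theorem safe_loop (hn : n < N) {c : Cmd} (hc : c.Safe A (Bounded n N) N) :
    (Cmd.loop (scalar 0) c).Safe A (Bounded n N) N := by
  refine ⟨fun s hs => ?_, hc⟩
  rw [eval_scalar, hs.agents, Nat.floor_natCast]
  exact hn.le

theorem safe_forAgents (hn : n < N) {a : ℕ} (ha : a ∈ counters) {c : Cmd}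
    (hc : c.Safe A (Bounded n N) N) : (forAgents a c).Safe A (Bounded n N) N := by
  refine ⟨safe_store_counter hn ha fun s _ => ⟨0, by simp [Expr.eval]⟩, safe_loop hn
    ⟨hc, safe_store_counter hn ha fun s hs => ?_⟩⟩
  obtain ⟨k, hk, hq⟩ := hs.counter a ha 0
  simp only [Expr.eval, eval_scalar, hs.agents, hq]
  -- The invariant allows a counter to equal `n` already, where `increment` wraps around to `0`.
  -- This makes the bound on counters checkable without following the loop.
  by_cases h : k + 1 ≤ n
  · refine ⟨k + 1, h, ?_⟩
    have : (k : ℚ) + 1 ≤ n := by exact_mod_cast h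
    simp [this]
  · have : ¬ ((k : ℚ) + 1 ≤ n) := by exact_mod_cast h
    exact ⟨0, by simp [this]⟩

theorem safe_posted (hN : 1 ≤ N) (hn : n < N) (hv : ∀ S, bitSize (A.value S) ≤ N) {d : Expr}
    (hd : d.bits width ≤ 10) {e : Bool → Expr} (he : ∀ j, (e j).bits width ≤ 634) :
    (posted d e).Safe A (Bounded n N) N := by
  have hs : ∀ {a : ℕ} {e f : Expr}, a ∉ insert 0 counters → f.bits width ≤ width a →
    (Cmd.assign a e f).Safe A (Bounded n N) N := fun ha hf => safe_assign hN hv ha hf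
  have hc : ∀ j, (compare j).Safe A (Bounded n N) N := by
    intro j
    cases j <;>
    refine ⟨trivial, ⟨hs (by decide) ?_, hs (by decide) ?_, hs (by decide) ?_, hs (by decide) ?_,
      hs (by decide) ?_⟩, ⟨trivial, hs (by decide) ?_, hs (by decide) ?_, hs (by decide) ?_,
      hs (by decide) ?_⟩, trivial⟩ <;>
    simp [Expr.bits, bitSize_zero, bitSize_one, width, solArray, scalar]
  have ho : ∀ j, (offer e j).Safe A (Bounded n N) N := by
    intro j
    refine ⟨hs (by decide) (he j), hs (by decide) ?_, ⟨hs ?_ ?_, hs (by decide) ?_,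
      hs (by decide) ?_⟩, trivial⟩
    on_goal 2 => cases j <;> decide
    all_goals cases j <;> simp [Expr.bits, bitSize_one, width, solArray, scalar]
  refine ⟨hs (by decide) ?_, safe_forAgents hn (by decide) ⟨hs (by decide) hd, hs (by decide) ?_,
    hs (by decide) ?_, hs (by decide) ?_⟩, safe_loop hn ⟨hs (by decide) ?_,
    safe_forAgents hn (by decide) (hc false), safe_forAgents hn (by decide) (hc true),
    ⟨ho true, ho false⟩, trivial⟩⟩
  all_goals simp [Expr.bits, bitSize_zero, width]

theorem safe_body (hN : 1 ≤ N) (hn : n < N) (hv : ∀ S, bitSize (A.value S) ≤ N) :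
    body.Safe A (Bounded n N) N := by
  have hs : ∀ {a : ℕ} {e f : Expr}, a ∉ insert 0 counters → f.bits width ≤ width a →
    (Cmd.assign a e f).Safe A (Bounded n N) N := fun ha hf => safe_assign hN hv ha hf
  -- Every arithmetic operation maps widths `x` and `y` to `2 * (x + y) + 2`. From the widths `1`,
  -- `6`, `20` of budget, marginal value and target, the price gets successively `16`, `74`, `154`,
  -- `314` and `634`.
  have hg : ∀ j, (greedyPriceExpr j).bits width ≤ 634 := by
    intro j
    simp [greedyPriceExpr, Expr.bits, bitSize_one, width, scalar]
  have h1 : ∀ j, (singlePriceExpr j).bits width ≤ 634 := by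
    intro j
    simp [singlePriceExpr, Expr.bits, bitSize_one, width, scalar]
  have h6 : bitSize 6 ≤ 7 := bitSize_natCast_le 6
  refine ⟨safe_forAgents hn (by decide) ⟨hs (by decide) ?_, safe_forAgents hn (by decide)
    ⟨hs (by decide) ?_, safe_posted hN hn hv ?_ hg, ⟨trivial, hs (by decide) ?_⟩,
      ⟨trivial, hs (by decide) ?_⟩⟩, hs (by decide) ?_⟩, hs (by decide) ?_,
    ⟨safe_posted hN hn hv ?_ hg, safe_posted hN hn hv ?_ h1⟩,
    safe_forAgents hn (by decide) ⟨⟨⟨hs (by decide) ?_, hs (by decide) ?_⟩, hs (by decide) ?_⟩,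
      hs (by decide) ?_⟩⟩
  all_goals simp [Expr.bits, bitSize_zero, bitSize_one, width, scalar, coinExpr]
  omega

theorem bounded_input (ω : program.Coins n) (b : Fin n → ℚ≥0) :
    Bounded n (inputSize A b + 1) (program.input A ω b) := by
  have hb : ∀ i, bitSize (b i) ≤ ∑ i, bitSize (b i) := fun i =>
    Finset.single_le_sum (f := fun i => bitSize (b i)) (fun _ _ => Nat.zero_le _)
      (Finset.mem_univ i)
  have hw : ∀ a, 1 ≤ width a := by
    intro a
    unfold width
    split <;> norm_num
  have h0 : ∀ a, bitSize 0 ≤ width a * (inputSize A b + 1) := by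
    intro a
    rw [bitSize_zero]
    exact Nat.mul_pos (hw a) (Nat.succ_pos _)
  refine ⟨rfl, fun a i => ?_, fun a ha i => ⟨0, Nat.zero_le _, ?_⟩⟩
  · unfold RandomizedProgram.input
    split
    · have := bitSize_natCast_le n
      simp only [width, inputSize]
      omega
    · simp only [width, inputSize]
      omega
    · split_ifs with h
      · have := hb ⟨_, h⟩
        simp only [width, inputSize]
        omega
      · exact h0 _
    · split_ifs
      · rw [bitSize_one]
        simp only [width]
        omega
      · exact h0 _
      · exact h0 _
    · exact h0 _
  · simp only [counters, Finset.mem_insert, Finset.mem_singleton] at ha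
    rcases ha with rfl | rfl | rfl <;> rfl

end Safe

/-- The static bound needs no property of the auction. The composition with `X + 1` accounts for the
scale `inputSize A b + 1`. -/
theorem polynomialTime (K : ∀ n : ℕ, Auction n → Prop) : program.PolynomialTime K := by
  refine ⟨(body.cost width).comp (Polynomial.X + 1), fun n A _ ω b => ?_⟩
  have hv : ∀ S, bitSize (A.value S) ≤ inputSize A b + 1 := by
    intro S
    have := Finset.le_sup (f := fun S => bitSize (A.value S)) (Finset.mem_univ S)
    simp only [inputSize] at this ⊢
    omega
  have hn : n < inputSize A b + 1 := by
    simp only [inputSize]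
    omega
  have h := (Cmd.exec_le (A := A) (K := width) (N := inputSize A b + 1) (by omega) hn.le hv
    (Inv := Bounded n (inputSize A b + 1)) (fun s hs => hs.bits) body
    (safe_body (by omega) hn hv) _ 0 (bounded_input ω b)).2
  simpa [RandomizedProgram.time, RandomizedProgram.run, Polynomial.eval_comp, program] using h

end Program


/-! ### Submodular functions -/

section Submodular

variable {v : Finset (Fin n) → ℚ≥0}

theorem IsSubmodular.insert_sub_le (hv : IsSubmodular v) {S T : Finset (Fin n)} (h : S ⊆ T)
    {i : Fin n} (hi : i ∈ S ∨ i ∉ T) :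
    (v (insert i T) : ℚ) - v T ≤ v (insert i S) - v S := by
  rcases hi with hi | hi
  · rw [Finset.insert_eq_of_mem hi, Finset.insert_eq_of_mem (h hi), sub_self, sub_self]
  · exact hv S T h i hi

theorem IsSubmodular.union_sub_le (hv : IsSubmodular v) {S T : Finset (Fin n)} (h : S ⊆ T)
    (D : Finset (Fin n)) (hD : Disjoint T D) :
    (v (T ∪ D) : ℚ) - v T ≤ v (S ∪ D) - v S := by
  induction D using Finset.induction_on with
  | empty => simp
  | insert a D ha ih =>
    rw [Finset.disjoint_insert_right] at hD
    have h1 := ih hD.2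
    have h2 := hv.insert_sub_le (Finset.union_subset_union h (Finset.Subset.refl D)) (i := a)
      (Or.inr (by simp [hD.1, ha]))
    rw [Finset.union_insert, Finset.union_insert]
    linarith

theorem IsSubmodular.union_add_inter_le (hv : IsSubmodular v) (X Y : Finset (Fin n)) :
    (v (X ∪ Y) : ℚ) + v (X ∩ Y) ≤ v X + v Y := by
  have h := hv.union_sub_le (Finset.inter_subset_left (s₁ := X) (s₂ := Y)) (Y \ X)
    Finset.disjoint_sdiff
  have h1 : X ∪ Y \ X = X ∪ Y := by simp
  have h2 : X ∩ Y ∪ Y \ X = Y := by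
    ext i
    simp only [Finset.mem_union, Finset.mem_inter, Finset.mem_sdiff]
    tauto
  rw [h1, h2] at h
  linarith

/-- For disjoint `S` and `T` the sets `O ∪ S` and `O ∪ T` intersect in `O`, and the value of their
union is nonnegative. This replaces monotonicity and is the reason for keeping two solutions. -/
theorem IsSubmodular.value_le_union_add_union (hv : IsSubmodular v) {O S T : Finset (Fin n)}
    (h : Disjoint S T) : (v O : ℚ) ≤ v (O ∪ S) + v (O ∪ T) := by
  have h1 := hv.union_add_inter_le (O ∪ S) (O ∪ T)
  rw [← Finset.union_inter_distrib_left, Finset.disjoint_iff_inter_eq_empty.1 h,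
    Finset.union_empty] at h1
  have h2 : (0 : ℚ) ≤ v (O ∪ S ∪ (O ∪ T)) := by positivity
  linarith

theorem IsSubmodular.union_le (hv : IsSubmodular v) (S O : Finset (Fin n)) :
    (v (O ∪ S) : ℚ) ≤ v S + ∑ o ∈ O, ((v (insert o S) : ℚ) - v S) := by
  induction O using Finset.induction_on with
  | empty => simp
  | insert a O ha ih =>
    have h1 := hv.insert_sub_le (Finset.subset_union_right (s₁ := O) (s₂ := S)) (i := a)
      (by
        by_cases h : a ∈ S
        · exact Or.inl h
        · exact Or.inr (by simp [h, ha]))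
    rw [Finset.insert_union, Finset.sum_insert ha]
    linarith

/-- Additive lower bounds on the values of the subsets of `O`. -/
theorem IsSubmodular.exists_weights (hv : IsSubmodular v) (h0 : v ∅ = 0) (O : Finset (Fin n)) :
    ∃ w : Fin n → ℚ, ∑ i ∈ O, w i = v O ∧ ∀ T ⊆ O, ∑ i ∈ T, w i ≤ v T := by
  induction O using Finset.induction_on with
  | empty =>
    refine ⟨0, by simp [h0], fun T hT => ?_⟩
    rw [Finset.subset_empty.1 hT]
    simp
  | insert a O ha ih =>
    obtain ⟨w, h1, h2⟩ := ih
    have hw : ∀ T : Finset (Fin n), a ∉ T →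
        ∑ i ∈ T, Function.update w a ((v (insert a O) : ℚ) - v O) i = ∑ i ∈ T, w i := by
      intro T hT
      refine Finset.sum_congr rfl fun i hi => Function.update_of_ne ?_ _ _
      rintro rfl
      exact hT hi
    -- The weights are marginal values along an insertion order. Relative to a subset of `O` the
    -- marginal value of `a` is at least as large, so no subset gets more weight than value.
    refine ⟨Function.update w a ((v (insert a O) : ℚ) - v O), ?_, fun T hT => ?_⟩
    · rw [Finset.sum_insert ha, hw O ha, h1, Function.update_self]
      ring
    · by_cases haT : a ∈ T
      · have hT' : T.erase a ⊆ O := by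
          intro i hi
          rw [Finset.mem_erase] at hi
          exact (Finset.mem_insert.1 (hT hi.2)).resolve_left hi.1
        have h3 := hv.insert_sub_le hT' (Or.inr ha)
        have h4 := h2 _ hT'
        rw [← Finset.insert_erase haT, Finset.sum_insert (Finset.notMem_erase a T),
          hw _ (Finset.notMem_erase a T), Function.update_self]
        linarith
      · have hT' : T ⊆ O := fun i hi => (Finset.mem_insert.1 (hT hi)).resolve_left (by
          rintro rfl
          exact haT hi)
        rw [hw T haT]
        exact h2 T hT'

end Submodular

/-! ### `p`-systems -/

section PSystem

variable {I : Finset (Finset (Fin n))}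

theorem bddAbove_card_bases (S : Finset (Fin n)) : BddAbove (Finset.card '' bases I S) := by
  refine ⟨n, ?_⟩
  rintro _ ⟨T, -, rfl⟩
  simpa using Finset.card_le_univ T

theorem card_le_upperRank {S T : Finset (Fin n)} (hT : T ∈ I) (hTS : T ⊆ S) :
    T.card ≤ upperRank I S := by
  obtain ⟨T', h1, h2⟩ := (Set.toFinite {X : Finset (Fin n) | X ∈ I ∧ X ⊆ S}).exists_le_maximal
    (show T ∈ {X : Finset (Fin n) | X ∈ I ∧ X ⊆ S} from ⟨hT, hTS⟩)
  exact (Finset.card_le_card h1).trans (le_csSup (bddAbove_card_bases S) ⟨T', h2, rfl⟩)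

theorem lowerRank_le_card {S T : Finset (Fin n)} (hT : T ∈ bases I S) :
    lowerRank I S ≤ T.card :=
  Nat.sInf_le ⟨T, hT, rfl⟩

/-- Since `S` cannot be extended by elements of `C`, it is a basis of `S ∪ C`, while `C` is an
independent subset of the same set. -/
theorem IsPSystem.card_le {p : ℝ} (h : IsPSystem I p) (hp : 0 ≤ p) {S C : Finset (Fin n)}
    (hS : S ∈ I) (hC : C ∈ I) (hSC : ∀ o ∈ C, insert o S ∉ I) :
    (C.card : ℝ) ≤ p * S.card := by
  have hb : S ∈ bases I (S ∪ C) := by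
    refine ⟨⟨hS, Finset.subset_union_left⟩, fun Y hY hSY y hy => ?_⟩
    by_contra hyS
    have hyC : y ∈ C := (Finset.mem_union.1 (hY.2 hy)).resolve_left hyS
    exact hSC y hyC (h.1.2 _ _ (Finset.insert_subset hy hSY) hY.1)
  have h1 := card_le_upperRank hC (Finset.subset_union_right (s₁ := S))
  have h2 := lowerRank_le_card hb
  calc (C.card : ℝ) ≤ upperRank I (S ∪ C) := by exact_mod_cast h1
    _ ≤ p * lowerRank I (S ∪ C) := h.2 _
    _ ≤ p * S.card := mul_le_mul_of_nonneg_left (by exact_mod_cast h2) hp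

/-- An independent set is its own only basis, so its two ranks agree and are positive. -/
theorem IsPSystem.one_le {p : ℝ} (h : IsPSystem I p) {T : Finset (Fin n)} (hT : T ∈ I)
    (hne : T.Nonempty) : 1 ≤ p := by
  have hb : T ∈ bases I T := ⟨⟨hT, subset_rfl⟩, fun Y hY _ => hY.2⟩
  have h1 := card_le_upperRank hT subset_rfl
  have hl : lowerRank I T = T.card := by
    refine le_antisymm (lowerRank_le_card hb) (le_csInf ⟨_, T, hb, rfl⟩ ?_)
    rintro _ ⟨T', hT', rfl⟩
    rw [subset_antisymm hT'.1.2 (hT'.2 ⟨hT, subset_rfl⟩ hT'.1.2)]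
  have h2 := h.2 T
  rw [hl] at h2
  have h3 : (T.card : ℝ) ≤ upperRank I T := by exact_mod_cast h1
  have h4 : (0 : ℝ) < T.card := by exact_mod_cast hne.card_pos
  nlinarith

end PSystem

/-! ### The value of the solutions of the greedy mechanism -/

namespace State

/-- The marginal value of an agent in `O` that cannot join solution `j` any more. -/
def lost (A : Auction n) (st : State n) (j : Bool) (o : Fin n) : ℚ :=
  if st.Candidate A (o, j) then 0 else st.marginal A (o, j)

/-- The cost of an agent that has received an offer. -/
def spent (b : Fin n → ℚ≥0) (st : State n) (o : Fin n) : ℚ :=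
  if o ∈ st.alive then 0 else b o

/-- Indicator of the agents that are blocked by the independence system. -/
def blocked (A : Auction n) (st : State n) (j : Bool) (o : Fin n) : ℚ :=
  if insert o (st.sol j) ∈ A.indep then 0 else 1

/-- The number `δ` bounds the marginal values of all candidates, and the marginal values of the agents
in `O` that are not candidates any more are charged to the solutions and to the costs. -/
structure ChargedWith (A : Auction n) (O : Finset (Fin n)) (p τ : ℚ) (b : Fin n → ℚ≥0)
    (st : State n) (δ : ℚ) : Prop where
  nonneg : 0 ≤ δ
  marginal_le : ∀ x, st.Candidate A x → st.marginal A x ≤ δ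
  charge : ∀ j, ∑ o ∈ O, st.lost A j o + (p * (st.sol j).card - ∑ o ∈ O, st.blocked A j o) * δ ≤
    p * A.value (st.sol j) + A.value (st.sol !j) + τ / A.budget * ∑ o ∈ O, spent b st o

variable {A : Auction n} {O : Finset (Fin n)} {p τ M : ℚ} {b : Fin n → ℚ≥0} {st : State n}

theorem ChargedWith.start (hA : A.IsSubmodularAuction) (hO : O ∈ A.indep) {U : Finset (Fin n)}
    (hOU : O ⊆ U) : ∃ δ, (start U).ChargedWith A O p τ b δ := by
  obtain ⟨-, hI, h0, -⟩ := hA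
  have hc : ∀ o ∈ O, ({o} : Finset (Fin n)) ∈ A.indep := fun o ho =>
    hI.2 _ _ (Finset.singleton_subset_iff.2 ho) hO
  refine ⟨∑ i, (A.value {i} : ℚ), by positivity, ?_, fun j => ?_⟩
  · rintro ⟨i, j⟩ -
    have := Finset.single_le_sum (f := fun i => (A.value {i} : ℚ)) (fun _ _ => by positivity)
      (Finset.mem_univ i)
    simpa [State.start, marginal, h0] using this
  · have h1 : ∑ o ∈ O, (State.start U).lost A j o = 0 := Finset.sum_eq_zero fun o ho => by
      simp [lost, Candidate, State.start, hOU ho, hc o ho]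
    have h2 : ∑ o ∈ O, (State.start U).blocked A j o = 0 := Finset.sum_eq_zero fun o ho => by
      simp [blocked, State.start, hc o ho]
    have h3 : ∑ o ∈ O, spent b (State.start U) o = 0 := Finset.sum_eq_zero fun o ho => by
      simp [spent, State.start, hOU ho]
    rw [h1, h2, h3]
    simp [State.start, h0]

theorem sum_spent_le (hO : ∑ i ∈ O, b i ≤ A.budget) (st : State n) :
    ∑ o ∈ O, spent b st o ≤ A.budget := by
  calc ∑ o ∈ O, spent b st o ≤ ∑ o ∈ O, (b o : ℚ) := by
        refine Finset.sum_le_sum fun o _ => ?_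
        unfold spent
        split_ifs
        · positivity
        · exact le_rfl
    _ ≤ A.budget := by exact_mod_cast hO

/-- The picked pair has the largest marginal value. If the agent was still a candidate for a
solution, its loss there is therefore also at most `τ / B` times its cost, and one refusal is
charged to the cost term of both solutions. Agents outside `O` cause no loss. -/
theorem ChargedWith.reject (hB : 0 < A.budget) (hτ : 0 ≤ τ) {δ : ℚ}
    (h : st.ChargedWith A O p τ b δ) {x : Fin n × Bool} (hx : st.pick A = some x)
    (hr : x.1 ∈ O → st.marginal A x ≤ τ / A.budget * b x.1) :
    (⟨st.sol, st.alive.erase x.1, st.pay⟩ : State n).ChargedWith A O p τ b δ := by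
  set st' : State n := ⟨st.sol, st.alive.erase x.1, st.pay⟩ with hst
  have hB' : (0 : ℚ) < A.budget := by exact_mod_cast hB
  have hm : ∀ y, st'.marginal A y = st.marginal A y := fun _ => rfl
  have hc : ∀ y, st'.Candidate A y → st.Candidate A y := fun y hy =>
    ⟨Finset.mem_of_mem_erase hy.1, hy.2⟩
  refine ⟨h.nonneg, fun y hy => h.marginal_le y (hc y hy), fun j => ?_⟩
  have hsum : ∑ o ∈ O, st'.lost A j o ≤ ∑ o ∈ O, st.lost A j o +
      τ / A.budget * (∑ o ∈ O, spent b st' o - ∑ o ∈ O, spent b st o) := by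
    rw [← Finset.sum_sub_distrib, Finset.mul_sum, ← Finset.sum_add_distrib]
    refine Finset.sum_le_sum fun o ho => ?_
    rcases eq_or_ne o x.1 with rfl | hox
    · have ha : x.1 ∈ st.alive := (pick_candidate hx).1
      have h1 : spent b st' x.1 = b x.1 := by simp [spent, hst]
      have h2 : spent b st x.1 = 0 := by simp [spent, ha]
      have h3 : ¬ st'.Candidate A (x.1, j) := fun h => by
        have := h.1
        simp [hst] at this
      rw [h1, h2, sub_zero]
      unfold lost
      rw [if_neg h3, hm]
      split_ifs with h4
      · have := marginal_le_of_pick hx h4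
        linarith [hr ho]
      · have : 0 ≤ τ / A.budget * (b x.1 : ℚ) := by positivity
        linarith
    · have h1 : st'.Candidate A (o, j) ↔ st.Candidate A (o, j) := by
        simp [Candidate, hst, hox]
      have h2 : st'.lost A j o = st.lost A j o := by
        unfold lost
        simp only [h1, hm]
      have h3 : spent b st' o = spent b st o := by simp [spent, hst, hox]
      rw [h2, h3, sub_self, mul_zero, add_zero]
  have h1 := h.charge j
  have h2 : ∑ o ∈ O, st'.blocked A j o = ∑ o ∈ O, st.blocked A j o := rfl
  have h3 : st'.sol = st.sol := rfl
  rw [h2, h3]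
  linarith

/-- The quantity `p * |S| - blocked` is an account of unused blocking rights, each worth `δ`. It is
nonnegative by `hO`, so lowering `δ` to the accepted marginal value `m` only decreases the left
side. Acceptance adds `p` rights worth `m`, matched by `p * m` on the right, and newly blocked
agents consume rights worth at least their losses. For the other solution the accepted agent itself
is lost, at most `m`, which is the gain of the solution that it joined. -/
theorem ChargedWith.accept (hA : A.IsSubmodularAuction) (hτ : 0 ≤ τ)
    (hO : ∀ S ∈ A.indep, ∑ o ∈ O, (if insert o S ∈ A.indep then (0 : ℚ) else 1) ≤ p * S.card)
    (hv : st.Valid A) {δ : ℚ} (h : st.ChargedWith A O p τ b δ) {x : Fin n × Bool}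
    (hx : st.pick A = some x) (hm0 : 0 ≤ st.marginal A x) (q : ℚ) :
    (⟨Function.update st.sol x.2 (insert x.1 (st.sol x.2)), st.alive.erase x.1,
      Function.update st.pay x.1 q⟩ : State n).ChargedWith A O p τ b (st.marginal A x) := by
  obtain ⟨hB, hI, -, hsub⟩ := hA
  obtain ⟨i, k⟩ := x
  set m := st.marginal A (i, k) with hm
  obtain ⟨ha, hk⟩ := pick_candidate hx
  simp only at ha hk
  set st' : State n := ⟨Function.update st.sol k (insert i (st.sol k)), st.alive.erase i,
      Function.update st.pay i q⟩ with hst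
  have hB' : (0 : ℚ) < A.budget := by exact_mod_cast hB
  have hik : i ∉ st.sol k := fun h' => hv.notMem_alive _ _ h' ha
  have hsol : ∀ j, st.sol j ⊆ st'.sol j := by
    intro j
    rcases eq_or_ne j k with rfl | hj
    · simp [hst]
    · simp [hst, hj]
  have hmono : ∀ (o : Fin n) j, insert o (st'.sol j) ∈ A.indep → insert o (st.sol j) ∈ A.indep :=
    fun o j ho => hI.2 _ _ (Finset.insert_subset_insert o (hsol j)) ho
  have hmarg : ∀ o j, o ≠ i → st'.marginal A (o, j) ≤ st.marginal A (o, j) := by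
    intro o j ho
    refine hsub.insert_sub_le (hsol j) ?_
    by_cases h' : o ∈ st.sol j
    · exact Or.inl h'
    · right
      rcases eq_or_ne j k with rfl | hj
      · simpa [hst, ho] using h'
      · simpa [hst, hj] using h'
  have hspent : ∑ o ∈ O, spent b st o ≤ ∑ o ∈ O, spent b st' o := by
    refine Finset.sum_le_sum fun o _ => ?_
    unfold spent
    by_cases h1 : o ∈ st.alive
    · rw [if_pos h1]
      split_ifs <;> positivity
    · rw [if_neg h1, if_neg (fun h => h1 (Finset.mem_of_mem_erase h))]
  have hspent' : τ / A.budget * ∑ o ∈ O, spent b st o ≤ τ / A.budget * ∑ o ∈ O, spent b st' o :=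
    mul_le_mul_of_nonneg_left hspent (by positivity)
  have hmδ : m ≤ δ := h.marginal_le _ ⟨ha, hk⟩
  refine ⟨hm0, ?_, fun j => ?_⟩
  · rintro ⟨o, j⟩ ⟨h1, h2⟩
    have hoi : o ≠ i := Finset.ne_of_mem_erase h1
    exact (hmarg o j hoi).trans
      (marginal_le_of_pick hx ⟨Finset.mem_of_mem_erase h1, hmono o j h2⟩)
  · have hfree : 0 ≤ p * (st.sol j).card - ∑ o ∈ O, st.blocked A j o :=
      sub_nonneg.2 (hO _ (hv.indep j))
    have hold := h.charge j
    have hδ := mul_le_mul_of_nonneg_left hmδ hfree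
    rcases eq_or_ne j k with rfl | hj
    · have hsum : ∑ o ∈ O, st'.lost A j o ≤ ∑ o ∈ O, st.lost A j o +
          (∑ o ∈ O, st'.blocked A j o - ∑ o ∈ O, st.blocked A j o) * m := by
        rw [← Finset.sum_sub_distrib, Finset.sum_mul, ← Finset.sum_add_distrib]
        refine Finset.sum_le_sum fun o _ => ?_
        -- The accepted agent has marginal value zero for the solution that now contains it. Any
        -- other newly lost agent was a candidate before and is newly blocked, so its loss is at
        -- most `m`; losses that were already counted do not grow, by submodularity.
        rcases eq_or_ne o i with rfl | hoi
        · have h1 : st'.lost A j o = 0 := by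
            unfold lost
            split_ifs
            · rfl
            · simp [marginal, hst]
          have h2 : st.lost A j o = 0 := if_pos ⟨ha, hk⟩
          have h3 : st'.blocked A j o = 0 := by simp [blocked, hst, hk]
          have h4 : st.blocked A j o = 0 := if_pos hk
          rw [h1, h2, h3, h4]
          simp
        · have hal : o ∈ st'.alive ↔ o ∈ st.alive := by simp [hst, hoi]
          have hmo := hmarg o j hoi
          unfold lost blocked Candidate
          simp only [hal]
          by_cases h1 : insert o (st'.sol j) ∈ A.indep
          · have h2 := hmono o j h1
            by_cases h3 : o ∈ st.alive
            · simp [h1, h2, h3]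
            · simpa [h1, h2, h3] using hmo
          · by_cases h2 : insert o (st.sol j) ∈ A.indep
            · by_cases h3 : o ∈ st.alive
              · have := marginal_le_of_pick hx (y := (o, j)) ⟨h3, h2⟩
                simp only [h1, h2, h3, and_false, and_true, if_true, if_false]
                linarith
              · simp only [h1, h2, h3, and_false, and_true, if_true, if_false]
                linarith
            · simpa [h1, h2] using hmo
      have h1 : ((st'.sol j).card : ℚ) = (st.sol j).card + 1 := by
        simp only [hst, Function.update_self]
        rw [Finset.card_insert_of_notMem hik]
        push_cast
        ring
      have h2 : (A.value (st'.sol j) : ℚ) = A.value (st.sol j) + m := by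
        simp [hst, hm, marginal]
      have h3 : st'.sol (!j) = st.sol (!j) := by simp [hst]
      rw [h1, h2, h3]
      linarith
    · have hk' : (!j) = k := by cases j <;> cases k <;> simp_all
      have hjs : st'.sol j = st.sol j := by simp [hst, hj]
      have hsum : ∑ o ∈ O, st'.lost A j o ≤ ∑ o ∈ O, st.lost A j o + m := by
        have h1 : ∑ o ∈ O, (if o = i then m else 0) ≤ m := by
          rw [Finset.sum_ite_eq']
          split_ifs
          · exact le_rfl
          · exact hm0
        refine le_trans ?_ (add_le_add_right h1 _)
        rw [← Finset.sum_add_distrib]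
        refine Finset.sum_le_sum fun o _ => ?_
        have h2 : st'.marginal A (o, j) = st.marginal A (o, j) := by simp [marginal, hjs]
        rcases eq_or_ne o i with rfl | hoi
        · have h3 : ¬ st'.Candidate A (o, j) := fun h => by
            have := h.1
            simp [hst] at this
          unfold lost
          rw [if_neg h3, h2, if_pos rfl]
          split_ifs with h4
          · have := marginal_le_of_pick hx h4
            linarith
          · linarith
        · have h3 : st'.Candidate A (o, j) ↔ st.Candidate A (o, j) := by
            simp [Candidate, hst, hoi, hj]
          unfold lost
          rw [if_neg hoi]
          simp only [h2, h3, add_zero, le_refl]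
      have h1 : (A.value (st'.sol (!j)) : ℚ) = A.value (st.sol (!j)) + m := by
        simp [hst, hm, marginal, hk']
      have h2 : ∑ o ∈ O, st'.blocked A j o = ∑ o ∈ O, st.blocked A j o := by
        simp [blocked, hjs]
      rw [h1, h2, hjs]
      linarith

/-- The greedy mechanism with target value `τ` for a feasible set `O` of available agents: either
the target is almost reached, or the two solutions are good in comparison with `O`. -/
theorem run_greedy_value (hA : A.IsSubmodularAuction) (hτ : 0 ≤ τ) (hM0 : 0 ≤ M)
    (hO : ∀ S ∈ A.indep, ∑ o ∈ O, (if insert o S ∈ A.indep then (0 : ℚ) else 1) ≤ p * S.card)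
    (hOI : O ∈ A.indep) (hOb : ∑ i ∈ O, b i ≤ A.budget) (hM : ∀ o ∈ O, (A.value {o} : ℚ) ≤ M)
    {U : Finset (Fin n)} (hOU : O ⊆ U) :
    (∃ j, τ - M ≤ A.value (((start U).run A (greedyPrice A τ) b).sol j)) ∨
      (A.value O : ℚ) ≤ (p + 2) * (A.value (((start U).run A (greedyPrice A τ) b).sol false) +
        A.value (((start U).run A (greedyPrice A τ) b).sol true)) + 2 * τ := by
  have hA' := hA
  obtain ⟨hB, hI, h0, hsub⟩ := hA'
  have hB' : (0 : ℚ) < A.budget := by exact_mod_cast hB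
  -- For `τ = 0` the first alternative is trivial; below, `τ` is a divisor.
  rcases hτ.eq_or_lt with rfl | hτ'
  · left
    refine ⟨false, ?_⟩
    have : (0 : ℚ) ≤ A.value (((start U).run A (greedyPrice A 0) b).sol false) := by positivity
    linarith
  have key : ((start U).run A (greedyPrice A τ) b).Valid A ∧
      ((∃ j, τ - M ≤ A.value (((start U).run A (greedyPrice A τ) b).sol j)) ∨
        ∃ δ, ((start U).run A (greedyPrice A τ) b).ChargedWith A O p τ b δ) := by
    refine run_induction (P := fun st => st.Valid A ∧
      ((∃ j, τ - M ≤ A.value (st.sol j)) ∨ ∃ δ, st.ChargedWith A O p τ b δ))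
      ⟨Valid.start hI.1 U, Or.inr (ChargedWith.start hA hOI hOU)⟩ ?_
    rintro st x ⟨hv, hst⟩ hx
    refine ⟨hv.offer (pick_candidate hx) _ _, ?_⟩
    unfold State.offer
    split_ifs with hb
    · obtain ⟨h1, h2⟩ := greedyPrice_of_le hb
      -- An accepted price is at least a nonnegative cost, so negative marginal values are never
      -- taken. Hence the values of the solutions never drop, and a target that was almost reached
      -- stays so.
      have hm0 : 0 ≤ st.marginal A x := by
        have h3 : (0 : ℚ) ≤ b x.1 := by positivity
        have h4 : 0 ≤ A.budget * st.marginal A x / τ := by linarith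
        have h5 := mul_nonneg h4 hτ
        rw [div_mul_cancel₀ _ hτ'.ne'] at h5
        exact nonneg_of_mul_nonneg_right h5 hB'
      rcases hst with ⟨j, hj⟩ | ⟨δ, hδ⟩
      · left
        refine ⟨j, hj.trans ?_⟩
        rcases eq_or_ne j x.2 with rfl | hjx
        · simp only [Function.update_self]
          simp only [marginal] at hm0
          linarith
        · simp [hjx]
      · exact Or.inr ⟨_, hδ.accept hA hτ hO hv hx hm0 _⟩
    · rcases hst with hj | ⟨δ, hδ⟩
      · exact Or.inl hj
      -- A refusal below the target means that the cost exceeds `B * m / τ` and can be charged. If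
      -- the target would be exceeded by an agent of `O`, whose marginal value is at most `M`, then
      -- the solution is already worth more than `τ - M`.
      · by_cases hover : A.value (st.sol x.2) + st.marginal A x ≤ τ
        · right
          refine ⟨δ, hδ.reject hB hτ hx fun _ => ?_⟩
          have hg : greedyPrice A τ st x.1 x.2 = A.budget * st.marginal A x / τ := if_pos hover
          rw [hg, not_le, div_lt_iff₀ hτ'] at hb
          rw [div_mul_eq_mul_div, le_div_iff₀ hB']
          linarith
        · by_cases hxO : x.1 ∈ O
          · left
            refine ⟨x.2, ?_⟩
            have h1 := hsub.insert_sub_le (Finset.empty_subset (st.sol x.2)) (i := x.1)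
              (Or.inr fun h' => hv.notMem_alive _ _ h' (pick_candidate hx).1)
            rw [h0] at h1
            have h2 := hM _ hxO
            simp only [insert_empty_eq, NNRat.cast_zero, sub_zero] at h1
            simp only [marginal] at hover
            simp only
            linarith
          · exact Or.inr ⟨δ, hδ.reject hB hτ hx fun h' => absurd h' hxO⟩
  have hp := pick_run (A := A) (greedyPrice A τ) b (start U)
  generalize (start U).run A (greedyPrice A τ) b = st at *
  obtain ⟨hv, h | ⟨δ, hδ⟩⟩ := key
  · exact Or.inl h
  · right
    -- At the end nobody is a candidate, so the lost marginal values are those of all of `O`; the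
    -- costs of `O` are within the budget and contribute at most `τ`.
    have hj : ∀ j, (A.value (O ∪ st.sol j) : ℚ) ≤
        (p + 1) * A.value (st.sol j) + A.value (st.sol !j) + τ := by
      intro j
      have h1 := hδ.charge j
      have h2 : ∑ o ∈ O, st.lost A j o = ∑ o ∈ O, st.marginal A (o, j) :=
        Finset.sum_congr rfl fun o _ => if_neg (not_candidate_of_pick hp _)
      have h3 : 0 ≤ (p * (st.sol j).card - ∑ o ∈ O, st.blocked A j o) * δ :=
        mul_nonneg (sub_nonneg.2 (hO _ (hv.indep j))) hδ.nonneg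
      have h4 : τ / A.budget * ∑ o ∈ O, spent b st o ≤ τ := by
        refine (mul_le_mul_of_nonneg_left (sum_spent_le hOb st) (by positivity)).trans ?_
        rw [div_mul_cancel₀ _ hB'.ne']
      have h5 := hsub.union_le (st.sol j) O
      rw [h2] at h1
      simp only [marginal] at h1
      linarith
    have hd : Disjoint (st.sol false) (st.sol true) :=
      Finset.disjoint_left.2 fun i hi => hv.notMem_other false i hi
    have h1 := hsub.value_le_union_add_union (O := O) hd
    have h2 := hj false
    have h3 := hj true
    simp only [Bool.not_false, Bool.not_true] at h2 h3
    linarith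

end State


/-! ### The approximation guarantee for a fixed sample -/

section Sample

variable {A : Auction n} {O : Finset (Fin n)} {p M : ℚ} {b : Fin n → ℚ≥0}

/-- The set `O` is feasible, its elements have value at most `M`, and every independent set `S`
blocks at most `p * |S|` of its elements. -/
structure IsTarget (A : Auction n) (b : Fin n → ℚ≥0) (p M : ℚ) (O : Finset (Fin n)) : Prop where
  indep : O ∈ A.indep
  cost_le : ∑ i ∈ O, b i ≤ A.budget
  value_le : ∀ o ∈ O, (A.value {o} : ℚ) ≤ M
  blocked_le : ∀ S ∈ A.indep, ∑ o ∈ O, (if insert o S ∈ A.indep then (0 : ℚ) else 1) ≤ p * S.card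

theorem IsTarget.mono (hI : IsIndependenceSystem A.indep) (h : IsTarget A b p M O)
    {O' : Finset (Fin n)} (hO : O' ⊆ O) : IsTarget A b p M O' := by
  refine ⟨hI.2 _ _ hO h.indep, (Finset.sum_le_sum_of_subset hO).trans h.cost_le,
    fun o ho => h.value_le o (hO ho), fun S hS => le_trans ?_ (h.blocked_le S hS)⟩
  refine Finset.sum_le_sum_of_subset_of_nonneg hO fun o _ _ => ?_
  split_ifs <;> norm_num

/-- Every trial produces feasible solutions, so the estimate never overshoots the optimum. -/
theorem estimate_le_opt (hA : A.IsSubmodularAuction) (R : Finset (Fin n)) (b : Fin n → ℚ≥0) :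
    estimate A R b ≤ A.opt b := by
  obtain ⟨-, hI, h0, -⟩ := hA
  refine Finset.sup_le fun i _ => Finset.sup_le fun k _ => ?_
  have hτ : (0 : ℚ) ≤ ((k : ℚ) + 1) * A.value (agent (n := n) i) := by positivity
  have hv := State.run_valid hI.1 (greedyPrice A (((k : ℚ) + 1) * A.value (agent (n := n) i))) b R
  have hp := State.run_paid hI.1 h0 hτ b R
  exact max_le (State.value_sol_le_opt hv false (hp.le_pay _) (hp.sum_pay_le hτ _))
    (State.value_sol_le_opt hv true (hp.le_pay _) (hp.sum_pay_le hτ _))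

/-- Among the trial targets there is one within `M` below the ideal target `t`. The two alternatives
of `State.run_greedy_value` then give solutions worth at least `t - 2 * M` and `t - M`. -/
theorem le_estimate (hA : A.IsSubmodularAuction) (hp : 1 ≤ p) (hM : 0 ≤ M)
    {R : Finset (Fin n)} (hO : IsTarget A b p M O) (hOR : O ⊆ R) :
    ((A.value O : ℚ) - 2 * M) / (2 * (p + 3)) - M ≤ estimate A R b := by
  have hL : (0 : ℚ) ≤ estimate A R b := by positivity
  have hp3 : 0 < 2 * (p + 3) := by linarith
  set V : ℚ := (A.value O : ℚ) with hV
  -- This `t` solves `V - 2 * t = 2 * (p + 2) * (t - M)`, so the second alternative with a target at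
  -- most `t` forces a value of at least `t - M`.
  set t : ℚ := (V + 2 * (p + 2) * M) / (2 * (p + 3)) with ht
  have htV : t * (2 * (p + 3)) = V + 2 * (p + 2) * M := div_mul_cancel₀ _ hp3.ne'
  have hgoal : (V - 2 * M) / (2 * (p + 3)) - M = t - 2 * M := by
    rw [ht]
    field_simp
    ring
  rw [hgoal]
  by_cases hVM : V ≤ 2 * M
  · have : t ≤ M := by
      rw [ht, div_le_iff₀ hp3]
      nlinarith
    linarith
  rw [not_le] at hVM
  have ht2 : t ≤ V / 2 := by
    rw [ht, div_le_iff₀ hp3]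
    nlinarith
  obtain ⟨-, hI, h0, hsub⟩ := id hA
  have hne : O.Nonempty := by
    rw [Finset.nonempty_iff_ne_empty]
    rintro rfl
    rw [h0] at hV
    simp only [NNRat.cast_zero] at hV
    linarith
  obtain ⟨i, hi, hmax⟩ := O.exists_max_image (fun i => A.value {i}) hne
  set m : ℚ := (A.value {i} : ℚ) with hm
  have hVm : V ≤ n * m := by
    have h1 := hsub.union_le ∅ O
    simp only [Finset.union_empty, insert_empty_eq, h0, NNRat.cast_zero, sub_zero, zero_add] at h1
    have h2 : ∑ o ∈ O, (A.value {o} : ℚ) ≤ O.card • m :=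
      Finset.sum_le_card_nsmul _ _ _ fun o ho => by exact_mod_cast hmax o ho
    have h3 : (O.card : ℚ) ≤ n := by
      have := Finset.card_le_univ O
      rw [Fintype.card_fin] at this
      exact_mod_cast this
    have h4 : 0 ≤ m := by positivity
    rw [nsmul_eq_mul] at h2
    nlinarith
  have hm0 : 0 < m := by
    by_contra h
    have h4 : m = 0 := le_antisymm (not_lt.1 h) (by positivity)
    rw [h4, mul_zero] at hVm
    linarith
  have hmM : m ≤ M := hO.value_le i hi
  have ht0 : 0 ≤ t := by positivity
  have hfl := Nat.floor_le (div_nonneg ht0 hm0.le)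
  have hlt := Nat.lt_floor_add_one (t / m)
  rw [le_div_iff₀ hm0] at hfl
  rw [div_lt_iff₀ hm0] at hlt
  -- The target is the largest multiple of `m` that is at most `t`. A zero multiple means `t < m ≤
  -- M`, where the claim is trivial; otherwise `t ≤ V / 2` and `V ≤ n * m` put the multiplier in the
  -- range of the trials.
  rcases hk : ⌊t / m⌋₊ with _ | k
  · rw [hk] at hlt
    simp only [Nat.cast_zero, zero_add, one_mul] at hlt
    linarith
  rw [hk] at hfl hlt
  push_cast at hfl hlt
  have hkn : k < n := by
    have : ((k : ℚ) + 1) * m ≤ n * m := by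
      have hV0 : 0 ≤ V := by positivity
      linarith
    have := le_of_mul_le_mul_right this hm0
    exact_mod_cast this
  have htrial : trialValue A R b i k ≤ estimate A R b :=
    (Finset.le_sup (f := fun k => trialValue A R b i k) (Finset.mem_range.2 hkn)).trans
      (Finset.le_sup (f := fun i => (Finset.range n).sup fun k => trialValue A R b i k)
        (Finset.mem_range.2 i.2))
  have hτ : (0 : ℚ) ≤ ((k : ℚ) + 1) * A.value {i} := by positivity
  have hrun := State.run_greedy_value hA hτ hM hO.blocked_le hO.indep hO.cost_le hO.value_le hOR
  rw [trialValue, agent_val] at htrial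
  have hsol : ∀ j, (A.value (((State.start R).run A
      (greedyPrice A (((k : ℚ) + 1) * A.value {i})) b).sol j) : ℚ) ≤ estimate A R b := by
    intro j
    cases j
    · exact_mod_cast (le_max_left _ _).trans htrial
    · exact_mod_cast (le_max_right _ _).trans htrial
  rcases hrun with ⟨j, hj⟩ | h
  · have := hsol j
    linarith
  · have h1 := hsol false
    have h2 := hsol true
    rw [← hV] at h
    have h3 : V ≤ 2 * (p + 2) * estimate A R b + 2 * t := by nlinarith
    by_contra hcon
    rw [not_le] at hcon
    nlinarith

/-- The sum of the values of the two solutions of the greedy mechanism. -/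
def greedyValue (A : Auction n) (R : Finset (Fin n)) (b : Fin n → ℚ≥0) : ℚ :=
  A.value ((finalState A R true b).sol false) + A.value ((finalState A R true b).sol true)

/-- A lower bound on the value of the solutions by a quadratic function of the weight of the sample. -/
theorem quadratic_le_greedyValue (hA : A.IsSubmodularAuction) (hp : 1 ≤ p) (hM : 0 ≤ M)
    (hO : IsTarget A b p M O) (hopt : A.opt b = A.value O) {w : Fin n → ℚ}
    (hw : ∑ i ∈ O, w i = A.value O) (hwT : ∀ T ⊆ O, ∑ i ∈ T, w i ≤ A.value T)
    (R : Finset (Fin n)) :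
    (A.value O : ℚ) ^ 2 / 24 + A.value O * (∑ i ∈ O ∩ R, w i - A.value O / 2) / 12 -
        5 / 2 * (∑ i ∈ O ∩ R, w i - A.value O / 2) ^ 2 ≤
      A.value O * ((p + 3) * greedyValue A R b + (M / 6 + 7 * M * (p + 3) / 6)) := by
  have hI := hA.2.1
  have hL1 := le_estimate hA hp hM (hO.mono hI (Finset.inter_subset_left (s₂ := R)))
    Finset.inter_subset_right
  have hL2 : (estimate A R b : ℚ) ≤ A.value O := by
    have := estimate_le_opt hA R b
    rw [hopt] at this
    exact_mod_cast this
  have hL0 : (0 : ℚ) ≤ estimate A R b := by positivity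
  have h1 := hwT (O ∩ R) Finset.inter_subset_left
  have h2 := hwT (O \ R) Finset.sdiff_subset
  have h3 : ∑ i ∈ O ∩ R, w i + ∑ i ∈ O \ R, w i = A.value O := by
    rw [Finset.sum_inter_add_sum_sdiff, hw]
  have hOR : O \ R ⊆ Rᶜ := fun i hi => by
    rw [Finset.mem_compl]
    exact (Finset.mem_sdiff.1 hi).2
  have hO2 := hO.mono hI (Finset.sdiff_subset (s := O) (t := R))
  have hrun := State.run_greedy_value hA (τ := (estimate A R b : ℚ) / 6) (by positivity) hM
    hO2.blocked_le hO2.indep hO2.cost_le hO2.value_le hOR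
  have hZ : greedyValue A R b = A.value (((State.start Rᶜ).run A
      (greedyPrice A ((estimate A R b : ℚ) / 6)) b).sol false) + A.value (((State.start Rᶜ).run A
      (greedyPrice A ((estimate A R b : ℚ) / 6)) b).sol true) := rfl
  rw [← hZ] at hrun
  have hZj : ∀ j, (A.value (((State.start Rᶜ).run A
      (greedyPrice A ((estimate A R b : ℚ) / 6)) b).sol j) : ℚ) ≤ greedyValue A R b := by
    intro j
    rw [hZ]
    cases j
    · exact le_add_of_nonneg_right (by positivity)
    · exact le_add_of_nonneg_left (by positivity)
  have hZ0 : 0 ≤ greedyValue A R b := by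
    rw [hZ]
    positivity
  have hW0 : (0 : ℚ) ≤ A.value O := by positivity
  generalize (A.value O : ℚ) = W at *
  generalize (A.value (O ∩ R) : ℚ) = V1 at *
  generalize (A.value (O \ R) : ℚ) = V2 at *
  generalize ∑ i ∈ O ∩ R, w i = X at *
  generalize ∑ i ∈ O \ R, w i = X2 at *
  generalize greedyValue A R b = Z at *
  generalize (estimate A R b : ℚ) = L at *
  have hp3 : 0 < 2 * (p + 3) := by linarith
  -- If the target is almost reached, the value is controlled by the estimate and grows with the
  -- sampled weight `X`. Otherwise it is controlled by the unsampled weight `W - X`, less `2 * L / 6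
  -- ≤ W / 3`. One quadratic lies below both linear bounds.
  rcases hrun with ⟨j, hj⟩ | hrun
  · have h4 : L / 6 - M ≤ Z := hj.trans (hZj j)
    have h5 : V1 - 2 * M ≤ (L + M) * (2 * (p + 3)) := by
      rw [← div_le_iff₀ hp3]
      linarith
    have h6 : X / 12 ≤ (p + 3) * Z + (M / 6 + 7 * M * (p + 3) / 6) := by nlinarith
    have h7 := mul_le_mul_of_nonneg_left h6 hW0
    nlinarith [sq_nonneg (X - W / 2)]
  · have h4 : 2 * W / 3 - X ≤ (p + 3) * Z + (M / 6 + 7 * M * (p + 3) / 6) := by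
      have : 0 ≤ M * (p + 3) := by positivity
      nlinarith
    have h5 := mul_le_mul_of_nonneg_left h4 hW0
    -- With `D = X - W / 2` the difference is `W ^ 2 / 8 - 13 / 12 * W * D + 5 / 2 * D ^ 2`;
    -- completing the square at `D = 13 / 60 * W` leaves a positive multiple of `W ^ 2`.
    nlinarith [sq_nonneg (X - W / 2 - 13 / 60 * W), sq_nonneg W]

end Sample

/-! ### Sums over independent coin tosses -/

section Coins

variable {ι : Type*} [Fintype ι] [DecidableEq ι]

/-- Flipping coin `k` is an involution of the outcomes. Conditioning on a single coin is expressed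
in this form throughout. -/
theorem sum_update_coin (f : (ι → Bool) → ℚ) (k : ι) :
    ∑ ω, (f (Function.update ω k true) + f (Function.update ω k false)) = 2 * ∑ ω, f ω := by
  have hinv : Function.Involutive fun ω : ι → Bool => Function.update ω k (!ω k) := by
    intro ω
    simp
  have h1 : ∑ ω : ι → Bool, f (Function.update ω k (!ω k)) = ∑ ω, f ω :=
    hinv.bijective.sum_comp f
  calc _ = ∑ ω : ι → Bool, (f ω + f (Function.update ω k (!ω k))) := by
        refine Finset.sum_congr rfl fun ω _ => ?_
        have h2 : Function.update ω k (ω k) = ω := Function.update_eq_self k ω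
        cases hk : ω k
        · rw [hk] at h2
          rw [h2, Bool.not_false, add_comm]
        · rw [hk] at h2
          rw [h2, Bool.not_true]
    _ = 2 * ∑ ω, f ω := by
        rw [Finset.sum_add_distrib, h1]
        ring

/-- The sign of a coin toss. -/
def sign (x : Bool) : ℚ := if x then 1 else -1

theorem sum_sign_mul_eq_zero {f : (ι → Bool) → ℚ} {k : ι}
    (hf : ∀ ω x, f (Function.update ω k x) = f ω) : ∑ ω, sign (ω k) * f ω = 0 := by
  have h := sum_update_coin (fun ω => sign (ω k) * f ω) k
  simp only [Function.update_self, hf] at h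
  have h0 : sign true = 1 ∧ sign false = -1 := ⟨rfl, rfl⟩
  simp only [h0.1, h0.2, one_mul, neg_one_mul, add_neg_cancel, Finset.sum_const_zero] at h
  linarith

variable {κ : Type*}

theorem sum_sum_sign (O : Finset κ) (e : κ → ι) (a : κ → ℚ) :
    ∑ ω : ι → Bool, ∑ i ∈ O, a i * sign (ω (e i)) = 0 := by
  rw [Finset.sum_comm]
  refine Finset.sum_eq_zero fun i _ => ?_
  rw [← Finset.mul_sum]
  have := sum_sign_mul_eq_zero (f := fun _ => 1) (k := e i) fun _ _ => rfl
  simp only [mul_one] at this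
  rw [this, mul_zero]

/-- Distinct coins give uncorrelated signs, so the mixed terms vanish. -/
theorem sum_sq_sum_sign [DecidableEq κ] (O : Finset κ) (e : κ → ι) (he : Function.Injective e) (a : κ → ℚ) :
    ∑ ω : ι → Bool, (∑ i ∈ O, a i * sign (ω (e i))) ^ 2 =
      Fintype.card (ι → Bool) * ∑ i ∈ O, a i ^ 2 := by
  induction O using Finset.induction_on with
  | empty => simp
  | insert i O hi ih =>
    have h0 := sum_sign_mul_eq_zero (f := fun ω => ∑ j ∈ O, a j * sign (ω (e j))) (k := e i) (by
      intro ω x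
      refine Finset.sum_congr rfl fun j hj => ?_
      rw [Function.update_of_ne]
      intro h
      exact hi (he h ▸ hj))
    have h1 : ∀ ω : ι → Bool, (∑ j ∈ insert i O, a j * sign (ω (e j))) ^ 2 =
        a i ^ 2 + 2 * a i * (sign (ω (e i)) * ∑ j ∈ O, a j * sign (ω (e j))) +
          (∑ j ∈ O, a j * sign (ω (e j))) ^ 2 := by
      intro ω
      have h2 : sign (ω (e i)) ^ 2 = 1 := by
        unfold sign
        split_ifs <;> norm_num
      rw [Finset.sum_insert hi]
      linear_combination a i ^ 2 * h2
    simp only [h1]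
    rw [Finset.sum_add_distrib, Finset.sum_add_distrib, ← Finset.mul_sum, h0, ih,
      Finset.sum_insert hi, Finset.sum_const, Finset.card_univ, nsmul_eq_mul]
    ring

end Coins


namespace Program

/-! ### The approximation guarantee -/

section Expectation

variable {A : Auction n} {O : Finset (Fin n)} {p M : ℚ} {b : Fin n → ℚ≥0}

/-- The coin toss with number `k`. -/
def coin (k : ℕ) (hk : k < n + 2) : Fin (program.coins.eval n) := ⟨k, by rwa [coins_eval]⟩

theorem toss_coin (ω : program.Coins n) {k : ℕ} (hk : k < n + 2) :
    toss ω k = ω (coin k hk) := by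
  have : k < program.coins.eval n := by rwa [coins_eval]
  simp [toss, coin, this]

theorem mem_sample (ω : program.Coins n) (i : Fin n) :
    i ∈ (sample (toss ω) : Finset (Fin n)) ↔ ω (coin i (by omega)) = true := by
  simp [sample, toss_coin ω (show (i : ℕ) < n + 2 by omega)]

theorem coin_ne {k l : ℕ} {hk : k < n + 2} {hl : l < n + 2} (h : k ≠ l) : coin k hk ≠ coin l hl := by
  simpa [coin] using h

theorem sample_update (ω : program.Coins n) {k : ℕ} (hk : k < n + 2) (hn : n ≤ k) (x : Bool) :
    (sample (toss (Function.update ω (coin k hk) x)) : Finset (Fin n)) = sample (toss ω) := by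
  ext i
  rw [mem_sample, mem_sample, Function.update_of_ne (coin_ne (by omega))]

theorem sum_inter_sample (w : Fin n → ℚ) (O : Finset (Fin n)) (ω : program.Coins n) :
    2 * (∑ i ∈ O ∩ sample (toss ω), w i - (∑ i ∈ O, w i) / 2) =
      ∑ i ∈ O, w i * sign (ω (coin i (by omega))) := by
  have h : ∑ i ∈ O ∩ sample (toss ω), w i =
      ∑ i ∈ O, if ω (coin i (by omega)) = true then w i else 0 := by
    rw [← Finset.sum_filter]
    refine Finset.sum_congr ?_ fun _ _ => rfl
    ext i
    simp [mem_sample]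
  have h2 : ∑ i ∈ O, w i * sign (ω (coin i (by omega))) =
      ∑ i ∈ O, (2 * (if ω (coin i (by omega)) = true then w i else 0) - w i) := by
    refine Finset.sum_congr rfl fun i _ => ?_
    unfold sign
    split_ifs <;> ring
  rw [h, h2, Finset.sum_sub_distrib, ← Finset.mul_sum]
  ring

/-- The expected value of the two solutions of the greedy mechanism. -/
theorem le_sum_greedyValue (hA : A.IsSubmodularAuction) (hp : 1 ≤ p) (hM : 0 ≤ M)
    (hO : IsTarget A b p M O) (hopt : A.opt b = A.value O) :
    (Fintype.card (program.Coins n) : ℚ) * (A.value O / 24 - 2 * M * (p + 3)) ≤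
      (p + 3) * ∑ ω : program.Coins n, greedyValue A (sample (toss ω)) b := by
  have hZ0 : ∀ R, 0 ≤ greedyValue A R b := by
    intro R
    unfold greedyValue
    positivity
  have hcard : (0 : ℚ) ≤ Fintype.card (program.Coins n) := by positivity
  obtain ⟨w, hw, hwT⟩ := hA.2.2.2.exists_weights hA.2.2.1 O
  -- The quadratic bound carries a factor `v(O)` that is cancelled at the end, so a zero optimum is
  -- treated separately.
  rcases (show (0 : ℚ) ≤ A.value O by positivity).eq_or_lt with hW | hW
  · rw [← hW]
    have h1 : 0 ≤ (p + 3) * ∑ ω : program.Coins n, greedyValue A (sample (toss ω)) b :=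
      mul_nonneg (by linarith) (Finset.sum_nonneg fun ω _ => hZ0 _)
    have h2 : 0 ≤ M * (p + 3) := by positivity
    nlinarith
  -- Although `v` need not be monotone, removing an element from the optimal set keeps it feasible
  -- and cannot raise its value.
  have hw0 : ∀ i ∈ O, 0 ≤ w i := by
    intro i hi
    have h1 := hwT (O.erase i) (Finset.erase_subset _ _)
    have h2 : A.value (O.erase i) ≤ A.value O := by
      rw [← hopt]
      refine Finset.le_sup (f := A.value) (Finset.mem_filter.2 ⟨?_, ?_⟩)
      · exact hA.2.1.2 _ _ (Finset.erase_subset _ _) hO.indep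
      · exact (Finset.sum_le_sum_of_subset (Finset.erase_subset _ _)).trans hO.cost_le
    have h3 : (A.value (O.erase i) : ℚ) ≤ A.value O := by exact_mod_cast h2
    have h4 := Finset.add_sum_erase O w hi
    linarith
  have hwM : ∀ i ∈ O, w i ≤ M := by
    intro i hi
    have h1 := hwT {i} (Finset.singleton_subset_iff.2 hi)
    rw [Finset.sum_singleton] at h1
    exact h1.trans (hO.value_le i hi)
  -- This is the variance bound: all weights lie between `0` and `M`.
  have hsq : ∑ i ∈ O, w i ^ 2 ≤ M * A.value O := by
    rw [← hw, Finset.mul_sum]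
    refine Finset.sum_le_sum fun i hi => ?_
    nlinarith [hw0 i hi, hwM i hi]
  have he : Function.Injective fun i : Fin n => coin (n := n) i (by omega) := by
    intro i j hij
    by_contra h
    exact coin_ne (fun h' => h (Fin.ext h')) hij
  have h1 := sum_sum_sign O (fun i : Fin n => coin (n := n) i (by omega)) w
  have h2 := sum_sq_sum_sign O _ he w
  have h3 := Finset.sum_le_sum fun (ω : program.Coins n) (_ : ω ∈ Finset.univ) =>
    quadratic_le_greedyValue hA hp hM hO hopt hw hwT (sample (toss ω))
  have h4 : ∀ ω : program.Coins n, ∑ i ∈ O ∩ sample (toss ω), w i - (A.value O : ℚ) / 2 =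
      (∑ i ∈ O, w i * sign (ω (coin i (by omega)))) / 2 := by
    intro ω
    rw [← sum_inter_sample, hw]
    ring
  simp only [h4] at h3
  have h5 : ∑ ω : program.Coins n, ((A.value O : ℚ) ^ 2 / 24 +
      A.value O * ((∑ i ∈ O, w i * sign (ω (coin i (by omega)))) / 2) / 12 -
      5 / 2 * ((∑ i ∈ O, w i * sign (ω (coin i (by omega)))) / 2) ^ 2) =
      Fintype.card (program.Coins n) * ((A.value O : ℚ) ^ 2 / 24 - 5 / 8 * ∑ i ∈ O, w i ^ 2) := by
    have h6 : ∀ y : ℚ, (A.value O : ℚ) ^ 2 / 24 + A.value O * (y / 2) / 12 - 5 / 2 * (y / 2) ^ 2 =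
        (A.value O : ℚ) ^ 2 / 24 + (A.value O : ℚ) / 24 * y - 5 / 8 * y ^ 2 := by
      intro y
      ring
    simp only [h6]
    rw [Finset.sum_sub_distrib, Finset.sum_add_distrib, ← Finset.mul_sum, ← Finset.mul_sum, h1, h2,
      Finset.sum_const, Finset.card_univ, nsmul_eq_mul]
    ring
  rw [h5, ← Finset.mul_sum, Finset.sum_add_distrib, ← Finset.mul_sum, Finset.sum_const,
    Finset.card_univ, nsmul_eq_mul] at h3
  generalize (Fintype.card (program.Coins n) : ℚ) = N at *
  generalize ∑ ω : program.Coins n, greedyValue A (sample (toss ω)) b = Z at *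
  generalize ∑ i ∈ O, w i ^ 2 = Q at *
  generalize (A.value O : ℚ) = W at *
  have h7 : W * (N * (W / 24 - 5 / 8 * M)) ≤
      W * ((p + 3) * Z + N * (M / 6 + 7 * M * (p + 3) / 6)) := by
    refine le_trans ?_ h3
    have := mul_le_mul_of_nonneg_left hsq hcard
    linarith
  have h8 := le_of_mul_le_mul_left h7 hW
  have h9 : 0 ≤ N * (M * (p - 1)) := mul_nonneg hcard (mul_nonneg hM (by linarith))
  have h10 : 0 ≤ N * M := mul_nonneg hcard hM
  linarith

/-- The value of the single winner in the second mode. -/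
theorem le_value_single (hA : A.IsSubmodularAuction) (hO : O ∈ A.indep)
    (hb : ∑ i ∈ O, b i ≤ A.budget) (R : Finset (Fin n)) (c : Bool) {o : Fin n} (ho : o ∈ O) :
    A.value {o} ≤ A.value ((sampleMechanism A R false c).winners b) := by
  rw [sampleMechanism_winners_false]
  refine State.SinglePaid.value_le (State.run_singlePaid b) (State.pick_run _ _ _) ?_ ?_
  · exact hA.2.1.2 _ _ (Finset.singleton_subset_iff.2 ho) hO
  · exact (Finset.single_le_sum (f := b) (fun _ _ => zero_le) ho).trans hb

/-- The last two coins give four equally likely cases: the two greedy solutions, and twice the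
single winner of value at least `M`. After multiplication by `p + 3` the summand `2 * M` cancels
exactly the loss in `le_sum_greedyValue`, and the factor is `4 * 24 = 96`. -/
theorem value_le_expectedValue (hA : A.IsSubmodularAuction) (hp : 1 ≤ p)
    (hO : IsTarget A b p (O.sup fun o => A.value {o} : ℚ≥0) O) (hopt : A.opt b = A.value O) :
    (A.value O : ℚ) ≤ 96 * (p + 3) * program.expectedValue A b := by
  set M : ℚ≥0 := O.sup fun o => A.value {o} with hM
  set f : program.Coins n → ℚ := fun ω => A.value ((program.mechanism A ω).winners b) with hf
  have hfm : ∀ ω, f ω = A.value ((sampleMechanism A (sample (toss ω)) (toss ω n)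
      (toss ω (n + 1))).winners b) := by
    intro ω
    rw [hf]
    simp only
    rw [mechanism_eq hA.2.1.1]
  have hn : n < n + 2 := by omega
  have hn1 : n + 1 < n + 2 := by omega
  have hup : ∀ ω g c, f (Function.update (Function.update ω (coin (n + 1) hn1) c) (coin n hn) g) =
      A.value ((sampleMechanism A (sample (toss ω)) g c).winners b) := by
    intro ω g c
    rw [hfm, sample_update _ hn le_rfl, sample_update _ hn1 (by omega), toss_coin _ hn,
      toss_coin _ hn1, Function.update_self, Function.update_of_ne (coin_ne (by omega)),
      Function.update_self]
  have h1 : ∑ ω, ((f (Function.update (Function.update ω (coin (n + 1) hn1) true) (coin n hn) true) +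
      f (Function.update (Function.update ω (coin (n + 1) hn1) true) (coin n hn) false)) +
      (f (Function.update (Function.update ω (coin (n + 1) hn1) false) (coin n hn) true) +
      f (Function.update (Function.update ω (coin (n + 1) hn1) false) (coin n hn) false))) =
      4 * ∑ ω, f ω := by
    have h2 := sum_update_coin f (coin n hn)
    have h3 := sum_update_coin (fun ω => f (Function.update ω (coin n hn) true) +
      f (Function.update ω (coin n hn) false)) (coin (n + 1) hn1)
    rw [h3, h2]
    ring
  have h4 : ∑ ω : program.Coins n, (2 * (M : ℚ) + greedyValue A (sample (toss ω)) b) ≤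
      4 * ∑ ω, f ω := by
    rw [← h1]
    refine Finset.sum_le_sum fun ω _ => ?_
    rw [hup, hup, hup, hup, sampleMechanism_winners_true, sampleMechanism_winners_true]
    have hs : ∀ c, (M : ℚ) ≤
        A.value ((sampleMechanism A (sample (toss ω)) false c).winners b) := by
      intro c
      have : M ≤ A.value ((sampleMechanism A (sample (toss ω)) false c).winners b) :=
        Finset.sup_le fun o ho => le_value_single hA hO.indep hO.cost_le _ _ ho
      exact_mod_cast this
    have h5 := hs true
    have h6 := hs false
    unfold greedyValue
    linarith
  rw [Finset.sum_add_distrib, Finset.sum_const, Finset.card_univ, nsmul_eq_mul] at h4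
  have h5 := le_sum_greedyValue hA hp (by positivity) hO hopt
  have hE : (program.expectedValue A b : ℚ) * Fintype.card (program.Coins n) = ∑ ω, f ω := by
    have : (Fintype.card (program.Coins n) : ℚ) ≠ 0 := by exact_mod_cast Fintype.card_ne_zero
    unfold RandomizedProgram.expectedValue
    push_cast
    rw [div_mul_cancel₀ _ this]
  have hN : (0 : ℚ) < Fintype.card (program.Coins n) := by exact_mod_cast Fintype.card_pos
  refine le_of_mul_le_mul_left ?_ hN
  have h6 := mul_le_mul_of_nonneg_left h4 (show 0 ≤ p + 3 by linarith)
  rw [← hE] at h6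
  linarith

end Expectation

theorem approximation {A : Auction n} (hA : A.IsSubmodularAuction) {p : ℝ}
    (hp : IsPSystem A.indep p) (b : Fin n → ℚ≥0) {C : ℝ} (hC : 96 ≤ C) :
    (A.opt b : ℝ) ≤ C * (p + 10) * (program.expectedValue A b : ℝ) := by
  obtain ⟨O, hO, hopt⟩ := Finset.exists_mem_eq_sup
    (A.indep.filter fun S => ∑ i ∈ S, b i ≤ A.budget)
    ⟨∅, Finset.mem_filter.2 ⟨hA.2.1.1, by simp⟩⟩ A.value
  rw [Finset.mem_filter] at hO
  have hopt' : A.opt b = A.value O := hopt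
  -- If only the empty set is independent, `p` may be any real number, even negative, but both sides
  -- vanish.
  by_cases hne : ∃ T ∈ A.indep, T.Nonempty
  · obtain ⟨T, hT, hTne⟩ := hne
    have h1 := hp.one_le hT hTne
    -- The charging argument is carried out over the rationals, so `p` is rounded up to a rational
    -- below `p + 1`; the slack in `p + 10` absorbs this.
    obtain ⟨q, hq1, hq2⟩ := exists_rat_btwn (show p < p + 1 by linarith)
    have hq : (1 : ℚ) ≤ q := by exact_mod_cast h1.trans hq1.le
    have htarget : IsTarget A b q (O.sup fun o => A.value {o} : ℚ≥0) O := by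
      refine ⟨hO.1, hO.2, fun o ho => ?_, fun S hS => ?_⟩
      · have := Finset.le_sup (f := fun o => A.value {o}) ho
        exact_mod_cast this
      · have h2 := hp.card_le (by linarith) hS
          (hA.2.1.2 _ _ (Finset.filter_subset (fun o => insert o S ∉ A.indep) O) hO.1)
          fun o ho => (Finset.mem_filter.1 ho).2
        have h3 : ∑ o ∈ O, (if insert o S ∈ A.indep then (0 : ℚ) else 1) =
            ((O.filter fun o => insert o S ∉ A.indep).card : ℚ) := by
          rw [Finset.card_filter]
          push_cast
          refine Finset.sum_congr rfl fun o _ => ?_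
          split_ifs <;> simp_all
        rw [h3]
        have h4 : (p : ℝ) * S.card ≤ q * S.card :=
          mul_le_mul_of_nonneg_right hq1.le (by positivity)
        exact_mod_cast h2.trans h4
    have h2 := value_le_expectedValue hA hq htarget hopt'
    have h3 : (A.value O : ℝ) ≤ 96 * ((q : ℝ) + 3) * (program.expectedValue A b : ℝ) := by
      exact_mod_cast h2
    rw [hopt']
    refine h3.trans (mul_le_mul_of_nonneg_right ?_ (by positivity))
    nlinarith
  · have hI : ∀ T ∈ A.indep, A.value T = 0 := by
      intro T hT
      rw [Finset.not_nonempty_iff_eq_empty.1 fun h => hne ⟨T, hT, h⟩, hA.2.2.1]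
    have h1 : program.expectedValue A b = 0 := by
      unfold RandomizedProgram.expectedValue
      rw [Finset.sum_eq_zero, zero_div]
      intro ω _
      rw [mechanism_eq hA.2.1.1]
      exact hI _ (sampleMechanism_winners_mem hA.2.1.1 b)
    rw [hopt', hI O hO.1, h1]
    simp

theorem solves {K : ∀ n : ℕ, Auction n → Prop} (hK : ∀ n A, K n A → A.IsSubmodularAuction) {C : ℝ}
    (hC : 96 ≤ C) : program.Solves K fun p => C * (p + 10) where
  polynomialTime := polynomialTime K
  universallyTruthful n A hA ω := by
    rw [mechanism_eq (hK n A hA).2.1.1]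
    exact sampleMechanism_truthful
  individuallyRational n A hA ω := by
    rw [mechanism_eq (hK n A hA).2.1.1]
    exact sampleMechanism_individuallyRational
  paysOnlyWinners n A hA ω := by
    rw [mechanism_eq (hK n A hA).2.1.1]
    exact sampleMechanism_paysOnlyWinners
  budgetFeasible n A hA ω := by
    rw [mechanism_eq (hK n A hA).2.1.1]
    exact sampleMechanism_budgetFeasible (hK n A hA).2.1.1 (hK n A hA).2.2.1
  independent n A hA ω b := by
    rw [mechanism_eq (hK n A hA).2.1.1]
    exact sampleMechanism_winners_mem (hK n A hA).2.1.1 b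
  approximation n A hA _ hp c := approximation (hK n A hA) hp c hC

end Program

end Procurement

theorem mainTheorem3 :
    (∃ P : Procurement.RandomizedProgram,
      P.Solves (fun _ A => A.IsSubmodularAuction ∧ Monotone A.value)
        (fun p => 138 * (p + 10))) ∧
    (∃ P : Procurement.RandomizedProgram,
      P.Solves (fun _ A => A.IsSubmodularAuction)
        (fun p => 410 * (p + 10))) :=
  ⟨⟨Procurement.Program.program, Procurement.Program.solves (fun _ _ h => h.1) (by norm_num)⟩,
    ⟨Procurement.Program.program, Procurement.Program.solves (fun _ _ h => h) (by norm_num)⟩⟩
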